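/- Let $\ell,m\ge 3$ be integers with $(\ell-2)(m-2)>4$, and let $X_{\ell,m}$ be the $1$-skeleton of the tessellation of the hyperbolic plane by regular $m$-gons, $\ell$ of them meeting at each vertex. Fix any vertex $x_0$ of $X_{\ell,m}$ and let $F_{\ell,m}(X)=\sum_{x}X^{d(x_0,x)}\in\mathbb Z[[X]]$ be the growth series, where the sum is over the vertices of $X_{\ell,m}$ and $d$ is the graph distance. Then $F_{\ell,m}=N_m/D_{\ell,m}$ where, for $m=2w$ even, $$N_m=1+2\sum_{i=1}^{w-1}X^i+X^w,\qquad D_{\ell,m}=1-(\ell-2)\sum_{i=1}^{w-1}X^i+X^w,$$ and, for $m=2w+1$ odd, $$N_m=1+2\sum_{i=1}^{2w-1}X^i+2X^w+X^{2w},\qquad D_{\ell,m}=1-(\ell-2)\sum_{i=1}^{2w-1}X^i+2X^w+X^{2w}.$$ The denominator $D_{\ell,m}$ is a reciprocal Salem polynomial. Here a polynomial $f=\sum_{i=0}^n f_iX^i$ with $f_n\ne0$ is reciprocal if $f_i=f_{n-i}$ for all $i$, and $f\in\mathbb Z[X]$ is a Salem polynomial if it is monic and has exactly one complex root of modulus greater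 than $1$, and this root is simple. Moreover $D_{\ell,m}=T\cdot S$ with $S\in\mathbb Z[X]$ irreducible, where $T$ is the product of those of the following factors whose condition holds (so $T=1$ if no condition holds): - $X+1$, if $m\equiv2\pmod 4$; - $X^2-X+1$, if $\ell=3$ and $m\equiv4\pmod{12}$; - $X^2+X+1$, if $\ell=3$ and $m\equiv3\pmod 6$; - $X^4-X^3+X^2-X+1$, if $\ell=3$ and $m\equiv5\pmod{20}$; - $X^2+1$, if $\ell=4$ and $m\equiv3\pmod 8$; - $X^2-X+1$, if $\ell=5$ and $m\equiv3\pmod{12}$. In particular, outside the last five (exceptional) cases, $D_{\ell,m}$ (divided by $X+1$ if $m\equiv2\pmod4$) is irreducible. -/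

import Mathlib

open Polynomial

/-- The rotation group of the tessellation by regular `m`-gons with `ℓ` of them at each vertex:
the von Dyck group `⟨x, y ∣ x ^ ℓ = y ^ 2 = (x y) ^ m = 1⟩`, where `x = 0` is the rotation about
a vertex, `y = 1` the half-turn about the midpoint of an edge at that vertex and `x y` the rotation
about the centre of a face. It acts simply transitively on the oriented edges. -/
def tessRels (ℓ m : ℕ) : Set (FreeGroup (Fin 2)) :=
  {FreeGroup.of 0 ^ ℓ, FreeGroup.of 1 ^ 2, (FreeGroup.of 0 * FreeGroup.of 1) ^ m}

/-- The group presented by `tessRels ℓ m`. -/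
abbrev TessGroup (ℓ m : ℕ) : Type := PresentedGroup (tessRels ℓ m)

/-- The rotation by `2π/ℓ` about the base vertex. -/
def vertexRot (ℓ m : ℕ) : TessGroup ℓ m := PresentedGroup.of 0

/-- The half-turn about the midpoint of the base edge. -/
def edgeRot (ℓ m : ℕ) : TessGroup ℓ m := PresentedGroup.of 1

/-- The vertices of the tessellation: left cosets of the stabilizer of the base vertex. -/
abbrev TessVertex (ℓ m : ℕ) : Type := TessGroup ℓ m ⧸ Subgroup.zpowers (vertexRot ℓ m)

/-- The graph `X_{ℓ,m}`, the 1-skeleton of the tessellation: its edges are the translates of the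
base edge, which joins the base vertex to its image under the half-turn `edgeRot ℓ m`. -/
def tessGraph (ℓ m : ℕ) : SimpleGraph (TessVertex ℓ m) :=
  SimpleGraph.fromRel fun v w =>
    ∃ g : TessGroup ℓ m,
      v = (g : TessVertex ℓ m) ∧ w = ((g * edgeRot ℓ m : TessGroup ℓ m) : TessVertex ℓ m)

/-- The growth series `∑ₙ #{x : d(x₀, x) = n} Xⁿ` of a graph with respect to a base point. -/
noncomputable def growthSeries {V : Type*} (G : SimpleGraph V) (x₀ : V) : PowerSeries ℤ :=
  PowerSeries.mk fun n => (Set.ncard {x : V | G.edist x₀ x = n} : ℤ)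

/-- `1 + a X + a X² + ⋯ + a X^(b-1) + X^b`. -/
noncomputable def plateau (a : ℤ) (b : ℕ) : ℤ[X] :=
  1 + C a * ∑ i ∈ Finset.Ico 1 b, X ^ i + X ^ b

/-- The numerator: `1 + 2X + ⋯ + 2X^(w-1) + X^w` if `m = 2w`, and
`1 + 2X + ⋯ + 4X^w + ⋯ + 2X^(2w-1) + X^(2w)` if `m = 2w + 1`. -/
noncomputable def growthNum (m : ℕ) : ℤ[X] :=
  if Even m then plateau 2 (m / 2)
  else plateau 2 (2 * (m / 2)) + 2 * X ^ (m / 2)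

/-- The denominator: `1 - (ℓ-2)X - ⋯ - (ℓ-2)X^(w-1) + X^w` if `m = 2w`, and
`1 - (ℓ-2)X - ⋯ - (ℓ-4)X^w - ⋯ - (ℓ-2)X^(2w-1) + X^(2w)` if `m = 2w + 1`. -/
noncomputable def growthDenom (ℓ m : ℕ) : ℤ[X] :=
  if Even m then plateau (2 - (ℓ : ℤ)) (m / 2)
  else plateau (2 - (ℓ : ℤ)) (2 * (m / 2)) + 2 * X ^ (m / 2)

/-- `f = f₀ + f₁ X + ⋯ + fₙ Xⁿ` with `fₙ ≠ 0` is reciprocal if `fᵢ = fₙ₋ᵢ` for all `i`. -/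
def IsReciprocalPoly (f : ℤ[X]) : Prop :=
  f ≠ 0 ∧ ∀ i ≤ f.natDegree, f.coeff i = f.coeff (f.natDegree - i)

/-- A Salem polynomial: monic, with exactly one complex root of modulus `> 1`, which is simple. -/
def IsSalemPoly (f : ℤ[X]) : Prop :=
  f.Monic ∧ ∃ z : ℂ, 1 < ‖z‖ ∧ (f.map (Int.castRingHom ℂ)).rootMultiplicity z = 1 ∧
    ∀ u : ℂ, (f.map (Int.castRingHom ℂ)).IsRoot u → 1 < ‖u‖ → u = z

/-- The product of the cyclotomic factors of the five exceptional cases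
(equal to `1` outside of these cases). -/
noncomputable def exceptionalFactor (ℓ m : ℕ) : ℤ[X] :=
  (if ℓ = 3 ∧ m % 12 = 4 then X ^ 2 - X + 1 else 1) *
  (if ℓ = 3 ∧ m % 6 = 3 then X ^ 2 + X + 1 else 1) *
  (if ℓ = 3 ∧ m % 20 = 5 then X ^ 4 - X ^ 3 + X ^ 2 - X + 1 else 1) *
  (if ℓ = 4 ∧ m % 8 = 3 then X ^ 2 + 1 else 1) *
  (if ℓ = 5 ∧ m % 12 = 3 then X ^ 2 - X + 1 else 1)

/-! Growth series. Arrange the vertices in layers by distance from the base vertex and consider the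
gap between two neighbours in a layer; its age says how many layers ago the face count in that gap
began. For `m = 2w` a face starts at a vertex, is cut by `w - 1` layers and ends at a vertex with
two parents. For `m = 2w + 1` a face starting at a vertex is closed at age `w` by an edge inside the
layer; the face above this edge continues the count and ends at a vertex with two parents after age
`2w - 1`. The ages on both sides of a vertex therefore determine its children, and hyperbolicity
guarantees that there is at least one.

The layered graph is built abstractly: vertices are addresses in a spanning tree, and oriented edges
are darts with a rotation and a reversal. All its faces are `m`-gons (`Admissible.face`), so the
rotation group acts on the darts. Conversely, developing darts into the group along the tree
respects the edges outside the tree (`Admissible.develDart_compat`), and this is a left inverse of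
the orbit map (`Closes.elt_orbit`). Hence the model is the tessellation, and the length of an
address is the distance (`Closes.edist_eq`). Counting gaps by age gives linear recurrences, which
`Admissible.growth` sums.

Location of roots. Put `k = ℓ - 1`. A root `z` satisfies `z * M(z^w) = M*(z^w)` with an explicit
polynomial `M` of degree 1 or 2 and its reciprocal `M*`. For roots in the open disc this writes the
rank one kernel `M(u^w) * star M(v^w)` as a positive combination of several rank one kernels, and
the equality case of Cauchy–Schwarz leaves at most one root; inversion carries this to the outside.
A sign change on `[1, k]` yields a root there. Eliminating between `D` and `D'` shows that it is
simple, and that the roots on the circle are simple; both use the hyperbolic inequality.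

Factorization. A factor of `D` without the outer root has all its roots in the closed disc, hence by
Kronecker's theorem a root of unity among them. As circle roots are simple, irreducibility reduces
to listing the roots of unity that are roots of `D` (`rootOfUnity_even`, `rootOfUnity_odd`). For
this the root equation is traced down to `ℚ`: the trace divided by the degree sends a primitive
`n`-th root of unity to `μ(n)/φ(n)`, which is rarely far from `0`, so few orders survive. -/

/-! ### Layers, addresses and ages of gaps -/

/-- The combinatorial data of a layered planar graph: the vertex degree `deg`, the number `life` of
consecutive layers in which a face meets the gap between two neighbouring vertices, and the age
`hor` at which such a gap is closed by an edge inside the layer. -/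
structure LayerData where
  deg : ℕ
  life : ℕ
  hor : ℕ

/-- The local type of a vertex: whether it is the base vertex, whether it has two neighbours in the
previous layer, and the ages of the gaps on its left and on its right. -/
structure VertexType where
  isRoot : Bool
  isTop : Bool
  left : ℕ
  right : ℕ

namespace LayerData

variable (P : LayerData)

/-- The number of edges preceding the outgoing edges in the clockwise order that begins with the
edge to the parent. -/
def off (s : VertexType) : ℕ :=
  (if s.isRoot then 0 else 1) + (if s.isTop then 1 else 0) + (if s.left = P.hor then 1 else 0)

/-- The number of edges to the next layer. -/
def kids (s : VertexType) : ℕ :=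
  P.deg - P.off s - (if s.right = P.hor then 1 else 0)

/-- The number of children in the spanning tree of rightmost parents. -/
def own (s : VertexType) : ℕ := P.kids s - (if s.right = P.life then 1 else 0)

/-- The age of the gap following a gap of age `i`. -/
def age (i : ℕ) : ℕ := if i < P.life then i + 1 else 1

/-- The type of the `k`-th child. -/
def child (s : VertexType) (k : ℕ) : VertexType where
  isRoot := false
  isTop := decide (k = 0 ∧ s.left = P.life)
  left := if k = 0 then P.age s.left else 1
  right := if k + 1 = P.own s then P.age s.right else 1

/-- The type of the vertex with a given address. -/
def typ : List ℕ → VertexType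
  | [] => ⟨true, false, 0, 0⟩
  | k :: v => P.child (typ v) k

/-- The addresses of the vertices. -/
def Valid : List ℕ → Prop
  | [] => True
  | k :: v => k < P.own (P.typ v) ∧ Valid v

/-- The right neighbour in the same layer. -/
def next : List ℕ → List ℕ
  | [] => []
  | k :: v => if k + 1 < P.own (P.typ v) then (k + 1) :: v else 0 :: next v

/-- The left neighbour in the same layer. -/
def prev : List ℕ → List ℕ
  | [] => []
  | k :: v => if k = 0 then (P.own (P.typ (prev v)) - 1) :: prev v else (k - 1) :: v

/-- The data for which the layered graph is a tessellation: the ages are positive and every vertex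
has a child. -/
structure Admissible : Prop where
  life_pos : 1 ≤ P.life
  hor_pos : 1 ≤ P.hor
  own_pos : ∀ v, P.Valid v → 1 ≤ P.own (P.typ v)

variable {P}

@[simp] theorem typ_nil : P.typ [] = ⟨true, false, 0, 0⟩ := rfl

@[simp] theorem isRoot_cons (k : ℕ) (v : List ℕ) : (P.typ (k :: v)).isRoot = false := rfl

theorem isTop_cons (k : ℕ) (v : List ℕ) :
    (P.typ (k :: v)).isTop = decide (k = 0 ∧ (P.typ v).left = P.life) := rfl

theorem left_cons (k : ℕ) (v : List ℕ) :
    (P.typ (k :: v)).left = if k = 0 then P.age (P.typ v).left else 1 := rfl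

theorem right_cons (k : ℕ) (v : List ℕ) : (P.typ (k :: v)).right =
    if k + 1 = P.own (P.typ v) then P.age (P.typ v).right else 1 := rfl

theorem Admissible.right_le (h : P.Admissible) (v : List ℕ) : (P.typ v).right ≤ P.life := by
  have := h.life_pos
  cases v with
  | nil => simp
  | cons k v => rw [right_cons, age]; split_ifs <;> omega

/-- A gap is seen from both of its ends. The last child of a vertex and the first child of its right
neighbour inherit the gap between their parents by the same rule `age`, and gaps between siblings
are new. -/
theorem left_next {v : List ℕ} (hv : P.Valid v) : (P.typ (P.next v)).left = (P.typ v).right := by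
  induction v with
  | nil => rfl
  | cons k v ih =>
    have h1 := hv.1
    rw [next, right_cons]
    split_ifs with h2 h3 h3
    · omega
    · simp [left_cons]
    · simp [left_cons, ih hv.2]
    · omega

theorem valid_next (h : P.Admissible) {v : List ℕ} (hv : P.Valid v) : P.Valid (P.next v) := by
  induction v with
  | nil => trivial
  | cons k v ih =>
    rw [next]
    split_ifs with h2
    · exact ⟨h2, hv.2⟩
    · exact ⟨h.own_pos _ (ih hv.2), ih hv.2⟩

theorem valid_prev (h : P.Admissible) {v : List ℕ} (hv : P.Valid v) : P.Valid (P.prev v) := by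
  induction v with
  | nil => trivial
  | cons k v ih =>
    rw [prev]
    split_ifs with h2
    · have := h.own_pos _ (ih hv.2)
      exact ⟨by omega, ih hv.2⟩
    · have := hv.1
      exact ⟨by omega, hv.2⟩

theorem prev_next {v : List ℕ} (hv : P.Valid v) : P.prev (P.next v) = v := by
  induction v with
  | nil => rfl
  | cons k v ih =>
    have h1 := hv.1
    rw [next]
    split_ifs with h2
    · simp [prev]
    · simp only [prev, ih hv.2, if_true]
      congr 1
      omega

theorem next_prev (h : P.Admissible) {v : List ℕ} (hv : P.Valid v) : P.next (P.prev v) = v := by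
  induction v with
  | nil => rfl
  | cons k v ih =>
    have h1 := hv.1
    rw [prev]
    split_ifs with h2
    · have := h.own_pos _ (valid_prev h hv.2)
      rw [next, if_neg (by omega), ih hv.2, h2]
    · rw [next, if_pos (by omega)]
      congr 1
      omega

theorem right_prev (h : P.Admissible) {v : List ℕ} (hv : P.Valid v) :
    (P.typ (P.prev v)).right = (P.typ v).left := by
  rw [← left_next (valid_prev h hv), next_prev h hv]

theorem length_next (v : List ℕ) : (P.next v).length = v.length := by
  induction v with
  | nil => rfl
  | cons k v ih => rw [next]; split_ifs <;> simp [ih]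

theorem length_prev (v : List ℕ) : (P.prev v).length = v.length := by
  induction v with
  | nil => rfl
  | cons k v ih => rw [prev]; split_ifs <;> simp [ih]

theorem Admissible.off_add_kids (h : P.Admissible) {v : List ℕ} (hv : P.Valid v) :
    P.off (P.typ v) + P.kids (P.typ v) + (if (P.typ v).right = P.hor then 1 else 0) = P.deg := by
  have := h.own_pos v hv
  rw [own, kids] at this
  rw [kids]
  omega

theorem Admissible.own_add (h : P.Admissible) {v : List ℕ} (hv : P.Valid v) :
    P.own (P.typ v) + (if (P.typ v).right = P.life then 1 else 0) = P.kids (P.typ v) := by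
  have := h.own_pos v hv
  rw [own] at this ⊢
  omega

/-! ### Walks along faces -/

/-- The number of face steps from the last outgoing edge of a vertex to the first outgoing edge of
its right neighbour across a gap of age `i`. -/
def crossing (P : LayerData) (i : ℕ) : ℕ := if i < P.hor then 2 * i else 2 * (i - P.hor) + 1

/-- A labelling of the edge directions `(v, d)` by elements of `T` that follows the rotation `X`
about vertices and the reversal `Y` along the edges of the spanning tree. -/
structure TreeMap {T : Type*} (P : LayerData) (X Y : T → T) (f : List ℕ → ℤ → T) : Prop where
  rot : ∀ v, P.Valid v → ∀ d, X (f v d) = f v (d + 1)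
  per : ∀ v d, f v (d + P.deg) = f v d
  up : ∀ v k, P.Valid (k :: v) → Y (f v (P.off (P.typ v) + k)) = f (k :: v) 0
  down : ∀ v k, P.Valid (k :: v) → Y (f (k :: v) 0) = f v (P.off (P.typ v) + k)

/-- Compatibility with the edge inside the layer to the right of `v`. -/
def HorAt {T : Type*} (P : LayerData) (Y : T → T) (f : List ℕ → ℤ → T) (v : List ℕ) : Prop :=
  (P.typ v).right = P.hor → Y (f v (-1)) = f (P.next v) (P.off (P.typ (P.next v)) - 1)

/-- Compatibility with the edge joining `v` to a vertex whose tree parent is to the right. -/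
def TopAt {T : Type*} (P : LayerData) (Y : T → T) (f : List ℕ → ℤ → T) (v : List ℕ) : Prop :=
  (P.typ v).right = P.life →
    Y (f v (P.off (P.typ v) + P.kids (P.typ v) - 1)) = f (0 :: P.next v) 1

section

variable {T : Type*} {X Y : T → T} {f : List ℕ → ℤ → T}

theorem off_cons (k : ℕ) (v : List ℕ) : P.off (P.typ (k :: v)) =
    1 + (if k = 0 ∧ (P.typ v).left = P.life then 1 else 0) +
      (if (P.typ (k :: v)).left = P.hor then 1 else 0) := by
  simp [off, isTop_cons]

theorem TreeMap.step_descend (hf : TreeMap P X Y f) {k : ℕ} {v : List ℕ}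
    (hv : P.Valid (k :: v)) : Y (X (f (k :: v) (-1))) = f v (P.off (P.typ v) + k) := by
  rw [hf.rot _ hv, neg_add_cancel, hf.down _ _ hv]

/-- From the `k`-th child of `v`, down to `v` (already done) and up to the next vertex. -/
theorem Admissible.ascend (h : P.Admissible) (hf : TreeMap P X Y f) {k : ℕ} {v : List ℕ}
    (hv : P.Valid (k :: v))
    (hm : TopAt P Y f v)
    (hc : (Y ∘ X)^[P.crossing (P.typ v).right] (f v (P.off (P.typ v) + P.kids (P.typ v) - 1))
      = f (P.next v) (P.off (P.typ (P.next v)) - 1)) :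
    (Y ∘ X)^[if (P.typ (k :: v)).right = 1 ∧ (k + 1 = P.own (P.typ v) → P.life ≤ (P.typ v).right)
        then 1 else P.crossing (P.typ v).right + 1]
      (f v (P.off (P.typ v) + k)) =
    f (P.next (k :: v)) (P.off (P.typ (P.next (k :: v))) -
      (if (P.typ (k :: v)).right = P.hor then 2 else 1)) := by
  have h1 := hv.1
  have h2 := h.own_add hv.2
  have h3 := h.right_le v
  have h4 := left_next hv
  rw [next] at h4 ⊢
  -- Three situations: the next vertex is a sibling; or the gap of `v` has expired and the next
  -- vertex is the child shared with the right neighbour; or the gap of `v` survives and has to be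
  -- crossed below first.
  by_cases hk : k + 1 < P.own (P.typ v)
  · rw [if_pos hk] at h4 ⊢
    have h5 : (P.typ (k :: v)).right = 1 := by rw [right_cons, if_neg (by omega)]
    rw [if_pos ⟨h5, by omega⟩, off_cons, h4, h5]
    simp only [Function.iterate_one, Function.comp]
    rw [hf.rot _ hv.2, add_assoc, show ((k : ℤ) + 1) = ((k + 1 : ℕ) : ℤ) by push_cast; ring,
      hf.up _ _ ⟨hk, hv.2⟩]
    congr 1
    (split_ifs <;> simp_all); omega
  · have hk' : k + 1 = P.own (P.typ v) := by omega
    rw [if_neg hk] at h4 ⊢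
    by_cases hr : (P.typ v).right = P.life
    · have h5 : (P.typ (k :: v)).right = 1 := by
        rw [right_cons, if_pos hk', age, if_neg (by omega)]
      rw [if_pos ⟨h5, by omega⟩, off_cons, h4, h5, left_next hv.2]
      simp only [Function.iterate_one, Function.comp]
      rw [hf.rot _ hv.2]
      rw [if_pos hr] at h2
      have h6 := hm hr
      rw [← h2, ← hk'] at h6
      rw [show ((P.off (P.typ v) : ℤ) + k + 1)
        = P.off (P.typ v) + ((k + 1 + 1 : ℕ) : ℤ) - 1 by push_cast; ring, h6]
      congr 1
      simp only [hr]
      (split_ifs <;> simp_all); omega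
    · have h5 : (P.typ (k :: v)).right = (P.typ v).right + 1 := by
        rw [right_cons, if_pos hk', age, if_pos (by omega)]
      rw [if_neg (by intro hh; have := hh.2 hk'; omega), off_cons, h4, left_next hv.2,
        Function.iterate_succ_apply']
      rw [if_neg hr] at h2
      rw [show ((P.off (P.typ v) : ℤ) + k)
        = P.off (P.typ v) + P.kids (P.typ v) - 1 by rw [← h2, ← hk']; push_cast; ring, hc]
      simp only [Function.comp]
      have hn := valid_next h hv.2
      have h7 := hf.up (P.next v) 0 ⟨h.own_pos _ hn, hn⟩
      rw [hf.rot _ hn, sub_add_cancel]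
      rw [Nat.cast_zero, add_zero] at h7
      rw [h7]
      congr 1
      simp only [hr, and_false]
      split_ifs <;> simp_all

/-- Adds the descending step to the count in `ascend`. Under an edge inside the layer the walk takes
the long way round the lower face, hence the separate value there. -/
theorem Admissible.crossing_right (h : P.Admissible) {k : ℕ} {v : List ℕ}
    (hv : P.Valid (k :: v)) :
    (if (P.typ (k :: v)).right = 1 ∧ (k + 1 = P.own (P.typ v) → P.life ≤ (P.typ v).right)
        then 1 else P.crossing (P.typ v).right + 1) + 1 =
    if (P.typ (k :: v)).right = P.hor then 2 * P.hor else P.crossing (P.typ (k :: v)).right := by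
  have h1 := hv.1
  have h3 := h.right_le v
  have h4 := h.hor_pos
  have h5 := h.life_pos
  rw [right_cons, age, crossing, crossing]
  split_ifs <;> omega

/-- Induction along the address: go down to the parent, cross its gap if that gap is inherited, and
climb again; an edge inside the layer is crossed in a single step. Only edges up to the layer of `v`
are used, which permits the later induction over layers. -/
theorem Admissible.cross (h : P.Admissible) (hf : TreeMap P X Y f) {v : List ℕ}
    (hv : P.Valid v) (hh : ∀ u, P.Valid u → u.length ≤ v.length → HorAt P Y f u)
    (hm : ∀ u, P.Valid u → u.length < v.length → TopAt P Y f u) :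
    (Y ∘ X)^[P.crossing (P.typ v).right] (f v (P.off (P.typ v) + P.kids (P.typ v) - 1))
      = f (P.next v) (P.off (P.typ (P.next v)) - 1) := by
  induction v with
  | nil =>
    have h1 := h.off_add_kids hv
    have h2 := h.hor_pos
    rw [← hf.per (P.next []), ← h1]
    have h3 : P.off (P.typ []) = 0 := by simp [off, show ¬ 0 = P.hor by omega]
    have h4 : ¬ (P.typ []).right = P.hor := by simp; omega
    rw [if_neg h4, add_zero]
    simp only [next, h3, crossing, show (P.typ []).right = 0 from rfl, if_pos (show 0 < P.hor by omega), mul_zero,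
      Function.iterate_zero, id]
    congr 1
  | cons k v ih =>
    have h1 := h.off_add_kids hv
    have h2 := h.crossing_right hv
    have h3 := h.ascend hf hv (hm _ hv.2 (by simp)) (ih hv.2
      (fun u hu hl => hh u hu (by simp; omega)) (fun u hu hl => hm u hu (by simp; omega)))
    by_cases hr : (P.typ (k :: v)).right = P.hor
    · have h4 := hh _ hv le_rfl hr
      rw [hr, crossing, if_neg (lt_irrefl _), Nat.sub_self, mul_zero, zero_add,
        Function.iterate_one, Function.comp, hf.rot _ hv, ← h4, ← hf.per _ (-1)]
      rw [if_pos hr] at h1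
      congr 2
      rw [← h1]
      push_cast
      ring
    · rw [if_neg hr] at h2
      rw [if_neg hr] at h1
      rw [if_neg hr] at h3
      rw [← h2, Function.iterate_succ_apply, Function.comp, hf.rot _ hv, ← h3]
      congr 1
      rw [← hf.down _ _ hv, ← hf.per _ 0, ← h1]
      congr 2
      push_cast
      ring

/-- The walk around the face below an edge inside the layer, avoiding that edge. Compatibility along
the edge can then be deduced from the relation of the face. -/
theorem Admissible.cross_below (h : P.Admissible) (hf : TreeMap P X Y f) {v : List ℕ}
    (hv : P.Valid v) (hr : (P.typ v).right = P.hor)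
    (hh : ∀ u, P.Valid u → u.length < v.length → HorAt P Y f u)
    (hm : ∀ u, P.Valid u → u.length < v.length → TopAt P Y f u) :
    (Y ∘ X)^[2 * P.hor] (f v (-1)) = f (P.next v) (P.off (P.typ (P.next v)) - 2) := by
  cases v with
  | nil =>
    have h2 := h.hor_pos
    simp at hr
    omega
  | cons k v =>
    have h2 := h.crossing_right hv
    have h3 := h.ascend hf hv (hm _ hv.2 (by simp)) (h.cross hf hv.2
      (fun u hu hl => hh u hu (by simp; omega)) (fun u hu hl => hm u hu (by simp; omega)))
    rw [if_pos hr] at h2 h3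
    rw [← h2, Function.iterate_succ_apply, Function.comp, hf.step_descend hv, h3]

/-- One step beyond `cross` reaches the top vertex of the expiring face, without using the edge from
`v` to that vertex. -/
theorem Admissible.cross_above (h : P.Admissible) (hf : TreeMap P X Y f) {v : List ℕ}
    (hv : P.Valid v) (hr : (P.typ v).right = P.life)
    (hh : ∀ u, P.Valid u → u.length ≤ v.length → HorAt P Y f u)
    (hm : ∀ u, P.Valid u → u.length < v.length → TopAt P Y f u) :
    (Y ∘ X)^[P.crossing P.life + 1] (f v (P.off (P.typ v) + P.kids (P.typ v) - 1))
      = f (0 :: P.next v) 0 := by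
  have hn := valid_next h hv
  have h7 := hf.up (P.next v) 0 ⟨h.own_pos _ hn, hn⟩
  rw [Nat.cast_zero, add_zero] at h7
  rw [Function.iterate_succ_apply', ← hr, h.cross hf hv hh hm, Function.comp, hf.rot _ hn,
    sub_add_cancel, h7]

end

end LayerData

/-! ### Darts, their reversal and the faces of the layered graph -/

namespace LayerData

variable {P : LayerData}

/-- A vertex address with a direction. -/
abbrev Dart (P : LayerData) : Type := List ℕ × ZMod P.deg

/-- The standard labelling of directions by darts. -/
def dart (P : LayerData) (v : List ℕ) (d : ℤ) : P.Dart := (v, d)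

/-- The reversal of the `i`-th edge at `v`. -/
def flipEdge (P : LayerData) (v : List ℕ) (i : ℕ) : List ℕ × ℤ :=
  if i < P.off (P.typ v) then
    if i + 1 = P.off (P.typ v) ∧ (P.typ v).left = P.hor then (P.prev v, -1)
    else if i = 0 then (v.tail, P.off (P.typ v.tail) + v.headD 0)
    else (P.prev v.tail,
      P.off (P.typ (P.prev v.tail)) + P.kids (P.typ (P.prev v.tail)) - 1)
  else if i < P.off (P.typ v) + P.own (P.typ v) then ((i - P.off (P.typ v)) :: v, 0)
  else if i < P.off (P.typ v) + P.kids (P.typ v) then (0 :: P.next v, 1)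
  else (P.next v, P.off (P.typ (P.next v)) - 1)

open Classical in
/-- Rotation about a vertex. -/
noncomputable def rot (P : LayerData) (e : P.Dart) : P.Dart :=
  if P.Valid e.1 then (e.1, e.2 + 1) else e

open Classical in
/-- Reversal of darts. -/
noncomputable def flip (P : LayerData) (e : P.Dart) : P.Dart :=
  if P.Valid e.1 then P.dart (P.flipEdge e.1 e.2.val).1 (P.flipEdge e.1 e.2.val).2 else e

theorem Admissible.deg_pos (h : P.Admissible) : 0 < P.deg := by
  have h1 := h.off_add_kids (v := []) trivial
  have h2 := h.own_pos [] trivial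
  have h3 := h.own_add (v := []) trivial
  omega

theorem rot_dart {v : List ℕ} (hv : P.Valid v) (d : ℤ) :
    P.rot (P.dart v d) = P.dart v (d + 1) := by
  simp [rot, dart, hv]

theorem dart_add_deg (v : List ℕ) (d : ℤ) : P.dart v (d + P.deg) = P.dart v d := by
  simp [dart]

theorem flip_dart {v : List ℕ} (hv : P.Valid v) {i : ℕ} (hi : i < P.deg) :
    P.flip (P.dart v i) = P.dart (P.flipEdge v i).1 (P.flipEdge v i).2 := by
  simp [flip, dart, hv, ZMod.val_natCast_of_lt hi]

theorem Admissible.off_lt (h : P.Admissible) {v : List ℕ} (hv : P.Valid v) :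
    P.off (P.typ v) + P.kids (P.typ v) ≤ P.deg ∧ 1 ≤ P.kids (P.typ v) := by
  have h1 := h.off_add_kids hv
  have h2 := h.own_pos v hv
  have h3 := h.own_add hv
  omega

theorem off_cons_pos (k : ℕ) (v : List ℕ) : 1 ≤ P.off (P.typ (k :: v)) := by
  rw [off_cons]
  omega

theorem Admissible.flip_down (h : P.Admissible) {k : ℕ} {v : List ℕ} (hv : P.Valid (k :: v)) :
    P.flip (P.dart (k :: v) 0) = P.dart v (P.off (P.typ v) + k) := by
  have h1 := off_cons_pos (P := P) k v
  have h2 := flip_dart hv h.deg_pos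
  rw [flipEdge, if_pos (by omega), if_neg, if_pos rfl] at h2
  · simpa using h2
  · rintro ⟨h3, h4⟩
    rw [off_cons, if_pos h4] at h3
    omega

theorem Admissible.flip_up (h : P.Admissible) {k : ℕ} {v : List ℕ} (hv : P.Valid (k :: v)) :
    P.flip (P.dart v (P.off (P.typ v) + k)) = P.dart (k :: v) 0 := by
  have h1 := h.off_lt hv.2
  have h3 := h.own_add hv.2
  have h4 := hv.1
  have h2 := flip_dart hv.2 (i := P.off (P.typ v) + k) (by omega)
  rw [flipEdge, if_neg (by omega), if_pos (by omega), Nat.add_sub_cancel_left] at h2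
  simpa using h2

theorem Admissible.flip_last (h : P.Admissible) {v : List ℕ} (hv : P.Valid v) :
    TopAt P P.flip P.dart v := by
  intro hr
  have h1 := h.off_lt hv
  have h3 := h.own_add hv
  rw [if_pos hr] at h3
  have h2 := flip_dart hv (i := P.off (P.typ v) + P.kids (P.typ v) - 1) (by omega)
  rw [flipEdge, if_neg (by omega), if_neg (by omega), if_pos (by omega)] at h2
  rw [← h2]
  congr 2
  omega

theorem Admissible.flip_right (h : P.Admissible) {v : List ℕ} (hv : P.Valid v) :
    HorAt P P.flip P.dart v := by
  intro hr
  have h1 := h.off_lt hv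
  have h3 := h.own_add hv
  have h4 := h.off_add_kids hv
  rw [if_pos hr] at h4
  have h2 := flip_dart hv (i := P.off (P.typ v) + P.kids (P.typ v)) (by omega)
  rw [flipEdge, if_neg (by omega), if_neg (by omega), if_neg (by omega)] at h2
  rw [← h2, ← dart_add_deg]
  congr 2
  omega

theorem Admissible.flip_left (h : P.Admissible) {v : List ℕ} (hv : P.Valid v)
    (hl : (P.typ v).left = P.hor) :
    P.flip (P.dart v (P.off (P.typ v) - 1)) = P.dart (P.prev v) (-1) := by
  have h1 := h.off_lt hv
  have h4 : 1 ≤ P.off (P.typ v) := by rw [off, if_pos hl]; omega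
  have h2 := flip_dart hv (i := P.off (P.typ v) - 1) (by omega)
  rw [flipEdge, if_pos (by omega), if_pos ⟨by omega, hl⟩] at h2
  rw [← h2]
  congr 2
  omega

theorem Admissible.flip_top (h : P.Admissible) {v : List ℕ} (hv : P.Valid v)
    (hl : (P.typ v).left = P.life) :
    P.flip (P.dart (0 :: v) 1) = P.dart (P.prev v)
      (P.off (P.typ (P.prev v)) + P.kids (P.typ (P.prev v)) - 1) := by
  have hv' : P.Valid (0 :: v) := ⟨h.own_pos v hv, hv⟩
  have h1 := h.off_lt hv'
  have h3 := off_cons (P := P) 0 v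
  rw [if_pos ⟨rfl, hl⟩] at h3
  have h2 := flip_dart hv' (i := 1) (by omega)
  rw [flipEdge, if_pos (by omega), if_neg, if_neg (by omega)] at h2
  · simpa using h2
  · rintro ⟨h4, h5⟩
    rw [if_pos h5] at h3
    omega

/-- Every direction at a vertex leads to the tree parent, to the second parent, to the left
neighbour, to a child in the tree, to a child shared with the right neighbour, or to the right
neighbour. -/
theorem Admissible.dart_cases (h : P.Admissible) {v : List ℕ} (hv : P.Valid v)
    {motive : ℤ → Prop}
    (per : ∀ d, motive (d + P.deg) ↔ motive d)
    (down : ∀ k u, v = k :: u → motive 0)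
    (top : ∀ u, v = 0 :: u → (P.typ u).left = P.life → motive 1)
    (left : (P.typ v).left = P.hor → motive (P.off (P.typ v) - 1))
    (up : ∀ k, k < P.own (P.typ v) → motive (P.off (P.typ v) + k))
    (last : (P.typ v).right = P.life → motive (P.off (P.typ v) + P.kids (P.typ v) - 1))
    (right : (P.typ v).right = P.hor → motive (-1)) (d : ℤ) : motive d := by
  have hmul : ∀ (d n : ℤ), motive (d + P.deg * n) ↔ motive d := by
    intro d n
    induction n using Int.induction_on with
    | zero => simp
    | succ i ih => rw [← ih, ← per (d + P.deg * i)]; ring_nf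
    | pred i ih => rw [← ih, ← per]; ring_nf
  rw [← Int.emod_add_mul_ediv d P.deg, hmul]
  have hd : (0 : ℤ) < P.deg := by exact_mod_cast h.deg_pos
  obtain ⟨i, hi⟩ := Int.eq_ofNat_of_zero_le (Int.emod_nonneg d hd.ne')
  have hi' := Int.emod_lt_of_pos d hd
  rw [hi] at hi' ⊢
  have hi'' : i < P.deg := by exact_mod_cast hi'
  have h1 := h.off_lt hv
  have h3 := h.own_add hv
  have h4 := h.off_add_kids hv
  have h0 := h.hor_pos
  rcases lt_or_ge i (P.off (P.typ v)) with h5 | h5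
  · by_cases hl : i + 1 = P.off (P.typ v) ∧ (P.typ v).left = P.hor
    · have := left hl.2
      rw [← hl.1] at this
      simpa using this
    · cases v with
      | nil =>
        simp [off, show ¬ 0 = P.hor by omega] at h5
      | cons k u =>
        rcases Nat.eq_zero_or_pos i with rfl | h6
        · exact down k u rfl
        · have h7 := off_cons (P := P) k u
          have h8 : k = 0 ∧ (P.typ u).left = P.life := by
            by_contra h8
            rw [if_neg h8] at h7
            split_ifs at h7 with h9
            · exact hl ⟨by omega, h9⟩
            · omega
          rw [if_pos h8] at h7
          have h9 : i = 1 := by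
            split_ifs at h7 with h9
            · by_contra
              exact hl ⟨by omega, h9⟩
            · omega
          rw [h9]
          rw [h8.1] at top
          exact top u rfl h8.2
  · rcases lt_or_ge i (P.off (P.typ v) + P.own (P.typ v)) with h6 | h6
    · have := up (i - P.off (P.typ v)) (by omega)
      rwa [Nat.cast_sub h5, add_sub_cancel] at this
    · rcases lt_or_ge i (P.off (P.typ v) + P.kids (P.typ v)) with h7 | h7
      · split_ifs at h3 with h8
        · have := last h8
          rwa [show ((P.off (P.typ v) : ℤ) + P.kids (P.typ v) - 1) = i by omega] at this
        · omega
      · split_ifs at h4 with h8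
        · have := right h8
          rw [← per] at this
          rwa [show (-1 + (P.deg : ℤ)) = i by omega] at this
        · omega

theorem exists_eq_dart (h : P.Admissible) (e : P.Dart) : ∃ d : ℤ, e = P.dart e.1 d := by
  have : NeZero P.deg := ⟨h.deg_pos.ne'⟩
  exact ⟨e.2.cast, by simp [dart]⟩

theorem Admissible.flip_flip (h : P.Admissible) (e : P.Dart) : P.flip (P.flip e) = e := by
  by_cases hv : P.Valid e.1
  · obtain ⟨d, hd⟩ := exists_eq_dart h e
    rw [hd]
    refine h.dart_cases hv (motive := fun d => P.flip (P.flip (P.dart e.1 d)) = P.dart e.1 d)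
      ?_ ?_ ?_ ?_ ?_ ?_ ?_ d
    · intro d
      rw [dart_add_deg]
    · intro k u hu
      rw [hu] at hv ⊢
      rw [h.flip_down hv, h.flip_up hv]
    · intro u hu hl
      rw [hu] at hv ⊢
      have h1 := h.flip_last (valid_prev h hv.2) ((right_prev h hv.2).trans hl)
      rw [h.flip_top hv.2 hl, h1, next_prev h hv.2]
    · intro hl
      have h1 := h.flip_right (valid_prev h hv) ((right_prev h hv).trans hl)
      rw [h.flip_left hv hl, h1, next_prev h hv]
    · intro k hk
      rw [h.flip_up ⟨hk, hv⟩, h.flip_down ⟨hk, hv⟩]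
    · intro hr
      rw [h.flip_last hv hr, h.flip_top (valid_next h hv) ((left_next hv).trans hr), prev_next hv]
    · intro hr
      rw [h.flip_right hv hr, h.flip_left (valid_next h hv) ((left_next hv).trans hr),
        prev_next hv]
  · simp [flip, hv]

theorem Admissible.treeMap_dart (h : P.Admissible) : TreeMap P P.rot P.flip P.dart where
  rot _ hv d := rot_dart hv d
  per v d := dart_add_deg v d
  up _ _ hv := h.flip_up hv
  down _ _ hv := h.flip_down hv

/-- Validity and the change of layer under reversal. -/
theorem Admissible.flip_valid (h : P.Admissible) {e : P.Dart} (hv : P.Valid e.1) :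
    P.Valid (P.flip e).1 ∧ (P.flip e).1.length ≤ e.1.length + 1 := by
  obtain ⟨d, hd⟩ := exists_eq_dart h e
  rw [hd]
  refine h.dart_cases hv (motive := fun d => P.Valid (P.flip (P.dart e.1 d)).1 ∧
      (P.flip (P.dart e.1 d)).1.length ≤ e.1.length + 1) ?_ ?_ ?_ ?_ ?_ ?_ ?_ d
  · intro d
    rw [dart_add_deg]
  · intro k u hu
    rw [hu] at hv ⊢
    rw [h.flip_down hv]
    exact ⟨hv.2, by simp [dart]; omega⟩
  · intro u hu hl
    rw [hu] at hv ⊢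
    rw [h.flip_top hv.2 hl]
    exact ⟨valid_prev h hv.2, by simp [dart, length_prev]; omega⟩
  · intro hl
    rw [h.flip_left hv hl]
    exact ⟨valid_prev h hv, by simp [dart, length_prev]⟩
  · intro k hk
    rw [h.flip_up ⟨hk, hv⟩]
    exact ⟨⟨hk, hv⟩, by simp [dart]⟩
  · intro hr
    have hn := valid_next h hv
    rw [h.flip_last hv hr]
    exact ⟨⟨h.own_pos _ hn, hn⟩, by simp [dart, length_next]⟩
  · intro hr
    rw [h.flip_right hv hr]
    exact ⟨valid_next h hv, by simp [dart, length_next]⟩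

section face

variable {m : ℕ}

theorem Admissible.face_right (h : P.Admissible) {v : List ℕ} (hv : P.Valid v)
    (hr : (P.typ v).right = P.hor) :
    (P.flip ∘ P.rot)^[2 * P.hor + 1] (P.dart v (-1)) = P.dart v (-1) := by
  have hn := valid_next h hv
  rw [Function.iterate_succ_apply', h.cross_below h.treeMap_dart hv hr
    (fun u hu _ => h.flip_right hu) (fun u hu _ => h.flip_last hu), Function.comp,
    rot_dart hn, show ((P.off (P.typ (P.next v)) : ℤ) - 2 + 1)
      = P.off (P.typ (P.next v)) - 1 by ring, h.flip_left hn ((left_next hv).trans hr),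
    prev_next hv]

/-- Induction on the number of layers left until the gap to the right of `v` expires. At expiry the
face closes at its top vertex. Before that, the dart is one face step away from a dart of the last
child, so the claim moves up a layer, unless an edge inside that layer closes the face there. -/
theorem Admissible.face_last (h : P.Admissible) (hm1 : P.crossing P.life + 2 = m)
    (hm2 : P.hor ≤ P.life → 2 * P.hor + 1 = m) {v : List ℕ} (hv : P.Valid v) :
    (P.flip ∘ P.rot)^[m] (P.dart v (P.off (P.typ v) + P.kids (P.typ v) - 1))
      = P.dart v (P.off (P.typ v) + P.kids (P.typ v) - 1) := by
  obtain ⟨n, hn⟩ : ∃ n, n + (P.typ v).right = P.life := ⟨_, Nat.sub_add_cancel (h.right_le v)⟩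
  induction n generalizing v with
  | zero =>
    rw [zero_add] at hn
    have h1 := valid_next h hv
    rw [← hm1, Function.iterate_succ_apply', h.cross_above h.treeMap_dart hv hn
      (fun u hu _ => h.flip_right hu) (fun u hu _ => h.flip_last hu), Function.comp,
      rot_dart (v := 0 :: P.next v) ⟨h.own_pos _ h1, h1⟩, zero_add, h.flip_top h1 ((left_next hv).trans hn),
      prev_next hv]
  | succ n ih =>
    have h1 := h.own_add hv
    have h2 := h.own_pos v hv
    rw [if_neg (by omega)] at h1
    set k := P.own (P.typ v) - 1 with hk
    have hkv : P.Valid (k :: v) := ⟨by omega, hv⟩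
    have h3 : (P.typ (k :: v)).right = (P.typ v).right + 1 := by
      rw [right_cons, if_pos (by omega), age, if_pos (by omega)]
    have h4 : P.dart v (P.off (P.typ v) + P.kids (P.typ v) - 1)
        = (P.flip ∘ P.rot) (P.dart (k :: v) (-1)) := by
      rw [Function.comp, h.treeMap_dart.step_descend hkv]
      congr 1
      omega
    have h5 : (P.flip ∘ P.rot)^[m] (P.dart (k :: v) (-1)) = P.dart (k :: v) (-1) := by
      have h6 := h.off_add_kids hkv
      by_cases hr : (P.typ (k :: v)).right = P.hor
      · have := h.face_right hkv hr
        rwa [hm2 (by omega)] at this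
      · have := ih hkv (by omega)
        rw [if_neg hr] at h6
        rw [← dart_add_deg]
        rwa [show ((P.off (P.typ (k :: v)) : ℤ) + P.kids (P.typ (k :: v)) - 1)
          = -1 + P.deg by omega] at this
    rw [h4, ← Function.iterate_succ_apply, Function.iterate_succ_apply', h5]

theorem Admissible.face_neg_one (h : P.Admissible) (hm1 : P.crossing P.life + 2 = m)
    (hm2 : P.hor ≤ P.life → 2 * P.hor + 1 = m) {v : List ℕ} (hv : P.Valid v) :
    (P.flip ∘ P.rot)^[m] (P.dart v (-1)) = P.dart v (-1) := by
  have h6 := h.off_add_kids hv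
  by_cases hr : (P.typ v).right = P.hor
  · have := h.face_right hv hr
    have h7 := h.right_le v
    rwa [hm2 (by omega)] at this
  · have := h.face_last hm1 hm2 hv
    rw [if_neg hr] at h6
    rw [← dart_add_deg]
    rwa [show ((P.off (P.typ v) : ℤ) + P.kids (P.typ v) - 1) = -1 + P.deg by omega] at this

theorem Admissible.flip_injective (h : P.Admissible) : Function.Injective P.flip :=
  Function.LeftInverse.injective h.flip_flip

theorem rot_injective : Function.Injective P.rot := by
  intro a b hab
  unfold rot at hab
  split_ifs at hab with h1 h2 h2
  · simp only [Prod.mk.injEq, add_left_inj] at hab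
    exact Prod.ext hab.1 hab.2
  · rw [← hab] at h2
    exact absurd h1 h2
  · rw [hab] at h1
    exact absurd h2 h1
  · exact hab

/-- All faces are `m`-gons. -/
theorem Admissible.face (h : P.Admissible) (hm1 : P.crossing P.life + 2 = m)
    (hm2 : P.hor ≤ P.life → 2 * P.hor + 1 = m) {v : List ℕ} (hv : P.Valid v) (d : ℤ) :
    (P.flip ∘ P.rot)^[m] (P.dart v d) = P.dart v d := by
  have hinj : Function.Injective (P.flip ∘ P.rot) := h.flip_injective.comp rot_injective
  have hfwd : ∀ e, (P.flip ∘ P.rot)^[m] e = e →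
      (P.flip ∘ P.rot)^[m] ((P.flip ∘ P.rot) e) = (P.flip ∘ P.rot) e := by
    intro e he
    rw [← Function.iterate_succ_apply, Function.iterate_succ_apply', he]
  have hbwd : ∀ e, (P.flip ∘ P.rot)^[m] ((P.flip ∘ P.rot) e) = (P.flip ∘ P.rot) e →
      (P.flip ∘ P.rot)^[m] e = e := by
    intro e he
    rw [← Function.iterate_succ_apply, Function.iterate_succ_apply'] at he
    exact hinj he
  have hslot : ∀ k, k < P.own (P.typ v) →
      (P.flip ∘ P.rot)^[m] (P.dart v (P.off (P.typ v) + k)) = P.dart v (P.off (P.typ v) + k) := by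
    intro k hk
    rw [← h.treeMap_dart.step_descend ⟨hk, hv⟩]
    exact hfwd _ (h.face_neg_one hm1 hm2 ⟨hk, hv⟩)
  -- A face step turns before it reverses, so the dart `d - 1` is classified by the edge `d` that
  -- the step traverses.
  refine h.dart_cases hv (motive := fun d => (P.flip ∘ P.rot)^[m] (P.dart v (d - 1))
    = P.dart v (d - 1)) ?_ ?_ ?_ ?_ ?_ ?_ ?_ (d + 1) |> (by simpa using ·)
  · intro d
    rw [add_sub_right_comm, dart_add_deg]
  · intro k u hu
    exact h.face_neg_one hm1 hm2 hv
  · intro u hu hl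
    apply hbwd
    subst hu
    rw [Function.comp, rot_dart hv, sub_add_cancel, h.flip_top hv.2 hl]
    exact h.face_last hm1 hm2 (valid_prev h hv.2)
  · intro hl
    apply hbwd
    rw [Function.comp, rot_dart hv, sub_add_cancel, h.flip_left hv hl]
    exact h.face_neg_one hm1 hm2 (valid_prev h hv)
  · intro k hk
    -- The direction just before the first child lies on the face in the left gap, so it is reached
    -- from the left neighbour by `cross`.
    rcases k with _ | k
    · have hp := valid_prev h hv
      have h1 := h.cross h.treeMap_dart hp (fun u hu _ => h.flip_right hu)
        (fun u hu _ => h.flip_last hu)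
      rw [next_prev h hv] at h1
      have h2 := h.face_last hm1 hm2 hp
      rw [Nat.cast_zero, add_zero, ← h1]
      generalize P.crossing (P.typ (P.prev v)).right = a
      rw [← Function.iterate_add_apply, add_comm, Function.iterate_add_apply, h2]
    · have := hslot k (by omega)
      rwa [show ((P.off (P.typ v) : ℤ) + ((k + 1 : ℕ) : ℤ) - 1)
        = P.off (P.typ v) + k by push_cast; ring]
  · intro hr
    have h1 := h.own_add hv
    have h2 := h.own_pos v hv
    rw [if_pos hr] at h1
    have := hslot (P.own (P.typ v) - 1) (by omega)
    rwa [show ((P.off (P.typ v) : ℤ) + P.kids (P.typ v) - 1 - 1)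
        = P.off (P.typ v) + ((P.own (P.typ v) - 1 : ℕ) : ℤ) by omega]
  · intro hr
    have h1 := h.off_add_kids hv
    rw [if_pos hr] at h1
    have := h.face_last hm1 hm2 hv
    rw [← dart_add_deg]
    rwa [show (-1 - 1 + (P.deg : ℤ)) = P.off (P.typ v) + P.kids (P.typ v) - 1 by omega]

end face

end LayerData

/-! ### The developing map and the identification with the rotation group -/

namespace LayerData

variable {P : LayerData}

section developing

variable {G : Type*} [Group G] {x y : G}

/-- The group element attached to a vertex by the path from the base vertex in the tree. -/
def devel (P : LayerData) (x y : G) : List ℕ → G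
  | [] => 1
  | k :: v => devel P x y v * x ^ (P.off (P.typ v) + k) * y

/-- The group element attached to a direction. -/
def develDart (P : LayerData) (x y : G) (v : List ℕ) (d : ℤ) : G := P.devel x y v * x ^ d

theorem treeMap_develDart (hx : x ^ P.deg = 1) (hy : y ^ 2 = 1) :
    TreeMap P (· * x) (· * y) (P.develDart x y) where
  rot v _ d := by simp [develDart, mul_assoc, zpow_add_one]
  per v d := by simp [develDart, zpow_add, hx]
  up v k _ := by
    simp only [develDart, devel, zpow_zero, mul_one]
    norm_cast
  down v k _ := by
    simp only [develDart, devel, zpow_zero, mul_one]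
    rw [mul_assoc, ← pow_two, hy, mul_one]
    norm_cast

theorem develDart_congr (hx : x ^ P.deg = 1) (v : List ℕ) {d e : ℤ}
    (hde : (d : ZMod P.deg) = e) : P.develDart x y v d = P.develDart x y v e := by
  rw [ZMod.intCast_eq_intCast_iff_dvd_sub] at hde
  obtain ⟨c, hc⟩ := hde
  rw [show e = d + P.deg * c by linarith]
  simp [develDart, zpow_add, zpow_mul, hx]

theorem iterate_mul_mul (n : ℕ) (g : G) :
    ((· * y) ∘ (· * x))^[n] g = g * (x * y) ^ n := by
  induction n with
  | zero => simp
  | succ n ih => rw [Function.iterate_succ_apply', ih, pow_succ]; simp [mul_assoc]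

/-- Induction over layers. Tree edges are compatible by construction. For any other edge,
`cross_below` or `cross_above` makes `m - 1` steps around a face through edges already treated, and
`(x * y) ^ m = 1` supplies the remaining one. Edges inside a layer are treated before the shared
children of the next layer. -/
theorem Admissible.develDart_compat (h : P.Admissible) {m : ℕ} (hm1 : P.crossing P.life + 2 = m)
    (hm2 : P.hor ≤ P.life → 2 * P.hor + 1 = m) (hx : x ^ P.deg = 1) (hy : y ^ 2 = 1)
    (hxy : (x * y) ^ m = 1) (n : ℕ) : ∀ v, P.Valid v → v.length = n →
      HorAt P (· * y) (P.develDart x y) v ∧ TopAt P (· * y) (P.develDart x y) v := by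
  have hf := treeMap_develDart (P := P) hx hy
  have key : ∀ j, j + 1 = m → ∀ a b : G, ((· * y) ∘ (· * x))^[j] a = b → a * y = b * x := by
    intro j hj a b hab
    rw [iterate_mul_mul] at hab
    have h1 : (x * y) ^ j * (x * y) = 1 := by rw [← pow_succ, hj, hxy]
    have h2 : (x * y) ^ j * x = y := by
      rw [← mul_assoc] at h1
      rw [eq_inv_of_mul_eq_one_left h1]
      exact inv_eq_of_mul_eq_one_left (by rw [← pow_two, hy])
    rw [← hab, mul_assoc, h2]
  induction n using Nat.strong_induction_on with
  | _ n ih =>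
    intro v hv hn
    have hlt : ∀ u, P.Valid u → u.length < n → HorAt P (· * y) (P.develDart x y) u ∧
        TopAt P (· * y) (P.develDart x y) u := fun u hu hl => ih _ hl u hu rfl
    have hor : ∀ v, P.Valid v → v.length = n → HorAt P (· * y) (P.develDart x y) v := by
      intro v hv hn hr
      have h1 := h.cross_below hf hv hr (fun u hu hl => (hlt u hu (hn ▸ hl)).1)
        (fun u hu hl => (hlt u hu (hn ▸ hl)).2)
      have h2 := hm2 (hr ▸ h.right_le v)
      have h3 := hf.rot _ (valid_next h hv) (P.off (P.typ (P.next v)) - 2)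
      rw [show ((P.off (P.typ (P.next v)) : ℤ) - 2 + 1) = P.off (P.typ (P.next v)) - 1 by ring]
        at h3
      rw [← h3]
      exact key _ h2 _ _ h1
    refine ⟨hor v hv hn, fun hr => ?_⟩
    have h1 := h.cross_above hf hv hr
      (fun u hu hl => (hl.lt_or_eq).elim (fun hl => (hlt u hu (hn ▸ hl)).1)
        (fun hl => hor u hu (hl.trans hn)))
      (fun u hu hl => (hlt u hu (hn ▸ hl)).2)
    have hn := valid_next h hv
    have h3 := hf.rot (0 :: P.next v) ⟨h.own_pos _ hn, hn⟩ 0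
    rw [zero_add] at h3
    rw [← h3]
    exact key _ hm1 _ _ h1

/-- All kinds of edges are now compatible in one orientation; the opposite one follows from `y ^ 2 =
1`. -/
theorem Admissible.develDart_flip (h : P.Admissible) {m : ℕ} (hm1 : P.crossing P.life + 2 = m)
    (hm2 : P.hor ≤ P.life → 2 * P.hor + 1 = m) (hx : x ^ P.deg = 1) (hy : y ^ 2 = 1)
    (hxy : (x * y) ^ m = 1) {v : List ℕ} (hv : P.Valid v) (d : ℤ) {u : List ℕ} {e : ℤ}
    (hd : P.flip (P.dart v d) = P.dart u e) :
    P.develDart x y u e = P.develDart x y v d * y := by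
  have hf := treeMap_develDart (P := P) hx hy
  have hc := fun v (hv : P.Valid v) => h.develDart_compat hm1 hm2 hx hy hxy _ v hv rfl
  have hyy : ∀ a b : G, a * y = b → a = b * y := by
    intro a b hab
    rw [← hab, mul_assoc, ← pow_two, hy, mul_one]
  have hwd : ∀ u e u' e', P.dart u e = P.dart u' e' →
      P.develDart x y u e = P.develDart x y u' e' := by
    intro u e u' e' hue
    rw [dart, dart, Prod.mk.injEq] at hue
    obtain ⟨rfl, h2⟩ := hue
    exact develDart_congr hx _ h2
  revert hd
  refine h.dart_cases hv (motive := fun d => P.flip (P.dart v d) = P.dart u e →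
    P.develDart x y u e = P.develDart x y v d * y) ?_ ?_ ?_ ?_ ?_ ?_ ?_ d
  · intro d
    rw [dart_add_deg, hf.per]
  · intro k w hw hd
    subst hw
    rw [h.flip_down hv] at hd
    rw [← hwd _ _ _ _ hd]
    exact (hf.down _ _ hv).symm
  · intro w hw hl hd
    subst hw
    have hp := valid_prev h hv.2
    rw [h.flip_top hv.2 hl] at hd
    rw [← hwd _ _ _ _ hd]
    have := (hc _ hp).2 ((right_prev h hv.2).trans hl)
    rw [next_prev h hv.2] at this
    exact hyy _ _ this
  · intro hl hd
    have hp := valid_prev h hv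
    rw [h.flip_left hv hl] at hd
    rw [← hwd _ _ _ _ hd]
    have := (hc _ hp).1 ((right_prev h hv).trans hl)
    rw [next_prev h hv] at this
    exact hyy _ _ this
  · intro k hk hd
    rw [h.flip_up ⟨hk, hv⟩] at hd
    rw [← hwd _ _ _ _ hd]
    exact (hf.up _ _ ⟨hk, hv⟩).symm
  · intro hr hd
    rw [h.flip_last hv hr] at hd
    rw [← hwd _ _ _ _ hd]
    exact ((hc _ hv).2 hr).symm
  · intro hr hd
    rw [h.flip_right hv hr] at hd
    rw [← hwd _ _ _ _ hd]
    exact ((hc _ hv).1 hr).symm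

end developing

/-- A face-closing layered graph with all faces `m`-gons. -/
structure Closes (P : LayerData) (m : ℕ) : Prop extends P.Admissible where
  crossing_life : P.crossing P.life + 2 = m
  hor_eq : P.hor ≤ P.life → 2 * P.hor + 1 = m

open Classical in
/-- Rotation as a permutation. -/
noncomputable def rotPerm (P : LayerData) : Equiv.Perm P.Dart where
  toFun := P.rot
  invFun e := if P.Valid e.1 then (e.1, e.2 - 1) else e
  left_inv e := by by_cases h : P.Valid e.1 <;> simp [rot, h]
  right_inv e := by by_cases h : P.Valid e.1 <;> simp [rot, h]

/-- Reversal as a permutation. -/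
noncomputable def Admissible.flipPerm (h : P.Admissible) : Equiv.Perm P.Dart :=
  Function.Involutive.toPerm P.flip h.flip_flip

theorem rot_iterate_deg (e : P.Dart) : P.rot^[P.deg] e = e := by
  by_cases hv : P.Valid e.1
  · have : ∀ n : ℕ, P.rot^[n] e = (e.1, e.2 + n) := by
      intro n
      induction n with
      | zero => simp
      | succ n ih =>
        rw [Function.iterate_succ_apply', ih]
        simp [rot, hv, add_assoc]
    rw [this]
    simp
  · apply Function.iterate_fixed
    simp [rot, hv]

variable {m : ℕ}

theorem Closes.face_iterate (h : P.Closes m) (e : P.Dart) : (P.flip ∘ P.rot)^[m] e = e := by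
  by_cases hv : P.Valid e.1
  · obtain ⟨d, hd⟩ := exists_eq_dart h.toAdmissible e
    rw [hd]
    exact h.toAdmissible.face h.crossing_life h.hor_eq hv d
  · apply Function.iterate_fixed
    simp [rot, flip, hv]

/-- The (right) action of the rotation group on the darts. -/
noncomputable def Closes.act (h : P.Closes m) : TessGroup P.deg m →* (Equiv.Perm P.Dart)ᵐᵒᵖ :=
  PresentedGroup.toGroup
    (f := ![MulOpposite.op P.rotPerm, MulOpposite.op h.toAdmissible.flipPerm]) (by
      intro r hr
      simp only [tessRels, Set.mem_insert_iff, Set.mem_singleton_iff] at hr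
      rcases hr with rfl | rfl | rfl
      · simp only [map_pow, FreeGroup.lift_apply_of, Matrix.cons_val_zero]
        rw [← MulOpposite.op_pow, ← MulOpposite.op_one]
        congr 1
        ext1 e
        rw [← Equiv.Perm.iterate_eq_pow]
        exact rot_iterate_deg e
      · simp only [map_pow, FreeGroup.lift_apply_of, Matrix.cons_val_one, Matrix.cons_val_zero]
        rw [← MulOpposite.op_pow, ← MulOpposite.op_one]
        congr 1
        ext1 e
        rw [← Equiv.Perm.iterate_eq_pow]
        exact h.toAdmissible.flip_flip e
      · simp only [map_pow, map_mul, FreeGroup.lift_apply_of, Matrix.cons_val_zero,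
          Matrix.cons_val_one]
        rw [← MulOpposite.op_mul, ← MulOpposite.op_pow, ← MulOpposite.op_one]
        congr 1
        ext1 e
        rw [← Equiv.Perm.iterate_eq_pow]
        exact h.face_iterate e)

/-- The dart to which a group element moves the base dart. -/
noncomputable def Closes.orbit (h : P.Closes m) (g : TessGroup P.deg m) : P.Dart :=
  (h.act g).unop (P.dart [] 0)

theorem Closes.orbit_one (h : P.Closes m) : h.orbit 1 = P.dart [] 0 := by simp [orbit]

theorem Closes.orbit_mul_vertexRot (h : P.Closes m) (g : TessGroup P.deg m) :
    h.orbit (g * vertexRot P.deg m) = P.rot (h.orbit g) := by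
  simp only [orbit, map_mul, MulOpposite.unop_mul, Equiv.Perm.mul_apply]
  rw [vertexRot, act, PresentedGroup.toGroup.of]
  rfl

theorem Closes.orbit_mul_edgeRot (h : P.Closes m) (g : TessGroup P.deg m) :
    h.orbit (g * edgeRot P.deg m) = P.flip (h.orbit g) := by
  simp only [orbit, map_mul, MulOpposite.unop_mul, Equiv.Perm.mul_apply]
  rw [edgeRot, act, PresentedGroup.toGroup.of]
  rfl

theorem vertexRot_pow (ℓ m : ℕ) : vertexRot ℓ m ^ ℓ = 1 :=
  PresentedGroup.one_of_mem (rels := tessRels ℓ m) (x := FreeGroup.of 0 ^ ℓ) (by simp [tessRels])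

theorem edgeRot_sq (ℓ m : ℕ) : edgeRot ℓ m ^ 2 = 1 :=
  PresentedGroup.one_of_mem (rels := tessRels ℓ m) (x := FreeGroup.of 1 ^ 2) (by simp [tessRels])

theorem vertexRot_mul_edgeRot_pow (ℓ m : ℕ) : (vertexRot ℓ m * edgeRot ℓ m) ^ m = 1 :=
  PresentedGroup.one_of_mem (rels := tessRels ℓ m)
    (x := (FreeGroup.of 0 * FreeGroup.of 1) ^ m) (by simp [tessRels])

/-- Right induction over the generators of the rotation group. -/
theorem tessGroup_induction {ℓ m : ℕ} {motive : TessGroup ℓ m → Prop} (one : motive 1)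
    (rot : ∀ g, motive (g * vertexRot ℓ m) ↔ motive g)
    (edge : ∀ g, motive (g * edgeRot ℓ m) ↔ motive g) (g : TessGroup ℓ m) : motive g := by
  have hg : g ∈ Subgroup.closure (Set.range (PresentedGroup.of (rels := tessRels ℓ m))) := by
    rw [PresentedGroup.closure_range_of]
    trivial
  induction hg using Subgroup.closure_induction_right with
  | one => exact one
  | mul_right g _ y hy ih =>
    obtain ⟨i, rfl⟩ := hy
    fin_cases i
    · exact (rot g).2 ih
    · exact (edge g).2 ih
  | mul_inv_cancel g _ y hy ih =>
    obtain ⟨i, rfl⟩ := hy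
    fin_cases i
    · rw [← rot]
      simpa [vertexRot] using ih
    · rw [← edge]
      simpa [edgeRot] using ih

theorem rot_fst (e : P.Dart) : (P.rot e).1 = e.1 := by
  unfold rot
  split_ifs <;> rfl

theorem Admissible.valid_flip_iff (h : P.Admissible) (e : P.Dart) :
    P.Valid (P.flip e).1 ↔ P.Valid e.1 :=
  ⟨fun h1 => by simpa [h.flip_flip] using (h.flip_valid h1).1, fun h1 => (h.flip_valid h1).1⟩

theorem Closes.valid_orbit (h : P.Closes m) (g : TessGroup P.deg m) : P.Valid (h.orbit g).1 := by
  induction g using tessGroup_induction with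
  | one => rw [h.orbit_one]; trivial
  | rot g => rw [h.orbit_mul_vertexRot, rot_fst]
  | edge g => rw [h.orbit_mul_edgeRot, h.toAdmissible.valid_flip_iff]

/-- The group element attached to a dart. -/
noncomputable def Closes.elt (_ : P.Closes m) (e : P.Dart) : TessGroup P.deg m :=
  P.develDart (vertexRot P.deg m) (edgeRot P.deg m) e.1 e.2.cast

theorem Closes.elt_dart (h : P.Closes m) (v : List ℕ) (d : ℤ) :
    h.elt (P.dart v d) = P.develDart (vertexRot P.deg m) (edgeRot P.deg m) v d := by
  have : NeZero P.deg := ⟨h.toAdmissible.deg_pos.ne'⟩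
  exact develDart_congr (vertexRot_pow _ _) _ (by simp [dart])

theorem Closes.elt_rot (h : P.Closes m) {e : P.Dart} (hv : P.Valid e.1) :
    h.elt (P.rot e) = h.elt e * vertexRot P.deg m := by
  obtain ⟨d, hd⟩ := exists_eq_dart h.toAdmissible e
  rw [hd, rot_dart hv, h.elt_dart, h.elt_dart]
  exact ((treeMap_develDart (vertexRot_pow _ _) (edgeRot_sq _ _)).rot _ hv d).symm

theorem Closes.elt_flip (h : P.Closes m) {e : P.Dart} (hv : P.Valid e.1) :
    h.elt (P.flip e) = h.elt e * edgeRot P.deg m := by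
  obtain ⟨d, hd⟩ := exists_eq_dart h.toAdmissible e
  obtain ⟨d', hd'⟩ := exists_eq_dart h.toAdmissible (P.flip e)
  rw [hd', hd, h.elt_dart, h.elt_dart, ← hd]
  refine h.toAdmissible.develDart_flip h.crossing_life h.hor_eq (vertexRot_pow _ _)
    (edgeRot_sq _ _) (vertexRot_mul_edgeRot_pow _ _) hv d ?_
  rw [← hd, ← hd']

/-- Both maps follow the generators, so induction on words suffices. In particular `orbit` is
injective: the layered graph is not a proper quotient of the tessellation. -/
theorem Closes.elt_orbit (h : P.Closes m) (g : TessGroup P.deg m) : h.elt (h.orbit g) = g := by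
  induction g using tessGroup_induction with
  | one =>
    rw [h.orbit_one, h.elt_dart]
    simp [develDart, devel]
  | rot g => rw [h.orbit_mul_vertexRot, h.elt_rot (h.valid_orbit g), mul_left_inj]
  | edge g => rw [h.orbit_mul_edgeRot, h.elt_flip (h.valid_orbit g), mul_left_inj]

theorem Closes.orbit_mul_zpow (h : P.Closes m) {g : TessGroup P.deg m} {v : List ℕ} {d : ℤ}
    (hg : h.orbit g = P.dart v d) (n : ℤ) :
    h.orbit (g * vertexRot P.deg m ^ n) = P.dart v (d + n) := by
  have hv : P.Valid v := by
    have := h.valid_orbit g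
    rwa [hg] at this
  induction n using Int.induction_on with
  | zero => simpa using hg
  | succ i ih =>
    rw [zpow_add_one, ← mul_assoc, h.orbit_mul_vertexRot, ih, rot_dart hv, add_assoc]
  | pred i ih =>
    apply rot_injective
    rw [← h.orbit_mul_vertexRot, mul_assoc, ← zpow_add_one, sub_add_cancel, ih, rot_dart hv]
    congr 1
    ring

/-- The address of a vertex. -/
noncomputable def Closes.addr (h : P.Closes m) (q : TessVertex P.deg m) : List ℕ :=
  Quotient.liftOn' q (fun g => (h.orbit g).1) (by
    intro a b hab
    rw [QuotientGroup.leftRel_apply, Subgroup.mem_zpowers_iff] at hab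
    obtain ⟨n, hn⟩ := hab
    obtain ⟨d, hd⟩ := exists_eq_dart h.toAdmissible (h.orbit a)
    have := h.orbit_mul_zpow hd n
    rw [hn, mul_inv_cancel_left] at this
    simp only [this]
    rfl)

theorem Closes.addr_coe (h : P.Closes m) (g : TessGroup P.deg m) :
    h.addr (g : TessVertex P.deg m) = (h.orbit g).1 := rfl

theorem Closes.addr_injective (h : P.Closes m) : Function.Injective h.addr := by
  intro p q hpq
  induction p using QuotientGroup.induction_on with
  | H a =>
  induction q using QuotientGroup.induction_on with
  | H b =>
  rw [h.addr_coe, h.addr_coe] at hpq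
  obtain ⟨d, hd⟩ := exists_eq_dart h.toAdmissible (h.orbit a)
  obtain ⟨e, he⟩ := exists_eq_dart h.toAdmissible (h.orbit b)
  have h1 := h.orbit_mul_zpow hd (e - d)
  rw [add_sub_cancel, hpq, ← he] at h1
  have h2 := congrArg h.elt h1
  rw [h.elt_orbit, h.elt_orbit] at h2
  rw [QuotientGroup.eq, ← h2, inv_mul_cancel_left]
  exact ⟨e - d, rfl⟩

theorem Closes.addr_valid (h : P.Closes m) (q : TessVertex P.deg m) : P.Valid (h.addr q) := by
  induction q using QuotientGroup.induction_on with
  | H a => exact h.valid_orbit a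

theorem Closes.exists_addr_eq (h : P.Closes m) {v : List ℕ} (hv : P.Valid v) :
    ∃ q, h.addr q = v := by
  suffices ∃ g, h.orbit g = P.dart v 0 by
    obtain ⟨g, hg⟩ := this
    exact ⟨g, by rw [h.addr_coe, hg]; rfl⟩
  induction v with
  | nil => exact ⟨1, h.orbit_one⟩
  | cons k v ih =>
    obtain ⟨g, hg⟩ := ih hv.2
    refine ⟨g * vertexRot P.deg m ^ ((P.off (P.typ v) : ℤ) + k) * edgeRot P.deg m, ?_⟩
    rw [h.orbit_mul_edgeRot, h.orbit_mul_zpow hg, zero_add, h.toAdmissible.flip_up hv]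

theorem Closes.length_flip_le (h : P.Closes m) (g : TessGroup P.deg m) :
    (h.orbit (g * edgeRot P.deg m)).1.length ≤ (h.orbit g).1.length + 1 := by
  rw [h.orbit_mul_edgeRot]
  exact (h.toAdmissible.flip_valid (h.valid_orbit g)).2

/-- A graded exhaustion of a graph by a function that increases by at most one along edges and
has descending neighbours is the distance. -/
theorem _root_.SimpleGraph.edist_eq_of_descend {V : Type*} (G : SimpleGraph V) (x₀ : V) (r : V → ℕ)
    (h0 : ∀ q, r q = 0 ↔ q = x₀) (hadj : ∀ p q, G.Adj p q → r q ≤ r p + 1)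
    (hdesc : ∀ q n, r q = n + 1 → ∃ p, r p = n ∧ G.Adj p q) (q : V) : G.edist x₀ q = r q := by
  apply le_antisymm
  · suffices ∀ n q, r q = n → ∃ p : G.Walk x₀ q, p.length = n by
      obtain ⟨p, hp⟩ := this _ q rfl
      rw [← hp]
      exact SimpleGraph.edist_le p
    intro n
    induction n with
    | zero =>
      intro q hq
      obtain rfl := (h0 q).1 hq
      exact ⟨.nil, rfl⟩
    | succ n ih =>
      intro q hq
      obtain ⟨p, hp, hpq⟩ := hdesc q n hq
      obtain ⟨w, hw⟩ := ih p hp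
      exact ⟨w.concat hpq, by simp [hw]⟩
  · refine le_iInf fun w => ?_
    have : ∀ (a b : V) (w : G.Walk a b), r b ≤ r a + w.length := by
      intro a b w
      induction w with
      | nil => simp
      | cons hab w ih =>
        have := hadj _ _ hab
        simp only [SimpleGraph.Walk.length_cons]
        omega
    have h1 := this _ _ w
    rw [(h0 x₀).2 rfl, zero_add] at h1
    exact_mod_cast h1

/-- The distance in the tessellation graph. -/
theorem Closes.edist_eq (h : P.Closes m) (g₀ : TessGroup P.deg m) (q : TessVertex P.deg m) :
    (tessGraph P.deg m).edist (g₀ : TessVertex P.deg m) q = (h.addr (g₀⁻¹ • q)).length := by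
  refine SimpleGraph.edist_eq_of_descend _ _ (fun q => (h.addr (g₀⁻¹ • q)).length) ?_ ?_ ?_ q
  · intro q
    rw [List.length_eq_zero_iff]
    have h1 : h.addr (1 : TessGroup P.deg m) = [] := by rw [h.addr_coe, h.orbit_one]; rfl
    rw [← h1, h.addr_injective.eq_iff, inv_smul_eq_iff]
    simp
  · intro p q hpq
    rw [tessGraph, SimpleGraph.fromRel_adj] at hpq
    obtain ⟨-, ⟨g, rfl, rfl⟩ | ⟨g, rfl, rfl⟩⟩ := hpq
    · simp only [MulAction.Quotient.smul_coe, smul_eq_mul, h.addr_coe, ← mul_assoc]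
      exact h.length_flip_le _
    · simp only [MulAction.Quotient.smul_coe, smul_eq_mul, h.addr_coe, ← mul_assoc]
      have := h.length_flip_le (g₀⁻¹ * g * edgeRot P.deg m)
      rwa [mul_assoc, ← pow_two, edgeRot_sq, mul_one] at this
  · intro q n hq
    induction q using QuotientGroup.induction_on with
    | H g =>
    simp only [MulAction.Quotient.smul_coe, smul_eq_mul, h.addr_coe] at hq
    obtain ⟨d, hd⟩ := exists_eq_dart h.toAdmissible (h.orbit (g₀⁻¹ * g))
    have hv := h.valid_orbit (g₀⁻¹ * g)
    obtain ⟨k, v, hkv⟩ := List.exists_cons_of_length_eq_add_one hq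
    rw [hkv] at hd hq hv
    -- Another representative of the coset points in direction `0`, along the edge to the tree
    -- parent one layer below.
    have h1 := h.orbit_mul_zpow hd (-d)
    rw [add_neg_cancel] at h1
    set g' := g * vertexRot P.deg m ^ (-d) with hg'
    have h2 : (g : TessVertex P.deg m) = g' := by
      rw [QuotientGroup.eq, hg', inv_mul_cancel_left]
      exact ⟨-d, rfl⟩
    have h3 : (h.orbit (g₀⁻¹ * (g' * edgeRot P.deg m))).1 = v := by
      rw [hg', ← mul_assoc, ← mul_assoc, h.orbit_mul_edgeRot, h1, h.toAdmissible.flip_down hv]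
      rfl
    have h4 : (h.orbit (g₀⁻¹ * g')).1 = k :: v := by
      rw [hg', ← mul_assoc, h1]
      rfl
    refine ⟨((g' * edgeRot P.deg m : TessGroup P.deg m) : TessVertex P.deg m), ?_, ?_⟩
    · simp only [MulAction.Quotient.smul_coe, smul_eq_mul, h.addr_coe, h3]
      simpa using hq
    · rw [tessGraph, SimpleGraph.fromRel_adj]
      refine ⟨fun heq => ?_, Or.inr ⟨g', h2, rfl⟩⟩
      have h5 := congrArg (fun q => (h.addr (g₀⁻¹ • q)).length) (heq.trans h2)
      simp only [MulAction.Quotient.smul_coe, smul_eq_mul, h.addr_coe, h3, h4] at h5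
      simp at h5

/-- The spheres of the tessellation graph have as many elements as there are valid addresses. -/
theorem Closes.ncard_sphere (h : P.Closes m) (x₀ : TessVertex P.deg m) (n : ℕ) :
    Set.ncard {q | (tessGraph P.deg m).edist x₀ q = n}
      = Set.ncard {v | P.Valid v ∧ v.length = n} := by
  induction x₀ using QuotientGroup.induction_on with
  | H g₀ =>
  refine Set.ncard_congr (fun q _ => h.addr (g₀⁻¹ • q)) ?_ ?_ ?_
  · intro q hq
    rw [Set.mem_ofPred_eq, h.edist_eq] at hq
    exact ⟨h.addr_valid _, by exact_mod_cast hq⟩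
  · intro p q _ _ hpq
    exact smul_left_cancel _ (h.addr_injective hpq)
  · intro v hv
    obtain ⟨q, hq⟩ := h.exists_addr_eq hv.1
    refine ⟨g₀ • q, ?_, by rw [inv_smul_smul, hq]⟩
    rw [Set.mem_ofPred_eq, h.edist_eq, inv_smul_smul, hq, hv.2]

end LayerData

/-! ### Counting gaps by age -/

namespace LayerData

variable {P : LayerData}

/-- The valid addresses of the `n`-th layer. -/
def layer (P : LayerData) : ℕ → Finset (List ℕ)
  | 0 => {[]}
  | n + 1 => (layer P n).biUnion fun v => (Finset.range (P.own (P.typ v))).image (· :: v)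

theorem mem_layer {n : ℕ} {v : List ℕ} : v ∈ P.layer n ↔ P.Valid v ∧ v.length = n := by
  induction n generalizing v with
  | zero =>
    rw [layer, Finset.mem_singleton, List.length_eq_zero_iff]
    exact ⟨fun h => ⟨h ▸ trivial, h⟩, fun h => h.2⟩
  | succ n ih =>
    simp only [layer, Finset.mem_biUnion, Finset.mem_image, Finset.mem_range]
    constructor
    · rintro ⟨u, hu, k, hk, rfl⟩
      rw [ih] at hu
      exact ⟨⟨hk, hu.1⟩, by simp [hu.2]⟩
    · rintro ⟨h1, h2⟩
      obtain ⟨k, u, rfl⟩ := List.exists_cons_of_length_eq_add_one h2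
      exact ⟨u, ih.2 ⟨h1.2, by simpa using h2⟩, k, h1.1, rfl⟩

theorem sum_layer_succ {M : Type*} [AddCommMonoid M] (n : ℕ) (F : List ℕ → M) :
    ∑ v ∈ P.layer (n + 1), F v
      = ∑ v ∈ P.layer n, ∑ k ∈ Finset.range (P.own (P.typ v)), F (k :: v) := by
  rw [layer, Finset.sum_biUnion]
  · refine Finset.sum_congr rfl fun v _ => ?_
    rw [Finset.sum_image]
    intro a _ b _ hab
    simpa using hab
  · intro u _ v _ huv
    rw [Function.onFun, Finset.disjoint_left]
    intro a ha hb
    simp only [Finset.mem_image] at ha hb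
    obtain ⟨i, -, rfl⟩ := ha
    obtain ⟨j, -, hj⟩ := hb
    exact huv (List.cons.inj hj).2.symm

theorem Admissible.sum_left_children (h : P.Admissible) {v : List ℕ} (hv : P.Valid v)
    (F : ℕ → ℤ) : ∑ k ∈ Finset.range (P.own (P.typ v)), F (P.typ (k :: v)).left
      = F (P.age (P.typ v).left) + ((P.own (P.typ v) : ℤ) - 1) * F 1 := by
  have h1 := h.own_pos v hv
  obtain ⟨o, ho⟩ : ∃ o, P.own (P.typ v) = o + 1 := ⟨_, (Nat.sub_add_cancel h1).symm⟩
  rw [ho, Finset.sum_range_succ', add_comm]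
  simp [left_cons]

theorem Admissible.sum_right_children (h : P.Admissible) {v : List ℕ} (hv : P.Valid v)
    (F : ℕ → ℤ) : ∑ k ∈ Finset.range (P.own (P.typ v)), F (P.typ (k :: v)).right
      = F (P.age (P.typ v).right) + ((P.own (P.typ v) : ℤ) - 1) * F 1 := by
  have h1 := h.own_pos v hv
  obtain ⟨o, ho⟩ : ∃ o, P.own (P.typ v) = o + 1 := ⟨_, (Nat.sub_add_cancel h1).symm⟩
  simp only [right_cons]
  rw [ho, Finset.sum_range_succ, add_comm]
  simp only [if_true]
  rw [Finset.sum_congr rfl (g := fun _ => F 1)]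
  · simp
  · intro k hk
    rw [Finset.mem_range] at hk
    rw [if_neg (by omega)]

/-- Every gap is the left gap of one vertex and the right gap of another. The induction needs no
bijection, since the children of a vertex contribute by the same formula on either side. -/
theorem Admissible.sum_left_eq_sum_right (h : P.Admissible) (n : ℕ) (F : ℕ → ℤ) :
    ∑ v ∈ P.layer n, F (P.typ v).left = ∑ v ∈ P.layer n, F (P.typ v).right := by
  induction n generalizing F with
  | zero => simp [layer]
  | succ n ih =>
    rw [sum_layer_succ, sum_layer_succ]
    rw [Finset.sum_congr rfl fun v hv => h.sum_left_children (mem_layer.1 hv).1 F,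
      Finset.sum_congr rfl fun v hv => h.sum_right_children (mem_layer.1 hv).1 F,
      Finset.sum_add_distrib, Finset.sum_add_distrib, ih fun i => F (P.age i)]

/-- The number of gaps of age `i` in the `n`-th layer. -/
def gaps (P : LayerData) (i n : ℕ) : ℤ := ∑ v ∈ P.layer n, if (P.typ v).right = i then 1 else 0

theorem right_pos {n : ℕ} {v : List ℕ} (hv : v ∈ P.layer (n + 1)) :
    1 ≤ (P.typ v).right := by
  obtain ⟨k, u, rfl⟩ := List.exists_cons_of_length_eq_add_one (mem_layer.1 hv).2
  rw [right_cons, age]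
  split_ifs <;> omega

theorem gaps_succ_layer_zero (i : ℕ) : P.gaps (i + 1) 0 = 0 := by
  simp [gaps, layer]

theorem gaps_zero (n : ℕ) :
    P.gaps 0 n = if n = 0 then 1 else 0 := by
  cases n with
  | zero => rfl
  | succ n =>
    rw [gaps, Finset.sum_eq_zero]
    · simp
    · intro v hv
      have := right_pos hv
      rw [if_neg (by omega)]

theorem Admissible.gaps_of_lt (h : P.Admissible) {i : ℕ} (hi : P.life < i) (n : ℕ) :
    P.gaps i n = 0 := by
  rw [gaps, Finset.sum_eq_zero]
  intro v _
  have := h.right_le v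
  rw [if_neg (by omega)]

theorem Admissible.gaps_succ (h : P.Admissible) {i : ℕ} (hi : 1 ≤ i) (hi' : i < P.life) (n : ℕ) :
    P.gaps (i + 1) (n + 1) = P.gaps i n := by
  rw [gaps, sum_layer_succ, gaps]
  refine Finset.sum_congr rfl fun v hv => ?_
  rw [h.sum_right_children (mem_layer.1 hv).1 fun j => if j = i + 1 then 1 else 0, age]
  split_ifs <;> omega

/-- Consecutive outgoing edges enclose a new gap, so a vertex contributes one fewer than its
outgoing edges; the edges of the base vertex go all the way round and give one more. -/
theorem Admissible.gaps_one_succ (h : P.Admissible) (n : ℕ) :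
    P.gaps 1 (n + 1) = ∑ v ∈ P.layer n, ((P.kids (P.typ v) : ℤ) - 1) + P.gaps 0 n := by
  rw [gaps, sum_layer_succ, gaps, ← Finset.sum_add_distrib]
  refine Finset.sum_congr rfl fun v hv => ?_
  rw [h.sum_right_children (mem_layer.1 hv).1 fun j => if j = 1 then 1 else 0, age]
  have h1 := h.own_add (mem_layer.1 hv).1
  have h2 := h.right_le v
  have h3 := h.life_pos
  split_ifs at h1 ⊢ <;> omega

/-- Each expiring gap produces one vertex with two parents, the first child of the vertex on its
right. -/
theorem Admissible.sum_top (h : P.Admissible) (n : ℕ) :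
    ∑ v ∈ P.layer (n + 1), (if (P.typ v).isTop then 1 else 0 : ℤ) = P.gaps P.life n := by
  rw [sum_layer_succ, gaps,
    ← h.sum_left_eq_sum_right n fun j => if j = P.life then 1 else 0]
  refine Finset.sum_congr rfl fun v hv => ?_
  obtain ⟨o, ho⟩ : ∃ o, P.own (P.typ v) = o + 1 :=
    ⟨_, (Nat.sub_add_cancel (h.own_pos v (mem_layer.1 hv).1)).symm⟩
  rw [ho, Finset.sum_range_succ']
  simp [isTop_cons]

theorem Admissible.kids_eq (h : P.Admissible) {n : ℕ} {v : List ℕ} (hv : v ∈ P.layer (n + 1)) :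
    (P.kids (P.typ v) : ℤ) - 1 = (P.deg - 2) - (if (P.typ v).isTop then 1 else 0)
      - (if (P.typ v).left = P.hor then 1 else 0) - (if (P.typ v).right = P.hor then 1 else 0) := by
  have h1 := h.off_add_kids (mem_layer.1 hv).1
  obtain ⟨k, u, rfl⟩ := List.exists_cons_of_length_eq_add_one (mem_layer.1 hv).2
  rw [off] at h1
  simp only [isRoot_cons, Bool.false_eq_true, if_false] at h1
  split_ifs at h1 ⊢ <;> omega

theorem Admissible.gaps_one_succ_succ (h : P.Admissible) (n : ℕ) :
    P.gaps 1 (n + 2) = (P.deg - 2) * (P.layer (n + 1)).card - P.gaps P.life n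
      - 2 * P.gaps P.hor (n + 1) := by
  rw [h.gaps_one_succ, gaps_zero, if_neg (by omega), add_zero,
    Finset.sum_congr rfl fun v hv => h.kids_eq hv, Finset.sum_sub_distrib, Finset.sum_sub_distrib,
    Finset.sum_sub_distrib, h.sum_top,
    h.sum_left_eq_sum_right (n + 1) fun j => if j = P.hor then 1 else 0, gaps, gaps]
  simp only [Finset.sum_const, nsmul_eq_mul]
  ring

theorem Admissible.gaps_one_one (h : P.Admissible) : P.gaps 1 1 = P.deg := by
  have h1 := h.off_add_kids (v := []) trivial
  have h2 := h.hor_pos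
  rw [off] at h1
  simp [show ¬ 0 = P.hor by omega] at h1
  rw [show (1 : ℕ) = 0 + 1 from rfl, h.gaps_one_succ, gaps_zero]
  simp [layer, h1]

theorem Admissible.card_layer (h : P.Admissible) (n : ℕ) :
    ((P.layer n).card : ℤ) = P.gaps 0 n + ∑ i ∈ Finset.range P.life, P.gaps (i + 1) n := by
  rw [add_comm, ← Finset.sum_range_succ' (fun i => P.gaps i n) P.life]
  simp only [gaps]
  rw [Finset.sum_comm, Finset.card_eq_sum_ones, Nat.cast_sum]
  refine Finset.sum_congr rfl fun v _ => ?_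
  have := h.right_le v
  rw [Finset.sum_ite_eq, if_pos (Finset.mem_range.2 (by omega))]
  simp

/-- The generating function of the layers. -/
theorem Admissible.growth (h : P.Admissible) :
    (PowerSeries.mk fun n => ((P.layer n).card : ℤ)) *
      (1 + PowerSeries.C (2 - (P.deg : ℤ)) * (∑ i ∈ Finset.Ico 1 (P.life + 1), PowerSeries.X ^ i) + PowerSeries.X ^ (P.life + 1)
        + if P.hor ≤ P.life then 2 * PowerSeries.X ^ P.hor else 0) =
      1 + PowerSeries.C 2 * (∑ i ∈ Finset.Ico 1 (P.life + 1), PowerSeries.X ^ i) + PowerSeries.X ^ (P.life + 1)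
        + if P.hor ≤ P.life then 2 * PowerSeries.X ^ P.hor else 0 := by
  set V : PowerSeries ℤ := PowerSeries.mk fun n => ((P.layer n).card : ℤ) with hV
  set R : ℕ → PowerSeries ℤ := fun i => PowerSeries.mk (P.gaps i) with hR
  have hl := h.life_pos
  have hR1 : ∀ i, i < P.life → R (i + 1) = PowerSeries.X ^ i * R 1 := by
    intro i
    induction i with
    | zero => simp
    | succ i ih =>
      intro hi
      rw [pow_succ', mul_assoc, ← ih (by omega)]
      ext n
      cases n with
      | zero => simp [hR, gaps_succ_layer_zero]
      | succ n =>
        rw [PowerSeries.coeff_succ_X_mul]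
        simp only [hR, PowerSeries.coeff_mk]
        exact h.gaps_succ (by omega) hi n
  -- Vertices are counted by the gap on their right; the summand `1` is the base vertex.
  have hV1 : V = 1 + R 1 * ∑ i ∈ Finset.range P.life, PowerSeries.X ^ i := by
    rw [Finset.mul_sum, Finset.sum_congr rfl (g := fun i => R (i + 1))]
    · ext n
      simp only [hV, hR, map_add, map_sum, PowerSeries.coeff_mk, h.card_layer, gaps_zero, PowerSeries.coeff_one]
    · intro i hi
      rw [hR1 i (Finset.mem_range.1 hi), mul_comm]
  -- The recurrence for new gaps. The base vertex is taken out of `V` because it opens `deg` gaps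
  -- rather than `deg - 2`.
  have hB : R 1 = PowerSeries.X * (PowerSeries.C (P.deg : ℤ) + PowerSeries.C ((P.deg : ℤ) - 2) * (V - 1) - PowerSeries.X * R P.life
      - 2 * R P.hor) := by
    have h2 : (2 : PowerSeries ℤ) = PowerSeries.C 2 := by simp
    ext n
    rcases n with _ | _ | n
    · simp [hR, gaps_succ_layer_zero]
    · rw [PowerSeries.coeff_succ_X_mul, h2]
      have h3 : P.gaps P.hor 0 = 0 := by
        have := gaps_succ_layer_zero (P := P) (P.hor - 1)
        rwa [Nat.sub_add_cancel h.hor_pos] at this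
      simp only [map_sub, map_add, PowerSeries.coeff_C_mul, PowerSeries.coeff_zero_X_mul]
      simp [hR, hV, h3, h.gaps_one_one, layer]
    · have h4 := h.gaps_one_succ_succ n
      rw [PowerSeries.coeff_succ_X_mul, h2]
      generalize (P.deg : ℤ) - 2 = c at h4 ⊢
      simp only [map_sub, map_add, PowerSeries.coeff_C_mul, PowerSeries.coeff_succ_X_mul,
        PowerSeries.coeff_C, PowerSeries.coeff_one, hR, hV, PowerSeries.coeff_mk,
        h4, Nat.add_eq_zero_iff, one_ne_zero, and_false, if_false]
      ring
  have hS : ∑ i ∈ Finset.Ico 1 (P.life + 1), (PowerSeries.X : PowerSeries ℤ) ^ i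
      = PowerSeries.X * ∑ i ∈ Finset.range P.life, PowerSeries.X ^ i := by
    rw [Finset.sum_Ico_eq_sum_range, Finset.mul_sum, Nat.add_sub_cancel]
    refine Finset.sum_congr rfl fun i _ => ?_
    rw [add_comm, pow_succ']
  have hN : PowerSeries.X * R P.life = PowerSeries.X ^ P.life * R 1 := by
    have := hR1 (P.life - 1) (by omega)
    rw [Nat.sub_add_cancel hl] at this
    rw [this, ← mul_assoc, ← pow_succ', Nat.sub_add_cancel hl]
  have hH : PowerSeries.X * R P.hor = (if P.hor ≤ P.life then PowerSeries.X ^ P.hor else 0) * R 1 := by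
    have h0 := h.hor_pos
    split_ifs with h1
    · have := hR1 (P.hor - 1) (by omega)
      rw [Nat.sub_add_cancel h0] at this
      rw [this, ← mul_assoc, ← pow_succ', Nat.sub_add_cancel h0]
    · have : R P.hor = 0 := by
        ext n
        simp [hR, h.gaps_of_lt (by omega : P.life < P.hor)]
      simp [this]
  rw [hS]
  have h2 : (if P.hor ≤ P.life then 2 * (PowerSeries.X : PowerSeries ℤ) ^ P.hor else 0)
    = 2 * (if P.hor ≤ P.life then PowerSeries.X ^ P.hor else 0) := by split_ifs <;> simp
  rw [h2]
  generalize (if P.hor ≤ P.life then (PowerSeries.X : PowerSeries ℤ) ^ P.hor else 0) = E at *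
  generalize ∑ i ∈ Finset.range P.life, (PowerSeries.X : PowerSeries ℤ) ^ i = S at *
  have hC : (PowerSeries.C (2 - (P.deg : ℤ)) : PowerSeries ℤ) = 2 - PowerSeries.C (P.deg : ℤ) := by simp
  have hC' : (PowerSeries.C ((P.deg : ℤ) - 2) : PowerSeries ℤ) = PowerSeries.C (P.deg : ℤ) - 2 := by simp
  have hC2 : (PowerSeries.C (2 : ℤ) : PowerSeries ℤ) = 2 := by simp
  rw [hC, hC2]
  rw [hV1, hC'] at hB
  rw [hV1, pow_succ']
  linear_combination S * hB - PowerSeries.X * S * hN - 2 * S * hH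

end LayerData

/-! ### The layer data of a hyperbolic tessellation -/

/-- The layered graph of the tessellation by `m`-gons, `ℓ` at each vertex. -/
def tessLayers (ℓ m : ℕ) : LayerData where
  deg := ℓ
  -- For even `m` a face is cut by `m / 2 - 1` layers, and `hor` exceeds `life`, so no edge lies
  -- inside a layer. For `m = 2w + 1` the lower face occupies the ages `1, …, w` and the upper one
  -- `w, …, 2w - 1`, sharing the age of the edge between them.
  life := if Even m then m / 2 - 1 else m - 2
  hor := m / 2

namespace LayerData

variable {ℓ m : ℕ}

/-- The vertex types occurring in a hyperbolic tessellation. -/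
structure Reachable (P : LayerData) (s : VertexType) : Prop where
  not_root : s.isRoot = false
  left_pos : 1 ≤ s.left
  left_le : s.left ≤ P.life
  right_pos : 1 ≤ s.right
  right_le : s.right ≤ P.life
  top : s.isTop = true → s.left = 1 ∧ s.right = 1
  -- Two old gaps meet only at an only child. This forces degree 3 and a parent that spends an edge
  -- on a second parent or on a neighbour in its layer.
  ages : s.left = 1 ∨ s.right = 1 ∨ (P.deg = 3 ∧ ((s.left = 2 ∧ s.right = 2) ∨
    (s.left = P.hor + 1 ∧ s.right = 2) ∨ (s.left = 2 ∧ s.right = P.hor + 1)))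

theorem hyperbolic_cases (hℓ : 3 ≤ ℓ) (hm : 3 ≤ m) (hyp : 4 < (ℓ - 2) * (m - 2)) :
    (ℓ = 3 ∧ 7 ≤ m) ∨ (ℓ = 4 ∧ 5 ≤ m) ∨ (5 ≤ ℓ ∧ 4 ≤ m) ∨ 7 ≤ ℓ := by
  rcases (by omega : ℓ = 3 ∨ ℓ = 4 ∨ ℓ = 5 ∨ ℓ = 6 ∨ 7 ≤ ℓ) with rfl | rfl | rfl | rfl | h <;>
    omega

theorem tessLayers_cases (hm : 3 ≤ m) : ∃ w, (tessLayers ℓ m).hor = w ∧ 1 ≤ w ∧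
    ((m = 2 * w ∧ (tessLayers ℓ m).life = w - 1 ∧ 2 ≤ w) ∨
      (m = 2 * w + 1 ∧ (tessLayers ℓ m).life = 2 * w - 1)) := by
  refine ⟨m / 2, rfl, by omega, ?_⟩
  simp only [tessLayers]
  split_ifs with h
  · obtain ⟨w, rfl⟩ := h
    omega
  · rw [Nat.not_even_iff_odd] at h
    obtain ⟨w, rfl⟩ := h
    omega

/-- Two parents, two neighbours in the layer and a shared last child compete for the edges of a
vertex. For small degree the invariants of `Reachable` exclude the combinations that would use up
all edges. -/
theorem Reachable.own_pos (hℓ : 3 ≤ ℓ) (hm : 3 ≤ m) (hyp : 4 < (ℓ - 2) * (m - 2)) {s : VertexType}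
    (h : (tessLayers ℓ m).Reachable s) : 1 ≤ (tessLayers ℓ m).own s := by
  obtain ⟨h1, h2, h3, h4, h5, h6, h7⟩ := h
  have h8 := hyperbolic_cases hℓ hm hyp
  obtain ⟨w, hw, hw1, hw2⟩ := tessLayers_cases (ℓ := ℓ) hm
  have hd : (tessLayers ℓ m).deg = ℓ := rfl
  rw [own, kids, off, h1]
  rw [hw, hd] at *
  generalize (tessLayers ℓ m).life = N at *
  split_ifs <;> simp_all <;> omega

theorem Reachable.child (hℓ : 3 ≤ ℓ) (hm : 3 ≤ m) (hyp : 4 < (ℓ - 2) * (m - 2)) {s : VertexType}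
    (h : (tessLayers ℓ m).Reachable s) {k : ℕ} (hk : k < (tessLayers ℓ m).own s) :
    (tessLayers ℓ m).Reachable ((tessLayers ℓ m).child s k) := by
  obtain ⟨h1, h2, h3, h4, h5, h6, h7⟩ := h
  have h8 := hyperbolic_cases hℓ hm hyp
  obtain ⟨w, hw, hw1, hw2⟩ := tessLayers_cases (ℓ := ℓ) hm
  have hd : (tessLayers ℓ m).deg = ℓ := rfl
  have ho : (tessLayers ℓ m).own s = ℓ - (1 + (if s.isTop then 1 else 0) +
    if s.left = w then 1 else 0) - (if s.right = w then 1 else 0)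
      - (if s.right = (tessLayers ℓ m).life then 1 else 0) := by
    simp [own, kids, off, h1, hw, hd]
  rw [hw, hd] at h7
  have hl : ((tessLayers ℓ m).child s k).left = if k = 0 then
    (if s.left < (tessLayers ℓ m).life then s.left + 1 else 1) else 1 := rfl
  have hr : ((tessLayers ℓ m).child s k).right = if k + 1 = (tessLayers ℓ m).own s then
    (if s.right < (tessLayers ℓ m).life then s.right + 1 else 1) else 1 := rfl
  have ht : ((tessLayers ℓ m).child s k).isTop
    = decide (k = 0 ∧ s.left = (tessLayers ℓ m).life) := rfl
  constructor
  · rfl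
  all_goals
    rw [ho] at hk hr
    try rw [hw, hd]
    try rw [hl]
    try rw [hr]
    try rw [ht]
    clear hl hr ht ho
    generalize (tessLayers ℓ m).life = N at *
    try rw [decide_eq_true_iff]
    clear hyp hd hw
  · split_ifs <;> omega
  · split_ifs <;> omega
  · split_ifs <;> omega
  · split_ifs <;> omega
  · rintro ⟨rfl, ht⟩
    rcases Bool.eq_false_or_eq_true s.isTop with h9 | h9
    · have := h6 h9
      rw [if_pos h9] at hk ⊢
      split_ifs at hk ⊢ <;> omega
    · clear h6
      simp only [h9, Bool.false_eq_true, if_false] at hk ⊢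
      split_ifs at hk ⊢ <;> omega
  · rcases Bool.eq_false_or_eq_true s.isTop with h9 | h9
    · have := h6 h9
      rw [if_pos h9] at hk ⊢
      split_ifs at hk ⊢ <;> omega
    · clear h6
      simp only [h9, Bool.false_eq_true, if_false] at hk ⊢
      split_ifs at hk ⊢ <;> omega

theorem tessLayers_admissible (hℓ : 3 ≤ ℓ) (hm : 3 ≤ m) (hyp : 4 < (ℓ - 2) * (m - 2)) :
    (tessLayers ℓ m).Admissible := by
  obtain ⟨w, hw, hw1, hw2⟩ := tessLayers_cases (ℓ := ℓ) hm
  have hd : (tessLayers ℓ m).deg = ℓ := rfl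
  have hroot : (tessLayers ℓ m).own ((tessLayers ℓ m).typ []) = ℓ := by
    simp only [typ_nil, own, kids, off, hw, hd]
    simp [show 0 ≠ w by omega, show 0 ≠ (tessLayers ℓ m).life by omega]
  refine ⟨by omega, by omega, fun v hv => ?_⟩
  cases v with
  | nil => rw [hroot]; omega
  | cons k v =>
    suffices (tessLayers ℓ m).Reachable ((tessLayers ℓ m).typ (k :: v)) from
      this.own_pos hℓ hm hyp
    induction v generalizing k with
    | nil =>
      have hl : ((tessLayers ℓ m).typ [k]).left = 1 := by
        rw [left_cons]
        simp [age]
      have hr : ((tessLayers ℓ m).typ [k]).right = 1 := by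
        rw [right_cons]
        simp [age]
      refine ⟨rfl, ?_, ?_, ?_, ?_, fun _ => ⟨hl, hr⟩, Or.inl hl⟩ <;> omega
    | cons j v ih => exact (ih j hv.2).child hℓ hm hyp hv.1

theorem tessLayers_closes (hℓ : 3 ≤ ℓ) (hm : 3 ≤ m) (hyp : 4 < (ℓ - 2) * (m - 2)) :
    (tessLayers ℓ m).Closes m := by
  obtain ⟨w, hw, hw1, hw2⟩ := tessLayers_cases (ℓ := ℓ) hm
  refine ⟨tessLayers_admissible hℓ hm hyp, ?_, ?_⟩
  · rw [crossing, hw]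
    split_ifs <;> omega
  · omega

/-- The growth series of the tessellation graph. -/
theorem growthSeries_mul_growthDenom (hℓ : 3 ≤ ℓ) (hm : 3 ≤ m) (hyp : 4 < (ℓ - 2) * (m - 2))
    (x₀ : TessVertex ℓ m) :
    growthSeries (tessGraph ℓ m) x₀ * (growthDenom ℓ m : PowerSeries ℤ)
        = (growthNum m : PowerSeries ℤ) := by
  have h := tessLayers_closes hℓ hm hyp
  have h1 : growthSeries (tessGraph ℓ m) x₀
      = PowerSeries.mk fun n => (((tessLayers ℓ m).layer n).card : ℤ) := by
    rw [growthSeries]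
    congr 1
    ext1 n
    have h2 := h.ncard_sphere x₀ n
    have h3 : {v | (tessLayers ℓ m).Valid v ∧ v.length = n}
        = ((tessLayers ℓ m).layer n : Set (List ℕ)) := by
      ext v
      rw [Finset.mem_coe, mem_layer]
      rfl
    rw [h3, Set.ncard_coe_finset] at h2
    exact congrArg _ h2
  have h2 := h.toAdmissible.growth
  have hd : (tessLayers ℓ m).deg = ℓ := rfl
  obtain ⟨w, hw, hw1, hw2⟩ := tessLayers_cases (ℓ := ℓ) hm
  rw [h1, growthDenom, growthNum]
  rw [hw, hd] at h2
  have hX : (((2 : ℤ[X]) * X ^ w : ℤ[X]) : PowerSeries ℤ) = 2 * PowerSeries.X ^ w := by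
    rw [Polynomial.coe_mul, Polynomial.coe_pow, Polynomial.coe_X,
      show (2 : ℤ[X]) = C 2 by simp, Polynomial.coe_C]
    simp
  have hp : ∀ (a : ℤ) (b : ℕ), (plateau a b : PowerSeries ℤ) =
      1 + PowerSeries.C a * (∑ i ∈ Finset.Ico 1 b, PowerSeries.X ^ i) + PowerSeries.X ^ b := by
    intro a b
    rw [plateau, Polynomial.coe_add, Polynomial.coe_add, Polynomial.coe_mul, Polynomial.coe_C,
      Polynomial.coe_pow, Polynomial.coe_X, Polynomial.coe_one]
    congr 3
    rw [← Polynomial.coeToPowerSeries.ringHom_apply, map_sum]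
    simp
  rcases hw2 with ⟨rfl, hl, hw3⟩ | ⟨rfl, hl⟩
  · rw [hl, if_neg (by omega), Nat.sub_add_cancel (by omega), add_zero,
      add_zero] at h2
    rw [if_pos (by simp), if_pos (by simp), Nat.mul_div_cancel_left _ (by omega), hp, hp, h2]
  · rw [hl, if_pos (by omega), Nat.sub_add_cancel (by omega)] at h2
    rw [if_neg (by simp), if_neg (by simp), show (2 * w + 1) / 2 = w by omega,
      Polynomial.coe_add, Polynomial.coe_add, hp, hp, hX, h2]

end LayerData

/-! ### Closed forms of the denominator and its roots in the open disc -/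

section denominator

theorem plateau_mul_X_sub_one (a : ℤ) {b : ℕ} (hb : 1 ≤ b) :
    plateau a b * (X - 1) = (X - 1) * (1 + X ^ b) + C a * (X ^ b - X) := by
  have h : (∑ i ∈ Finset.Ico 1 b, (X : ℤ[X]) ^ i) * (X - 1) = X ^ b - X := by
    rw [geom_sum_Ico_mul _ hb, pow_one]
  rw [plateau]
  linear_combination C a * h

theorem growthDenom_even (ℓ w : ℕ) : growthDenom ℓ (2 * w) = plateau (2 - (ℓ : ℤ)) w := by
  rw [growthDenom, if_pos (by simp), Nat.mul_div_cancel_left _ (by omega)]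

theorem growthDenom_odd (ℓ w : ℕ) :
    growthDenom ℓ (2 * w + 1) = plateau (2 - (ℓ : ℤ)) (2 * w) + 2 * X ^ w := by
  rw [growthDenom, if_neg (by simp), show (2 * w + 1) / 2 = w by omega]

/-- The denominator multiplied by `X - 1`, for even `m`. -/
theorem growthDenom_even_mul (k : ℕ) {w : ℕ} (hw : 1 ≤ w) :
    growthDenom (k + 1) (2 * w) * (X - 1) = X ^ (w + 1) - C (k : ℤ) * X ^ w + C (k : ℤ) * X - 1 := by
  rw [growthDenom_even, plateau_mul_X_sub_one _ hw]
  push_cast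
  simp only [map_sub, map_add, C_1, C_ofNat]
  ring

/-- The denominator multiplied by `X - 1`, for odd `m`. -/
theorem growthDenom_odd_mul (k : ℕ) {w : ℕ} (hw : 1 ≤ w) :
    growthDenom (k + 1) (2 * w + 1) * (X - 1) = X ^ (2 * w + 1) - C (k : ℤ) * X ^ (2 * w)
      + 2 * X ^ (w + 1) - 2 * X ^ w + C (k : ℤ) * X - 1 := by
  rw [growthDenom_odd, add_mul, plateau_mul_X_sub_one _ (by omega)]
  push_cast
  simp only [map_sub, map_add, C_1, C_ofNat]
  ring

/-- In terms of `x = z ^ w`, a root satisfies `z * (x + k) = k * x + 1`, with reciprocal polynomials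
in `x` on the two sides. Both the location of the roots and the classification of the roots of unity
start from this form. -/
theorem aeval_even {R : Type*} [CommRing R] (k : ℕ) {w : ℕ} (hw : 1 ≤ w) (z : R) :
    aeval z (growthDenom (k + 1) (2 * w)) * (z - 1) = z * (z ^ w + k) - (k * z ^ w + 1) := by
  have h := congrArg (aeval z) (growthDenom_even_mul k hw)
  simp only [map_mul, map_sub, map_add, map_pow, aeval_X, map_one, map_natCast] at h
  rw [h]
  ring

theorem aeval_odd {R : Type*} [CommRing R] (k : ℕ) {w : ℕ} (hw : 1 ≤ w) (z : R) :
    aeval z (growthDenom (k + 1) (2 * w + 1)) * (z - 1)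
      = z * ((z ^ w) ^ 2 + 2 * z ^ w + k) - (k * (z ^ w) ^ 2 + 2 * z ^ w + 1) := by
  have h := congrArg (aeval z) (growthDenom_odd_mul k hw)
  simp only [map_mul, map_sub, map_add, map_pow, aeval_X, map_one, map_natCast,
    map_ofNat] at h
  rw [h]
  ring

/-- At a double root the factor `X - 1` contributes nothing to the derivative; multiplying by `z`
leaves only `z` and `z ^ w`. -/
theorem aeval_derivative_even {R : Type*} [CommRing R] (k : ℕ) {w : ℕ} (hw : 1 ≤ w) {z : R}
    (h0 : aeval z (growthDenom (k + 1) (2 * w)) = 0)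
    (h1 : aeval z (derivative (growthDenom (k + 1) (2 * w))) = 0) :
    (w + 1) * z * z ^ w - k * w * z ^ w + k * z = 0 := by
  have h := congrArg (fun p => aeval z (derivative p)) (growthDenom_even_mul k hw)
  obtain ⟨v, rfl⟩ : ∃ v, w = v + 1 := ⟨_, (Nat.sub_add_cancel hw).symm⟩
  simp only [derivative_mul, map_add, map_mul, h0, h1, zero_mul, derivative_X_pow,
    derivative_X, derivative_one, map_sub, map_pow, aeval_X, derivative_natCast, map_zero,
    map_natCast, map_one, Nat.add_sub_cancel] at h
  push_cast at h ⊢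
  linear_combination (-z) * h

theorem aeval_derivative_odd {R : Type*} [CommRing R] (k : ℕ) {w : ℕ} (hw : 1 ≤ w) {z : R}
    (h0 : aeval z (growthDenom (k + 1) (2 * w + 1)) = 0)
    (h1 : aeval z (derivative (growthDenom (k + 1) (2 * w + 1))) = 0) :
    (2 * w + 1) * z * (z ^ w) ^ 2 - 2 * w * k * (z ^ w) ^ 2 + 2 * (w + 1) * z * z ^ w
      - 2 * w * z ^ w + k * z = 0 := by
  have h := congrArg (fun p => aeval z (derivative p)) (growthDenom_odd_mul k hw)
  obtain ⟨v, rfl⟩ : ∃ v, w = v + 1 := ⟨_, (Nat.sub_add_cancel hw).symm⟩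
  simp only [derivative_mul, map_add, map_mul, h0, h1, zero_mul, derivative_X_pow,
    derivative_X, derivative_one, map_sub, map_pow, aeval_X, derivative_natCast,
    map_natCast, map_one, derivative_ofNat, map_ofNat, map_zero,
    Nat.add_sub_cancel, show 2 * (v + 1) - 1 = 2 * v + 1 by omega] at h
  push_cast at h ⊢
  linear_combination (-z) * h

/-- Equality in the Cauchy–Schwarz inequality: if the Gram matrix of the weighted vectors `f u`,
`f v` is that of the numbers `g u`, `g v`, then `f` is proportional to `g` on these points. -/
theorem proportional_of_gram {ι α : Type*} (s : Finset ι) (c : ι → ℝ) (hc : ∀ j ∈ s, 0 ≤ c j)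
    (f : ι → α → ℂ) (g : α → ℂ) {u v : α}
    (h : ∀ a b, (a = u ∨ a = v) → (b = u ∨ b = v) →
      g a * star (g b) = ∑ j ∈ s, (c j : ℂ) * (f j a * star (f j b)))
    {j : ι} (hj : j ∈ s) (hcj : 0 < c j) : g v * f j u = g u * f j v := by
  have h1 : ∑ j ∈ s, c j * Complex.normSq (g v * f j u - g u * f j v) = 0 := by
    rw [← Complex.ofReal_inj]
    push_cast
    have e : ∀ j, (c j : ℂ) * (Complex.normSq (g v * f j u - g u * f j v) : ℂ) =
        (g v * star (g v)) * (c j * (f j u * star (f j u)))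
        - (g v * star (g u)) * (c j * (f j u * star (f j v)))
        - (g u * star (g v)) * (c j * (f j v * star (f j u)))
        + (g u * star (g u)) * (c j * (f j v * star (f j v))) := by
      intro j
      rw [← Complex.mul_conj]
      simp only [map_sub, map_mul, Complex.star_def]
      ring
    rw [Finset.sum_congr rfl fun j _ => e j, Finset.sum_add_distrib, Finset.sum_sub_distrib,
      Finset.sum_sub_distrib, ← Finset.mul_sum, ← Finset.mul_sum, ← Finset.mul_sum,
      ← Finset.mul_sum, ← h u u (by simp) (by simp), ← h u v (by simp) (by simp),
      ← h v u (by simp) (by simp), ← h v v (by simp) (by simp)]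
    ring
  have h2 := (Finset.sum_eq_zero_iff_of_nonneg fun j hj =>
    mul_nonneg (hc j hj) (Complex.normSq_nonneg _)).1 h1 j hj
  rw [mul_eq_zero, or_iff_right hcj.ne', Complex.normSq_eq_zero, sub_eq_zero] at h2
  exact h2

theorem one_sub_mul_star_ne_zero {u v : ℂ} (hu : ‖u‖ < 1) (hv : ‖v‖ < 1) : 1 - u * star v ≠ 0 := by
  intro h
  have h1 : ‖u * star v‖ = 1 := by rw [← sub_eq_zero.1 h, norm_one]
  rw [norm_mul, norm_star] at h1
  nlinarith [norm_nonneg u, norm_nonneg v]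

/-- For even `m` there is at most one root in the open unit disc. -/
theorem eq_of_norm_lt_one_even {k w : ℕ} (hk : 2 ≤ k) (hw : 2 ≤ w) {u v : ℂ} (hu : ‖u‖ < 1)
    (hv : ‖v‖ < 1) (hu0 : u * (u ^ w + k) = k * u ^ w + 1)
    (hv0 : v * (v ^ w + k) = k * v ^ w + 1) : u = v := by
  have hk' : (2 : ℝ) ≤ k := by exact_mod_cast hk
  have hc : 0 < (k : ℝ) ^ 2 - 1 := by nlinarith
  -- By the root equations, `1 - a * star b` times the left side is `(k ^ 2 - 1) * (1 - (a * star b)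
  -- ^ w)`, and the quotient is a geometric sum.
  have gram : ∀ a b : ℂ, (a = u ∨ a = v) → (b = u ∨ b = v) →
      (a ^ w + k) * star (b ^ w + k) = ∑ j ∈ Finset.range w,
        (((k : ℝ) ^ 2 - 1 : ℝ) : ℂ) * (a ^ j * star (b ^ j)) := by
    have hall : ∀ a, (a = u ∨ a = v) → ‖a‖ < 1 ∧ a * (a ^ w + k) = k * a ^ w + 1 := by
      rintro a (rfl | rfl)
      exacts [⟨hu, hu0⟩, ⟨hv, hv0⟩]
    intro a b ha hb
    obtain ⟨ha1, ha0⟩ := hall a ha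
    obtain ⟨hb1, hb0⟩ := hall b hb
    have hb2 := congrArg star hb0
    simp only [star_mul', star_add, star_pow, star_natCast, star_one] at hb2 ⊢
    rw [← Finset.mul_sum]
    have hs : ∑ j ∈ Finset.range w, a ^ j * star b ^ j
        = ∑ j ∈ Finset.range w, (a * star b) ^ j := by simp only [mul_pow]
    rw [hs]
    have hg := mul_neg_geom_sum (a * star b) w
    rw [mul_pow] at hg
    have hne := one_sub_mul_star_ne_zero ha1 hb1
    generalize ∑ j ∈ Finset.range w, (a * star b) ^ j = S at *
    apply mul_left_cancel₀ hne
    push_cast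
    linear_combination (-(star b) * (star b ^ w + k)) * ha0 - (k * a ^ w + 1) * hb2
      - ((k : ℂ) ^ 2 - 1) * hg
  have hp := fun j (hj : j < w) => proportional_of_gram (Finset.range w) _ (fun _ _ => hc.le)
    (fun j a => a ^ j) (fun a => a ^ w + (k : ℂ)) gram (Finset.mem_range.2 hj) hc
  have h0 := hp 0 (by omega)
  have h1 := hp 1 (by omega)
  simp only [pow_zero, mul_one, pow_one] at h0 h1
  have hne : u ^ w + (k : ℂ) ≠ 0 := by
    intro h
    have : ‖u ^ w‖ = k := by rw [eq_neg_of_add_eq_zero_left h, norm_neg, Complex.norm_natCast]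
    rw [norm_pow] at this
    have h2 := pow_le_one₀ (norm_nonneg u) hu.le (n := w)
    linarith
  rw [h0] at h1
  exact mul_left_cancel₀ hne h1

/-- For odd `m` there is at most one root in the open unit disc. -/
theorem eq_of_norm_lt_one_odd {k w : ℕ} (hk : 2 ≤ k) (hw : 1 ≤ w) {u v : ℂ} (hu : ‖u‖ < 1)
    (hv : ‖v‖ < 1) (hu0 : u * ((u ^ w) ^ 2 + 2 * u ^ w + k) = k * (u ^ w) ^ 2 + 2 * u ^ w + 1)
    (hv0 : v * ((v ^ w) ^ 2 + 2 * v ^ w + k) = k * (v ^ w) ^ 2 + 2 * v ^ w + 1) : u = v := by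
  have hk' : (2 : ℝ) ≤ k := by exact_mod_cast hk
  -- With `x = a ^ w` and `y = star b ^ w`, the weights come from `(x² + 2x + k)(y² + 2y + k) - (kx²
  -- + 2x + 1)(ky² + 2y + 1) = (1 - xy)((k - 1)²(1 + xy) + 2(k - 1)(1 + x)(1 + y))`.
  let c : ℕ × Fin 3 → ℝ := fun j => ![((k : ℝ) - 1) ^ 2, ((k : ℝ) - 1) ^ 2, 2 * ((k : ℝ) - 1)] j.2
  let f : ℕ × Fin 3 → ℂ → ℂ := fun j a => ![a ^ j.1, a ^ w * a ^ j.1, (1 + a ^ w) * a ^ j.1] j.2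
  have hc : ∀ j, 0 < c j := by
    rintro ⟨i, t⟩
    have h1 : 0 < (k : ℝ) - 1 := by linarith
    fin_cases t <;> simp [c] <;> nlinarith
  have gram : ∀ a b : ℂ, (a = u ∨ a = v) → (b = u ∨ b = v) →
      ((a ^ w) ^ 2 + 2 * a ^ w + k) * star ((b ^ w) ^ 2 + 2 * b ^ w + k)
        = ∑ j ∈ Finset.range w ×ˢ Finset.univ, (c j : ℂ) * (f j a * star (f j b)) := by
    have hall : ∀ a, (a = u ∨ a = v) → ‖a‖ < 1 ∧
        a * ((a ^ w) ^ 2 + 2 * a ^ w + k) = k * (a ^ w) ^ 2 + 2 * a ^ w + 1 := by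
      rintro a (rfl | rfl)
      exacts [⟨hu, hu0⟩, ⟨hv, hv0⟩]
    intro a b ha hb
    obtain ⟨ha1, ha0⟩ := hall a ha
    obtain ⟨hb1, hb0⟩ := hall b hb
    have hb2 := congrArg star hb0
    rw [Finset.sum_product]
    simp only [star_mul', star_add, star_pow, star_natCast, star_one, star_ofNat] at hb2 ⊢
    have hs : ∀ j ∈ Finset.range w, ∑ t : Fin 3, (c (j, t) : ℂ) * (f (j, t) a * star (f (j, t) b))
        = (((k : ℂ) - 1) ^ 2 * (1 + a ^ w * star b ^ w)
          + 2 * ((k : ℂ) - 1) * ((1 + a ^ w) * (1 + star b ^ w))) * (a * star b) ^ j := by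
      intro j _
      simp only [Fin.sum_univ_three, c, f, Matrix.cons_val_zero, Matrix.cons_val_one,
        Matrix.cons_val, star_mul', star_add, star_pow, star_one, mul_pow]
      push_cast
      ring
    rw [Finset.sum_congr rfl hs, ← Finset.mul_sum]
    have hg := mul_neg_geom_sum (a * star b) w
    rw [mul_pow] at hg
    have hne := one_sub_mul_star_ne_zero ha1 hb1
    generalize ∑ j ∈ Finset.range w, (a * star b) ^ j = S at *
    apply mul_left_cancel₀ hne
    linear_combination (-(star b) * ((star b ^ w) ^ 2 + 2 * star b ^ w + k)) * ha0
      - (k * (a ^ w) ^ 2 + 2 * a ^ w + 1) * hb2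
      - (((k : ℂ) - 1) ^ 2 * (1 + a ^ w * star b ^ w)
          + 2 * ((k : ℂ) - 1) * ((1 + a ^ w) * (1 + star b ^ w))) * hg
  have hp := fun i t (hj : i < w) => proportional_of_gram _ c (fun j _ => (hc j).le)
    f (fun a => (a ^ w) ^ 2 + 2 * a ^ w + (k : ℂ)) gram (j := (i, t))
    (Finset.mem_product.2 ⟨Finset.mem_range.2 hj, Finset.mem_univ _⟩) (hc _)
  have h0 := hp 0 0 (by omega)
  simp only [f, pow_zero, mul_one, Matrix.cons_val_zero] at h0
  have hne : (u ^ w) ^ 2 + 2 * u ^ w + (k : ℂ) ≠ 0 := by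
    intro h
    have h1 := gram u u (by simp) (by simp)
    rw [h, zero_mul] at h1
    have h2 : ∑ j ∈ Finset.range w ×ˢ Finset.univ, c j * Complex.normSq (f j u) = 0 := by
      rw [← Complex.ofReal_inj]
      push_cast
      simp only [← Complex.mul_conj]
      exact h1.symm
    have h3 := (Finset.sum_eq_zero_iff_of_nonneg fun j _ =>
      mul_nonneg (hc j).le (Complex.normSq_nonneg _)).1 h2 (0, 0)
      (Finset.mem_product.2 ⟨Finset.mem_range.2 (by omega), Finset.mem_univ _⟩)
    rw [mul_eq_zero, or_iff_right (hc _).ne', Complex.normSq_eq_zero] at h3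
    simp [f] at h3
  -- For `w = 1` the geometric sum contains no first power; the component `a ^ w` takes its place.
  rcases (by omega : w = 1 ∨ 2 ≤ w) with rfl | hw2
  · have h1 := hp 0 1 (by omega)
    simp only [f, pow_zero, mul_one, Matrix.cons_val_one, Matrix.cons_val_zero] at h1
    rw [h0] at h1
    simpa using mul_left_cancel₀ hne h1
  · have h1 := hp 1 0 (by omega)
    simp only [f, pow_one, Matrix.cons_val_zero] at h1
    rw [h0] at h1
    exact mul_left_cancel₀ hne h1

end denominator

/-! ### Reciprocity, simplicity and the root outside the disc -/

section salem

theorem sum_Ico_add_one_X_pow_coeff (b n : ℕ) :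
    (∑ i ∈ Finset.Ico 1 b, (X : ℤ[X]) ^ i).coeff n = if 1 ≤ n ∧ n < b then 1 else 0 := by
  simp [finsetSum_coeff, coeff_X_pow]

theorem plateau_coeff (a : ℤ) {b : ℕ} (hb : 1 ≤ b) (n : ℕ) : (plateau a b).coeff n =
    if n = 0 ∨ n = b then 1 else if n < b then a else 0 := by
  rw [plateau, coeff_add, coeff_add, coeff_C_mul, sum_Ico_add_one_X_pow_coeff, coeff_one,
    coeff_X_pow]
  split_ifs <;> omega

/-- The shape of the denominator: a plateau with an optional extra middle term. -/
theorem growthDenom_coeff {ℓ m : ℕ} (hm : 3 ≤ m) : ∃ b : ℕ, 1 ≤ b ∧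
    (∀ n, b < n → (growthDenom ℓ m).coeff n = 0) ∧ (growthDenom ℓ m).coeff 0 = 1 ∧
    ∀ n ≤ b, (growthDenom ℓ m).coeff n = (growthDenom ℓ m).coeff (b - n) := by
  rcases Nat.even_or_odd' m with ⟨w, rfl | rfl⟩
  · rw [growthDenom_even]
    have hc := plateau_coeff (2 - (ℓ : ℤ)) (show 1 ≤ w by omega)
    refine ⟨w, by omega, fun n hn => ?_, ?_, fun n hn => ?_⟩
    · rw [hc, if_neg (by omega), if_neg (by omega)]
    · rw [hc, if_pos (Or.inl rfl)]
    · rw [hc, hc]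
      split_ifs <;> omega
  · rw [growthDenom_odd]
    have hc : ∀ n, (plateau (2 - (ℓ : ℤ)) (2 * w) + 2 * X ^ w).coeff n =
        (if n = 0 ∨ n = 2 * w then 1 else if n < 2 * w then (2 - (ℓ : ℤ)) else 0)
          + if n = w then 2 else 0 := by
      intro n
      rw [coeff_add, plateau_coeff _ (by omega), show (2 : ℤ[X]) = C 2 by simp, coeff_C_mul,
        coeff_X_pow]
      simp
    refine ⟨2 * w, by omega, fun n hn => ?_, ?_, fun n hn => ?_⟩
    · rw [hc, if_neg (by omega), if_neg (by omega), if_neg (by omega), add_zero]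
    · rw [hc, if_pos (Or.inl rfl), if_neg (by omega), add_zero]
    · rw [hc, hc]
      split_ifs <;> omega

theorem growthDenom_natDegree {ℓ m b : ℕ} (hb : ∀ n, b < n → (growthDenom ℓ m).coeff n = 0)
    (h0 : (growthDenom ℓ m).coeff 0 = 1)
    (hr : ∀ n ≤ b, (growthDenom ℓ m).coeff n = (growthDenom ℓ m).coeff (b - n)) :
    (growthDenom ℓ m).natDegree = b ∧ (growthDenom ℓ m).Monic := by
  have h1 : (growthDenom ℓ m).coeff b = 1 := by rw [hr b le_rfl, Nat.sub_self, h0]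
  have h2 : (growthDenom ℓ m).natDegree = b :=
    natDegree_eq_of_le_of_coeff_ne_zero
      (natDegree_le_iff_coeff_eq_zero.2 fun n hn => hb n hn) (by rw [h1]; exact one_ne_zero)
  exact ⟨h2, by rw [Monic, leadingCoeff, h2, h1]⟩

theorem growthDenom_monic (ℓ : ℕ) {m : ℕ} (hm : 3 ≤ m) : (growthDenom ℓ m).Monic := by
  obtain ⟨b, -, h1, h2, h3⟩ := growthDenom_coeff (ℓ := ℓ) hm
  exact (growthDenom_natDegree h1 h2 h3).2

theorem growthDenom_reciprocal (ℓ : ℕ) {m : ℕ} (hm : 3 ≤ m) :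
    IsReciprocalPoly (growthDenom ℓ m) := by
  obtain ⟨b, -, h1, h2, h3⟩ := growthDenom_coeff (ℓ := ℓ) hm
  have h4 := growthDenom_natDegree h1 h2 h3
  refine ⟨h4.2.ne_zero, ?_⟩
  rw [h4.1]
  exact h3

/-- For even `m` the roots on the unit circle are simple. -/
theorem simple_of_norm_one_even {k w : ℕ} (hk : 2 ≤ k) (hw : 2 ≤ w) (hyp : 2 < (k - 1) * (w - 1))
    {z : ℂ} (hz : ‖z‖ = 1) (h0 : aeval z (growthDenom (k + 1) (2 * w)) = 0)
    (h1 : aeval z (derivative (growthDenom (k + 1) (2 * w))) = 0) : False := by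
  have h2 := aeval_even k (show 1 ≤ w by omega) z
  have h3 := aeval_derivative_even k (show 1 ≤ w by omega) h0 h1
  rw [h0, zero_mul] at h2
  have hx : ‖z ^ w‖ = 1 := by rw [norm_pow, hz, one_pow]
  generalize z ^ w = x at *
  -- Elimination of `z`. On the unit circle the norms give `w * (k - 1) ≤ k + 1`, against the
  -- hyperbolic inequality.
  have h4 : (k * x + 1) * (x + k) = w * (k ^ 2 - 1) * x := by
    linear_combination (x + k) * h3 + (k + x + x * w) * h2
  have h5 := congrArg norm h4
  have hk' : (2 : ℝ) ≤ k := by exact_mod_cast hk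
  have hw' : (2 : ℝ) ≤ w := by exact_mod_cast hw
  have hyp' : (2 : ℝ) < (k - 1) * (w - 1) := by
    have : ((2 : ℕ) : ℝ) < (((k - 1) * (w - 1) : ℕ) : ℝ) := by exact_mod_cast hyp
    rwa [Nat.cast_mul, Nat.cast_sub (by omega), Nat.cast_sub (by omega), Nat.cast_one,
      Nat.cast_ofNat] at this
  have h6 : ‖(k : ℂ) ^ 2 - 1‖ = k ^ 2 - 1 := by
    rw [show (k : ℂ) ^ 2 - 1 = ((k ^ 2 - 1 : ℝ) : ℂ) by push_cast; ring, Complex.norm_real,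
      Real.norm_of_nonneg (by nlinarith)]
  have h7 : ‖k * x + 1‖ ≤ k + 1 := by
    refine (norm_add_le _ _).trans ?_
    rw [norm_mul, hx, Complex.norm_natCast, norm_one, mul_one]
  have h8 : ‖x + k‖ ≤ k + 1 := by
    refine (norm_add_le _ _).trans ?_
    rw [hx, Complex.norm_natCast, add_comm]
  rw [norm_mul, norm_mul, norm_mul, hx, h6, Complex.norm_natCast] at h5
  have h9 := mul_le_mul h7 h8 (norm_nonneg _) (by linarith)
  rw [h5] at h9
  have h10 : (k + 1 : ℝ) * (w * (k - 1)) ≤ (k + 1) * (k + 1) := by nlinarith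
  have h11 := le_of_mul_le_mul_left h10 (by linarith)
  nlinarith

/-- For odd `m` the roots on the unit circle are simple. -/
theorem simple_of_norm_one_odd {k w : ℕ} (hk : 2 ≤ k) (hw : 1 ≤ w)
    (hyp : 4 < (k - 1) * (2 * w - 1)) {z : ℂ} (hz : ‖z‖ = 1)
    (h0 : aeval z (growthDenom (k + 1) (2 * w + 1)) = 0)
    (h1 : aeval z (derivative (growthDenom (k + 1) (2 * w + 1))) = 0) : False := by
  have h2 := aeval_odd k hw z
  have h3 := aeval_derivative_odd k hw h0 h1
  rw [h0, zero_mul] at h2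
  have hx : ‖z ^ w‖ = 1 := by rw [norm_pow, hz, one_pow]
  generalize z ^ w = x at *
  have hk' : (2 : ℝ) ≤ k := by exact_mod_cast hk
  have hyp' : (4 : ℝ) < (k - 1) * (2 * w - 1) := by
    have : ((4 : ℕ) : ℝ) < (((k - 1) * (2 * w - 1) : ℕ) : ℝ) := by exact_mod_cast hyp
    rwa [Nat.cast_mul, Nat.cast_sub (by omega), Nat.cast_sub (by omega), Nat.cast_one,
      Nat.cast_ofNat, Nat.cast_mul, Nat.cast_ofNat] at this
  have h4 : (k * x ^ 2 + 2 * x + 1) * (x ^ 2 + 2 * x + k)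
      = 2 * w * (k - 1) * x * (x ^ 2 + (k + 1) * x + 1) := by
    linear_combination (x ^ 2 + 2 * x + k) * h3
      + (k + 2 * x + 2 * w * x + 2 * w * x ^ 2 + x ^ 2) * h2
  have hxx : x * star x = 1 := by
    rw [Complex.star_def, Complex.mul_conj, Complex.normSq_eq_norm_sq, hx]
    simp
  -- Division by `x ^ 2`, using that `star x` is the inverse of `x`. The factors on the left are
  -- conjugate, so the left side is a squared modulus and the equation concerns `x.re` alone.
  have h5 : (k * x + 2 + star x) * (x + 2 + k * star x)
      = 2 * w * (k - 1) * (x + (k + 1) + star x) := by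
    have hne : x ^ 2 ≠ 0 := by
      intro h
      rw [pow_eq_zero_iff (by norm_num)] at h
      rw [h, zero_mul] at hxx
      exact zero_ne_one hxx
    apply mul_left_cancel₀ hne
    linear_combination h4 + (k * star x * x + 1 + star x * k * x * (x * k) + 2 * x + 2 * x * k
      + x ^ 2 + x ^ 2 * k ^ 2 - 2 * w * (k - 1) * x - k ^ 2 * star x * x ^ 2 + (k - 1)) * hxx
  have h6 := congrArg Complex.re h5
  have h7 : x.re ^ 2 + x.im ^ 2 = 1 := by
    have := Complex.sq_norm_sub_sq_re x
    rw [hx] at this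
    linarith
  simp at h6
  have h8 : x.re ≤ 1 := by nlinarith
  have h9 : -1 ≤ x.re := by nlinarith
  have h10 : 0 < 2 * x.re + k + 1 := by linarith
  have h11 : (k + 3 : ℝ) < 2 * w * (k - 1) := by nlinarith
  have h12 := mul_lt_mul_of_pos_right h11 h10
  -- This is the slack in bounding that squared modulus by `(k + 3) * (2 * x.re + k + 1)`; it
  -- vanishes at `x = 1`.
  have h13 : 0 ≤ (1 - x.re) * (4 * k * x.re + 6 * k - 2) := by
    apply mul_nonneg <;> nlinarith
  have h14 : ((k + 1) * x.re + 2) ^ 2 + (k - 1) ^ 2 * x.im ^ 2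
      = 2 * w * (k - 1) * (2 * x.re + k + 1) := by linear_combination h6
  rw [show x.im ^ 2 = 1 - x.re ^ 2 by linarith] at h14
  nlinarith

/-- For even `m` there is at most one root outside the closed unit disc. -/
theorem eq_of_one_lt_norm_even {k w : ℕ} (hk : 2 ≤ k) (hw : 2 ≤ w) {u v : ℂ} (hu : 1 < ‖u‖)
    (hv : 1 < ‖v‖) (hu0 : aeval u (growthDenom (k + 1) (2 * w)) = 0)
    (hv0 : aeval v (growthDenom (k + 1) (2 * w)) = 0) : u = v := by
  have key : ∀ u : ℂ, 1 < ‖u‖ → aeval u (growthDenom (k + 1) (2 * w)) = 0 →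
      ‖u⁻¹‖ < 1 ∧ u⁻¹ * (u⁻¹ ^ w + k) = k * u⁻¹ ^ w + 1 := by
    intro u hu hu0
    have h2 := aeval_even k (show 1 ≤ w by omega) u
    rw [hu0, zero_mul] at h2
    have hu1 : u ≠ 0 := by rintro rfl; simp at hu; linarith
    refine ⟨by rw [norm_inv]; exact inv_lt_one_of_one_lt₀ hu, ?_⟩
    rw [inv_pow]
    have hx : u ^ w ≠ 0 := pow_ne_zero _ hu1
    generalize u ^ w = x at *
    field_simp
    linear_combination h2
  obtain ⟨h1, h2⟩ := key u hu hu0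
  obtain ⟨h3, h4⟩ := key v hv hv0
  exact inv_injective (eq_of_norm_lt_one_even hk hw h1 h3 h2 h4)

/-- For odd `m` there is at most one root outside the closed unit disc. -/
theorem eq_of_one_lt_norm_odd {k w : ℕ} (hk : 2 ≤ k) (hw : 1 ≤ w) {u v : ℂ} (hu : 1 < ‖u‖)
    (hv : 1 < ‖v‖) (hu0 : aeval u (growthDenom (k + 1) (2 * w + 1)) = 0)
    (hv0 : aeval v (growthDenom (k + 1) (2 * w + 1)) = 0) : u = v := by
  have key : ∀ u : ℂ, 1 < ‖u‖ → aeval u (growthDenom (k + 1) (2 * w + 1)) = 0 → ‖u⁻¹‖ < 1 ∧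
      u⁻¹ * ((u⁻¹ ^ w) ^ 2 + 2 * u⁻¹ ^ w + k) = k * (u⁻¹ ^ w) ^ 2 + 2 * u⁻¹ ^ w + 1 := by
    intro u hu hu0
    have h2 := aeval_odd k hw u
    rw [hu0, zero_mul] at h2
    have hu1 : u ≠ 0 := by rintro rfl; simp at hu; linarith
    refine ⟨by rw [norm_inv]; exact inv_lt_one_of_one_lt₀ hu, ?_⟩
    rw [inv_pow]
    have hx : u ^ w ≠ 0 := pow_ne_zero _ hu1
    generalize u ^ w = x at *
    field_simp
    linear_combination h2
  obtain ⟨h1, h2⟩ := key u hu hu0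
  obtain ⟨h3, h4⟩ := key v hv hv0
  exact inv_injective (eq_of_norm_lt_one_odd hk hw h1 h3 h2 h4)

theorem aeval_plateau {R : Type*} [CommRing R] (a : ℤ) (b : ℕ) (t : R) :
    aeval t (plateau a b) = 1 + a * ∑ i ∈ Finset.Ico 1 b, t ^ i + t ^ b := by
  simp [plateau]

theorem aeval_derivative_plateau {R : Type*} [CommRing R] (a : ℤ) {b : ℕ} (t : R) :
    t * aeval t (derivative (plateau a b)) =
      a * ∑ i ∈ Finset.Ico 1 b, i * t ^ i + b * t ^ b := by
  have h : ∀ i : ℕ, t * (i * t ^ (i - 1)) = i * t ^ i := by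
    intro i
    cases i with
    | zero => simp
    | succ i => rw [Nat.add_sub_cancel, pow_succ]; ring
  rw [← h b, ← Finset.sum_congr rfl fun i _ => h i, ← Finset.mul_sum]
  simp [plateau, derivative_X_pow]
  ring

theorem two_mul_sum_Ico_sub (b : ℝ) {p q : ℕ} (hpq : p ≤ q) :
    2 * ∑ i ∈ Finset.Ico p q, (b - i) = (q - p) * (2 * b - p - q + 1) := by
  induction q, hpq using Nat.le_induction with
  | base => simp
  | succ q hpq ih =>
    rw [Finset.sum_Ico_succ_top hpq, mul_add, ih]
    push_cast
    ring

theorem le_two_mul_sum_Ico_sub_mul_pow {b p q : ℕ} (hpq : p ≤ q) (hqb : q ≤ b) {t s : ℝ}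
    (hs : ∀ i, p ≤ i → s ≤ t ^ i) :
    (q - p) * (2 * b - p - q + 1) * s ≤ 2 * ∑ i ∈ Finset.Ico p q, ((b : ℝ) - i) * t ^ i := by
  rw [← two_mul_sum_Ico_sub _ hpq, mul_assoc, Finset.sum_mul]
  refine mul_le_mul_of_nonneg_left (Finset.sum_le_sum fun i hi => ?_) zero_le_two
  rw [Finset.mem_Ico] at hi
  have : (i : ℝ) ≤ b := by exact_mod_cast (by omega : i ≤ b)
  exact mul_le_mul_of_nonneg_left (hs i hi.1) (by linarith)

/-- For even `m` there is a simple real root greater than `1`. -/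
theorem exists_simple_root_even {k w : ℕ} (hk : 2 ≤ k) (hw : 2 ≤ w) (hyp : 2 < (k - 1) * (w - 1)) :
    ∃ t : ℝ, 1 < t ∧ aeval t (growthDenom (k + 1) (2 * w)) = 0 ∧
      aeval t (derivative (growthDenom (k + 1) (2 * w))) ≠ 0 := by
  have hk' : (2 : ℝ) ≤ k := by exact_mod_cast hk
  have hw' : (2 : ℝ) ≤ w := by exact_mod_cast hw
  have hyp' : (2 : ℝ) < (k - 1) * (w - 1) := by
    have : ((2 : ℕ) : ℝ) < (((k - 1) * (w - 1) : ℕ) : ℝ) := by exact_mod_cast hyp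
    rwa [Nat.cast_mul, Nat.cast_sub (by omega), Nat.cast_sub (by omega), Nat.cast_one,
      Nat.cast_ofNat] at this
  have h1 : aeval (1 : ℝ) (growthDenom (k + 1) (2 * w)) < 0 := by
    rw [growthDenom_even, aeval_plateau]
    simp [Nat.cast_sub (show 1 ≤ w by omega)]
    linarith
  -- At `k` the value times `k - 1` collapses to `k ^ 2 - 1`.
  have h2 : 0 < aeval (k : ℝ) (growthDenom (k + 1) (2 * w)) := by
    have h3 := aeval_even k (show 1 ≤ w by omega) (k : ℝ)
    refine pos_of_mul_pos_left (b := (k : ℝ) - 1) ?_ (by linarith)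
    rw [h3]
    nlinarith
  obtain ⟨t, ht, ht0⟩ := intermediate_value_Icc (show (1 : ℝ) ≤ k by linarith)
    (f := fun t => aeval t (growthDenom (k + 1) (2 * w)))
    (Polynomial.continuous_aeval _).continuousOn ⟨h1.le, h2.le⟩
  have ht1 : 1 < t := lt_of_le_of_ne ht.1 (by rintro rfl; exact h1.ne ht0)
  refine ⟨t, ht1, ht0, fun hd => ?_⟩
  have h4 := aeval_derivative_plateau (2 - ((k + 1 : ℕ) : ℤ)) (b := w) t
  rw [growthDenom_even] at ht0 hd
  simp only [aeval_plateau] at ht0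
  rw [hd, mul_zero] at h4
  have h5 := le_two_mul_sum_Ico_sub_mul_pow (show 1 ≤ w by omega) le_rfl (t := t) (s := 1)
    (fun i _ => one_le_pow₀ ht1.le)
  have h6 : ∑ i ∈ Finset.Ico 1 w, ((w : ℝ) - i) * t ^ i
      = w * ∑ i ∈ Finset.Ico 1 w, t ^ i - ∑ i ∈ Finset.Ico 1 w, i * t ^ i := by
    rw [Finset.mul_sum, ← Finset.sum_sub_distrib]
    exact Finset.sum_congr rfl fun i _ => by ring
  -- The combination `w D - t D'` is free of `t ^ w`. Since all powers of `t` are at least `1`, a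
  -- double root would give `(k - 1) * (w - 1) ≤ 2`.
  have h7 : ((k : ℝ) - 1) * ∑ i ∈ Finset.Ico 1 w, ((w : ℝ) - i) * t ^ i = w := by
    rw [h6]
    push_cast at h4 ht0
    linear_combination -h4 - w * ht0
  generalize ∑ i ∈ Finset.Ico 1 w, ((w : ℝ) - i) * t ^ i = S at *
  have h8 := mul_le_mul_of_nonneg_left h5 (show (0 : ℝ) ≤ k - 1 by linarith)
  push_cast at h8
  nlinarith

/-- For odd `m` there is a simple real root greater than `1`. -/
theorem exists_simple_root_odd {k w : ℕ} (hk : 2 ≤ k) (hw : 1 ≤ w)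
    (hyp : 4 < (k - 1) * (2 * w - 1)) :
    ∃ t : ℝ, 1 < t ∧ aeval t (growthDenom (k + 1) (2 * w + 1)) = 0 ∧
      aeval t (derivative (growthDenom (k + 1) (2 * w + 1))) ≠ 0 := by
  have hk' : (2 : ℝ) ≤ k := by exact_mod_cast hk
  have hw' : (1 : ℝ) ≤ w := by exact_mod_cast hw
  have hyp' : (4 : ℝ) < (k - 1) * (2 * w - 1) := by
    have : ((4 : ℕ) : ℝ) < (((k - 1) * (2 * w - 1) : ℕ) : ℝ) := by exact_mod_cast hyp
    rwa [Nat.cast_mul, Nat.cast_sub (by omega), Nat.cast_sub (by omega), Nat.cast_one,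
      Nat.cast_ofNat, Nat.cast_mul, Nat.cast_ofNat] at this
  have hkw : (4 : ℝ) ≤ (k - 1) * (w + 1) := by
    have : 4 ≤ (k - 1) * (w + 1) := by
      rcases (by omega : w = 1 ∨ w = 2 ∨ 3 ≤ w) with rfl | rfl | h
      · omega
      · omega
      · nlinarith [show 1 ≤ k - 1 by omega]
    have : ((4 : ℕ) : ℝ) ≤ (((k - 1) * (w + 1) : ℕ) : ℝ) := by exact_mod_cast this
    rwa [Nat.cast_mul, Nat.cast_sub (by omega), Nat.cast_add, Nat.cast_one,
      Nat.cast_ofNat] at this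
  have h1 : aeval (1 : ℝ) (growthDenom (k + 1) (2 * w + 1)) < 0 := by
    rw [growthDenom_odd, map_add, aeval_plateau]
    simp [Nat.cast_sub (show 1 ≤ 2 * w by omega), map_ofNat]
    linarith
  have h2 : 0 < aeval (k : ℝ) (growthDenom (k + 1) (2 * w + 1)) := by
    have h3 := aeval_odd k hw (k : ℝ)
    refine pos_of_mul_pos_left (b := (k : ℝ) - 1) ?_ (by linarith)
    rw [h3]
    have : 0 < (k : ℝ) ^ w := by positivity
    nlinarith
  obtain ⟨t, ht, ht0⟩ := intermediate_value_Icc (show (1 : ℝ) ≤ k by linarith)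
    (f := fun t => aeval t (growthDenom (k + 1) (2 * w + 1)))
    (Polynomial.continuous_aeval _).continuousOn ⟨h1.le, h2.le⟩
  have ht1 : 1 < t := lt_of_le_of_ne ht.1 (by rintro rfl; exact h1.ne ht0)
  refine ⟨t, ht1, ht0, fun hd => ?_⟩
  have h4 := aeval_derivative_plateau (2 - ((k + 1 : ℕ) : ℤ)) (b := 2 * w) t
  have hd' : t * aeval t (derivative (plateau (2 - ((k + 1 : ℕ) : ℤ)) (2 * w)))
      = - (2 * w * t ^ w) := by
    rw [growthDenom_odd, derivative_add, map_add, ← mul_right_inj' (by linarith : t ≠ 0),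
      mul_add, mul_zero] at hd
    rw [eq_neg_iff_add_eq_zero, ← hd]
    obtain ⟨v, rfl⟩ : ∃ v, w = v + 1 := ⟨_, (Nat.sub_add_cancel hw).symm⟩
    simp only [derivative_mul, derivative_ofNat, zero_mul, zero_add, derivative_X_pow, map_mul,
      map_natCast, map_ofNat, map_pow, aeval_X, Nat.add_sub_cancel]
    push_cast
    ring
  rw [hd'] at h4
  simp only [growthDenom_odd, map_add, aeval_plateau, map_mul, map_ofNat, map_pow, aeval_X] at ht0
  have h5 := le_two_mul_sum_Ico_sub_mul_pow (show 1 ≤ w by omega) (show w ≤ 2 * w by omega)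
    (t := t) (s := 1) (fun i _ => one_le_pow₀ ht1.le)
  have h5' := le_two_mul_sum_Ico_sub_mul_pow (show w ≤ 2 * w by omega) le_rfl
    (t := t) (s := t ^ w) (fun i hi => pow_le_pow_right₀ ht1.le hi)
  have h6 : ∑ i ∈ Finset.Ico 1 (2 * w), (((2 * w : ℕ) : ℝ) - i) * t ^ i
      = (2 * w) * ∑ i ∈ Finset.Ico 1 (2 * w), t ^ i - ∑ i ∈ Finset.Ico 1 (2 * w), i * t ^ i := by
    rw [Finset.mul_sum, ← Finset.sum_sub_distrib]
    exact Finset.sum_congr rfl fun i _ => by push_cast; ring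
  have h7 : ((k : ℝ) - 1) * ∑ i ∈ Finset.Ico 1 (2 * w), (((2 * w : ℕ) : ℝ) - i) * t ^ i
      = 2 * w + 2 * w * t ^ w := by
    rw [h6]
    push_cast at h4 ht0
    linear_combination -h4 - 2 * w * ht0
  -- The right side contains `t ^ w`, so the powers from `w` on are bounded below by `t ^ w` and the
  -- lower ones by `1`. By `hkw` it suffices to refute the resulting inequality at `t ^ w = 1`,
  -- where it contradicts `hyp'`.
  rw [← Finset.sum_Ico_consecutive _ (show 1 ≤ w by omega) (show w ≤ 2 * w by omega)] at h7
  generalize ∑ i ∈ Finset.Ico 1 w, (((2 * w : ℕ) : ℝ) - i) * t ^ i = S at *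
  generalize ∑ i ∈ Finset.Ico w (2 * w), (((2 * w : ℕ) : ℝ) - i) * t ^ i = S' at *
  have h8 := mul_le_mul_of_nonneg_left (add_le_add h5 h5') (show (0 : ℝ) ≤ k - 1 by linarith)
  have h9 : 1 ≤ t ^ w := one_le_pow₀ ht1.le
  push_cast at h8
  generalize t ^ w = y at *
  have h10 : (w : ℝ) * ((k - 1) * (3 * (w - 1)) + (k - 1) * (w + 1) * y)
      ≤ w * (4 + 4 * y) := by nlinarith
  have h11 := le_of_mul_le_mul_left h10 (by linarith)
  nlinarith [mul_nonneg (sub_nonneg.2 hkw) (sub_nonneg.2 h9)]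

end salem

/-! ### The Salem property, Kronecker's theorem and irreducibility of the cofactor -/

section roots

theorem hyperbolic_param {ℓ m : ℕ} (hℓ : 3 ≤ ℓ) (hm : 3 ≤ m) (hyp : 4 < (ℓ - 2) * (m - 2)) :
    ∃ k w : ℕ, ℓ = k + 1 ∧ 2 ≤ k ∧ ((m = 2 * w ∧ 2 ≤ w ∧ 2 < (k - 1) * (w - 1)) ∨
      (m = 2 * w + 1 ∧ 1 ≤ w ∧ 4 < (k - 1) * (2 * w - 1))) := by
  obtain ⟨k, rfl⟩ : ∃ k, ℓ = k + 1 := ⟨ℓ - 1, by omega⟩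
  rw [show k + 1 - 2 = k - 1 by omega] at hyp
  rcases Nat.even_or_odd' m with ⟨w, rfl | rfl⟩
  · refine ⟨k, w, rfl, by omega, Or.inl ⟨rfl, by omega, ?_⟩⟩
    rw [show 2 * w - 2 = 2 * (w - 1) by omega] at hyp
    have : (k - 1) * (2 * (w - 1)) = 2 * ((k - 1) * (w - 1)) := by ring
    omega
  · exact ⟨k, w, rfl, by omega, Or.inr ⟨rfl, by omega, hyp⟩⟩

variable {ℓ m : ℕ}

/-- The roots of the denominator on the unit circle are simple. -/
theorem growthDenom_simple_of_norm_one (hℓ : 3 ≤ ℓ) (hm : 3 ≤ m) (hyp : 4 < (ℓ - 2) * (m - 2))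
    {z : ℂ} (hz : ‖z‖ = 1) (h0 : aeval z (growthDenom ℓ m) = 0) :
    aeval z (derivative (growthDenom ℓ m)) ≠ 0 := by
  obtain ⟨k, w, rfl, hk, ⟨rfl, hw, h⟩ | ⟨rfl, hw, h⟩⟩ := hyperbolic_param hℓ hm hyp
  · exact simple_of_norm_one_even hk hw h hz h0
  · exact simple_of_norm_one_odd hk hw h hz h0

/-- The denominator has at most one root outside the closed unit disc. -/
theorem growthDenom_eq_of_one_lt_norm (hℓ : 3 ≤ ℓ) (hm : 3 ≤ m) (hyp : 4 < (ℓ - 2) * (m - 2))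
    {u v : ℂ} (hu : 1 < ‖u‖) (hv : 1 < ‖v‖) (hu0 : aeval u (growthDenom ℓ m) = 0)
    (hv0 : aeval v (growthDenom ℓ m) = 0) : u = v := by
  obtain ⟨k, w, rfl, hk, ⟨rfl, hw, h⟩ | ⟨rfl, hw, h⟩⟩ := hyperbolic_param hℓ hm hyp
  · exact eq_of_one_lt_norm_even hk hw hu hv hu0 hv0
  · exact eq_of_one_lt_norm_odd hk hw hu hv hu0 hv0

/-- The denominator has a simple root outside the closed unit disc. -/
theorem growthDenom_exists_root (hℓ : 3 ≤ ℓ) (hm : 3 ≤ m) (hyp : 4 < (ℓ - 2) * (m - 2)) :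
    ∃ z : ℂ, 1 < ‖z‖ ∧ aeval z (growthDenom ℓ m) = 0 ∧
      aeval z (derivative (growthDenom ℓ m)) ≠ 0 := by
  have : ∃ t : ℝ, 1 < t ∧ aeval t (growthDenom ℓ m) = 0 ∧
      aeval t (derivative (growthDenom ℓ m)) ≠ 0 := by
    obtain ⟨k, w, rfl, hk, ⟨rfl, hw, h⟩ | ⟨rfl, hw, h⟩⟩ := hyperbolic_param hℓ hm hyp
    · exact exists_simple_root_even hk hw h
    · exact exists_simple_root_odd hk hw h
  obtain ⟨t, ht, h0, h1⟩ := this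
  have hc : ∀ p : ℤ[X], aeval (t : ℂ) p = ((aeval t p : ℝ) : ℂ) := fun p => by
    rw [show (t : ℂ) = algebraMap ℝ ℂ t from rfl, aeval_algebraMap_apply]
    rfl
  refine ⟨t, ?_, ?_, ?_⟩
  · rw [Complex.norm_real, Real.norm_of_nonneg (by linarith)]
    exact ht
  · rw [hc, h0, Complex.ofReal_zero]
  · rw [hc]
    exact_mod_cast h1

theorem isRoot_map_int_iff {R : Type*} [CommRing R] (f : ℤ[X]) (z : R) :
    (f.map (Int.castRingHom R)).IsRoot z ↔ aeval z f = 0 := by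
  rw [IsRoot, eval_map, aeval_def]
  rfl

theorem growthDenom_salem (hℓ : 3 ≤ ℓ) (hm : 3 ≤ m) (hyp : 4 < (ℓ - 2) * (m - 2)) :
    IsSalemPoly (growthDenom ℓ m) := by
  have hmon := growthDenom_monic ℓ hm
  obtain ⟨z, hz, h0, h1⟩ := growthDenom_exists_root hℓ hm hyp
  refine ⟨hmon, z, hz, ?_, fun u hu hu1 => ?_⟩
  · have hne : (growthDenom ℓ m).map (Int.castRingHom ℂ) ≠ 0 := (hmon.map _).ne_zero
    have h2 := (rootMultiplicity_pos hne).2 ((isRoot_map_int_iff _ _).2 h0)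
    have h3 : ¬ 1 < ((growthDenom ℓ m).map (Int.castRingHom ℂ)).rootMultiplicity z := by
      rw [one_lt_rootMultiplicity_iff_isRoot hne]
      rintro ⟨-, h⟩
      rw [derivative_map, isRoot_map_int_iff] at h
      exact h1 h
    omega
  · rw [isRoot_map_int_iff] at hu
    exact growthDenom_eq_of_one_lt_norm hℓ hm hyp hu1 hz hu h0

/-- A monic integer polynomial with nonzero constant term all of whose complex roots lie in the
closed unit disc has a root that is a root of unity, unless it is constant. -/
theorem exists_rootOfUnity_root {f : ℤ[X]} (hf : f.Monic) (h0 : f.coeff 0 ≠ 0)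
    (hdeg : f.natDegree ≠ 0) (h : ∀ z : ℂ, aeval z f = 0 → ‖z‖ ≤ 1) :
    ∃ (z : ℂ) (n : ℕ), 0 < n ∧ IsPrimitiveRoot z n ∧ aeval z f = 0 := by
  have hmap : (f.map (Int.castRingHom ℂ)).Monic := hf.map _
  -- Kronecker's theorem applies in its Mahler measure form.
  have hM : (f.map (Int.castRingHom ℂ)).mahlerMeasure = 1 := by
    rw [mahlerMeasure_eq_leadingCoeff_mul_prod_roots, hmap.leadingCoeff, norm_one, one_mul]
    refine Multiset.prod_eq_one fun x hx => ?_
    obtain ⟨z, hz, rfl⟩ := Multiset.mem_map.1 hx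
    exact max_eq_left (h z ((isRoot_map_int_iff f z).1 (isRoot_of_mem_roots hz)))
  obtain ⟨z, hz⟩ := IsAlgClosed.exists_root (f.map (Int.castRingHom ℂ)) (by
    rw [degree_eq_natDegree hmap.ne_zero, hf.natDegree_map]
    exact_mod_cast hdeg)
  rw [isRoot_map_int_iff] at hz
  have hz0 : z ≠ 0 := by
    rintro rfl
    rw [← coeff_zero_eq_aeval_zero'] at hz
    exact h0 (by simpa using hz)
  obtain ⟨n, hn, hp⟩ := isPrimitiveRoot_of_mahlerMeasure_eq_one hM hz0
    (mem_aroots.2 ⟨hf.ne_zero, hz⟩)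
  exact ⟨z, n, hn, hp, hz⟩

/-- Irreducibility of a cofactor: a monic integer polynomial `D` with exactly one root outside the
closed unit disc, with simple roots on the unit circle, and all of whose roots that are roots of
unity are roots of `T`, is `T` times an irreducible polynomial. -/
theorem irreducible_cofactor {D T S : ℤ[X]} (hD : D.Monic) (hD0 : IsUnit (D.coeff 0))
    (hTS : D = T * S) (hT : T.Monic)
    (hT1 : ∀ z : ℂ, aeval z T = 0 → ‖z‖ ≤ 1)
    (hex : ∃ z : ℂ, 1 < ‖z‖ ∧ aeval z D = 0)
    (huniq : ∀ u v : ℂ, 1 < ‖u‖ → 1 < ‖v‖ → aeval u D = 0 → aeval v D = 0 → u = v)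
    (houter : ∀ z : ℂ, 1 < ‖z‖ → aeval z D = 0 → aeval z (derivative D) ≠ 0)
    (hcirc : ∀ z : ℂ, ‖z‖ = 1 → aeval z D = 0 → aeval z (derivative D) ≠ 0)
    (hroots : ∀ (z : ℂ) (n : ℕ), 0 < n → IsPrimitiveRoot z n → aeval z D = 0 → aeval z T = 0) :
    Irreducible S := by
  have hS : S.Monic := hT.of_mul_monic_left (hTS ▸ hD)
  obtain ⟨t, ht, ht0⟩ := hex
  have hSt : aeval t S = 0 := by
    rw [hTS, map_mul, mul_eq_zero] at ht0
    exact ht0.resolve_left fun h => absurd (hT1 t h) (not_le.2 ht)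
  have hdouble : ∀ (z : ℂ) (A B C : ℤ[X]), D = A * B * C → aeval z A = 0 → aeval z B = 0 →
      aeval z (derivative D) = 0 := by
    intro z A B C h hA hB
    rw [h, derivative_mul, derivative_mul]
    simp [hA, hB]
  have hS1 : S ≠ 1 := by
    rintro rfl
    simp at hSt
  rw [hS.irreducible_iff_natDegree']
  refine ⟨hS1, fun A B hA hB hAB hmem => ?_⟩
  rw [Finset.mem_Ioc] at hmem
  have hB1 : B.natDegree ≠ 0 := by omega
  have hA1 : A.natDegree ≠ 0 := by
    have := hA.natDegree_mul hB
    rw [hAB] at this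
    omega
  -- If `A` carries the outer root, all roots of `B` lie in the closed disc and some root of `B` is
  -- a root of unity. It is then a root of `T` as well, hence a double root of `D` on the circle.
  have key : ∀ A B : ℤ[X], A.Monic → B.Monic → A * B = S → B.natDegree ≠ 0 → aeval t A = 0 →
      False := by
    intro A B hA hB hAB hB1 htA
    have hDAB : D = A * B * T := by rw [hTS, ← hAB]; ring
    have hroot : ∀ z : ℂ, aeval z B = 0 → aeval z D = 0 := by
      intro z hz
      rw [hDAB]
      simp [hz]
    have hle : ∀ z : ℂ, aeval z B = 0 → ‖z‖ ≤ 1 := by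
      intro z hz
      by_contra hlt
      rw [not_le] at hlt
      have := huniq z t hlt ht (hroot z hz) ht0
      subst this
      exact houter z ht ht0 (hdouble z A B T hDAB htA hz)
    have hB0 : B.coeff 0 ≠ 0 := by
      intro h0
      rw [hDAB, mul_coeff_zero, mul_coeff_zero, h0, mul_zero, zero_mul] at hD0
      exact not_isUnit_zero hD0
    obtain ⟨z, n, hn, hzn, hz⟩ := exists_rootOfUnity_root hB hB0 hB1 hle
    refine hcirc z (hzn.norm'_eq_one hn.ne') (hroot z hz) ?_
    exact hdouble z T B A (by rw [hDAB]; ring) (hroots z n hn hzn (hroot z hz)) hz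
  rw [← hAB, map_mul, mul_eq_zero] at hSt
  rcases hSt with h | h
  · exact key A B hA hB hAB hB1 h
  · exact key B A hB hA (by rw [mul_comm, hAB]) hA1 h

end roots

/-! ### Normalized traces of roots of unity -/

section rootsOfUnity

-- In `X ^ n - 1 = ∏ Φ_d` the second coefficients of the monic factors add up, which is the divisor
-- sum recursion of the Möbius function up to sign.
open ArithmeticFunction in
theorem cyclotomic_nextCoeff (n : ℕ) (hn : 0 < n) :
    (cyclotomic n ℚ).nextCoeff = -(ArithmeticFunction.moebius n : ℚ) := by
  induction n using Nat.strong_induction_on with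
  | _ n ih =>
    have h1 := congrArg nextCoeff (prod_cyclotomic_eq_X_pow_sub_one hn ℚ)
    rw [Monic.nextCoeff_prod _ _ fun i _ => cyclotomic.monic i ℚ] at h1
    have h2 : (X ^ n - 1 : ℚ[X]).nextCoeff = if n = 1 then -1 else 0 := by
      rw [nextCoeff, ← C_1, natDegree_X_pow_sub_C, if_neg hn.ne']
      split_ifs with h
      · subst h
        simp
      · rw [coeff_sub, coeff_X_pow, coeff_C, if_neg (by omega), if_neg (by omega), sub_zero]
    have h3 : ∑ i ∈ n.divisors, (ArithmeticFunction.moebius i : ℚ) = if n = 1 then 1 else 0 := by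
      have h4 := congrArg (fun f : ArithmeticFunction ℤ => f n) moebius_mul_coe_zeta
      simp only [coe_mul_zeta_apply, ArithmeticFunction.one_apply] at h4
      exact_mod_cast h4
    rw [h2] at h1
    rw [← Nat.cons_self_properDivisors hn.ne', Finset.sum_cons] at h1 h3
    rw [Finset.sum_congr rfl fun i hi => ih i (Nat.mem_properDivisors.1 hi).2
      (Nat.pos_of_mem_properDivisors hi), Finset.sum_neg_distrib] at h1
    split_ifs at h1 h3 <;> linarith

/-- The trace of a primitive `n`-th root of unity divided by the degree. -/
def rootTrace (n : ℕ) : ℚ := (ArithmeticFunction.moebius n : ℚ) / n.totient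

variable {K : Type*} [Field K] [NumberField K]

/-- The trace divided by the degree. -/
noncomputable def normTrace (K : Type*) [Field K] [NumberField K] : K →ₗ[ℚ] ℚ :=
  (Module.finrank ℚ K : ℚ)⁻¹ • Algebra.trace ℚ K

open IntermediateField in
theorem finrank_adjoin_of_isPrimitiveRoot {x : K} {n : ℕ} (hn : 0 < n) (hx : IsPrimitiveRoot x n) :
    Module.finrank ℚ ℚ⟮x⟯ = n.totient := by
  rw [adjoin.finrank (Algebra.IsIntegral.isIntegral x), ← cyclotomic_eq_minpoly_rat hx hn,
    natDegree_cyclotomic]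

-- The trace is read off the second coefficient of the minimal polynomial `Φ_n`; dividing by the
-- degree removes the dependence on `K`.
open IntermediateField in
theorem normTrace_of_isPrimitiveRoot {x : K} {n : ℕ} (hn : 0 < n) (hx : IsPrimitiveRoot x n) :
    normTrace K x = rootTrace n := by
  have h1 := finrank_adjoin_of_isPrimitiveRoot hn hx
  have h2 := Module.finrank_mul_finrank ℚ ℚ⟮x⟯ K
  have h3 : (Module.finrank ℚ⟮x⟯ K : ℚ) ≠ 0 := by
    exact_mod_cast (Module.finrank_pos (R := ℚ⟮x⟯) (M := K)).ne'
  have h4 : (n.totient : ℚ) ≠ 0 := by exact_mod_cast (Nat.totient_pos.2 hn).ne'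
  rw [normTrace, LinearMap.smul_apply, trace_eq_finrank_mul_minpoly_nextCoeff,
    ← cyclotomic_eq_minpoly_rat hx hn, cyclotomic_nextCoeff n hn, ← h2, h1, rootTrace]
  push_cast
  rw [smul_eq_mul]
  field_simp

theorem normTrace_eq {x : K} (hx : 0 < orderOf x) : normTrace K x = rootTrace (orderOf x) :=
  normTrace_of_isPrimitiveRoot hx (IsPrimitiveRoot.orderOf x)

theorem rootTrace_one : rootTrace 1 = 1 := by simp [rootTrace]

theorem rootTrace_prime {p : ℕ} (hp : p.Prime) : rootTrace p = -1 / (p - 1) := by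
  rw [rootTrace, ArithmeticFunction.moebius_apply_prime hp, Nat.totient_prime hp,
    Nat.cast_sub hp.one_le]
  simp

theorem rootTrace_two : rootTrace 2 = -1 := by
  rw [rootTrace_prime Nat.prime_two]
  norm_num

theorem rootTrace_two_mul {a : ℕ} (ha : Odd a) : rootTrace (2 * a) = -rootTrace a := by
  have hc : Nat.Coprime 2 a := Nat.coprime_two_left.2 ha
  rw [rootTrace, rootTrace, ArithmeticFunction.isMultiplicative_moebius.map_mul_of_coprime hc,
    Nat.totient_mul hc, ArithmeticFunction.moebius_apply_prime Nat.prime_two]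
  simp
  ring

theorem rootTrace_four_mul (a : ℕ) : rootTrace (4 * a) = 0 := by
  rw [rootTrace, ArithmeticFunction.moebius_eq_zero_of_not_squarefree]
  · simp
  · intro h
    have := h 2 ⟨a, by ring⟩
    norm_num at this

theorem rootTrace_six : rootTrace 6 = 1 / 2 := by
  rw [show 6 = 2 * 3 from rfl, rootTrace_two_mul (by decide), rootTrace_prime Nat.prime_three]
  norm_num

theorem abs_rootTrace_le (n : ℕ) {q : ℕ} (hq : 0 < q) (h : q ≤ n.totient) :
    |rootTrace n| ≤ 1 / q := by
  rw [rootTrace, abs_div, Nat.abs_cast]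
  have h1 : |(ArithmeticFunction.moebius n : ℚ)| ≤ 1 := by
    exact_mod_cast ArithmeticFunction.abs_moebius_le_one
  have h2 : (q : ℚ) ≤ n.totient := by exact_mod_cast h
  have h3 : (0 : ℚ) < q := by exact_mod_cast hq
  exact div_le_div₀ zero_le_one h1 h3 h2

theorem abs_rootTrace_le_half {n : ℕ} (hn : 3 ≤ n) : |rootTrace n| ≤ 1 / 2 := by
  have h1 := Nat.totient_even (by omega : 2 < n)
  have h2 := Nat.totient_pos.2 (by omega : 0 < n)
  have := abs_rootTrace_le n (q := 2) (by norm_num) (by obtain ⟨c, hc⟩ := h1; omega)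
  simpa using this

/-- A number divisible by a large prime has a large totient; otherwise it divides the product of
the small primes or has vanishing Möbius function. -/
theorem rootTrace_cases (n q : ℕ) (hn : 0 < n) : (∃ p, p.Prime ∧ p ∣ n ∧ q ≤ p ∧ p - 1 ≤ n.totient) ∨
    rootTrace n = 0 ∨ n ∣ ∏ p ∈ (Finset.range q).filter Nat.Prime, p := by
  by_cases h : ∃ p, p.Prime ∧ p ∣ n ∧ q ≤ p
  · obtain ⟨p, hp, hpn, hqp⟩ := h
    refine Or.inl ⟨p, hp, hpn, hqp, ?_⟩
    rw [← Nat.totient_prime hp]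
    exact Nat.le_of_dvd (Nat.totient_pos.2 hn) (Nat.totient_dvd_of_dvd hpn)
  · right
    by_cases hs : Squarefree n
    · right
      rw [← Nat.prod_primeFactors_of_squarefree hs]
      refine Finset.prod_dvd_prod_of_subset _ _ _ fun p hp => ?_
      rw [Finset.mem_filter, Finset.mem_range]
      by_contra hpq
      exact h ⟨p, Nat.prime_of_mem_primeFactors hp, Nat.dvd_of_mem_primeFactors hp, by
        by_contra hlt
        exact hpq ⟨by omega, Nat.prime_of_mem_primeFactors hp⟩⟩
    · left
      rw [rootTrace, ArithmeticFunction.moebius_eq_zero_of_not_squarefree hs]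
      simp

/-- A prime factor of at least `5` makes the totient at least `4`. Otherwise the Möbius value
vanishes or `n` divides `6`. -/
theorem rootTrace_le_quarter {n : ℕ} (hn : 0 < n) (h1 : n ≠ 1) (h6 : n ≠ 6) :
    rootTrace n ≤ 1 / 4 := by
  rcases rootTrace_cases n 5 hn with ⟨p, hp, -, h5, h⟩ | h | h
  · have := abs_rootTrace_le n (q := 4) (by norm_num) (by omega)
    exact (le_abs_self _).trans (by simpa using this)
  · rw [h]; norm_num
  · rw [show ∏ p ∈ (Finset.range 5).filter Nat.Prime, p = 6 by decide] at h
    have hle := Nat.le_of_dvd (by norm_num) h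
    interval_cases n
    · contradiction
    · rw [rootTrace_two]; norm_num
    · rw [rootTrace_prime Nat.prime_three]; norm_num
    · norm_num at h
    · norm_num at h
    · contradiction

/-- A prime factor of at least `11` gives totient at least `10`. Among the remaining squarefree odd
numbers, the divisors of `105`, only `1` and `15` outside the excluded ones have a smaller totient,
and their traces are positive. -/
theorem neg_eighth_lt_rootTrace {n : ℕ} (hn : Odd n) (h3 : n ≠ 3) (h5 : n ≠ 5) (h7 : n ≠ 7) :
    -(1 / 8) < rootTrace n := by
  have hpos := hn.pos
  rcases rootTrace_cases n 11 hpos with ⟨p, hp, -, h11, h⟩ | h | h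
  · have := abs_rootTrace_le n (q := 10) (by norm_num) (by omega)
    have h' := (abs_le.1 this).1
    norm_num at h' ⊢
    linarith
  · rw [h]; norm_num
  · rw [show ∏ p ∈ (Finset.range 11).filter Nat.Prime, p = 210 by decide] at h
    have h105 : n ∣ 105 :=
      Nat.Coprime.dvd_of_dvd_mul_left (Nat.coprime_two_right.2 hn)
        (by rwa [show 2 * 105 = 210 from rfl])
    have hmem : n ∈ Nat.divisors 105 := Nat.mem_divisors.2 ⟨h105, by norm_num⟩
    rw [show Nat.divisors 105 = {1, 3, 5, 7, 15, 21, 35, 105} by decide] at hmem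
    simp only [Finset.mem_insert, Finset.mem_singleton] at hmem
    have hφ : n = 1 ∨ n = 15 ∨ 10 ≤ n.totient := by
      rcases hmem with rfl | rfl | rfl | rfl | rfl | rfl | rfl | rfl <;> simp_all <;> decide
    rcases hφ with rfl | rfl | h
    · rw [rootTrace_one]; norm_num
    · have h15 : rootTrace 15 = rootTrace 3 * rootTrace 5 := by
        rw [rootTrace, rootTrace, rootTrace, show 15 = 3 * 5 from rfl,
          ArithmeticFunction.isMultiplicative_moebius.map_mul_of_coprime (by decide),
          Nat.totient_mul (by decide)]
        push_cast
        ring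
      rw [h15, rootTrace_prime Nat.prime_three, rootTrace_prime Nat.prime_five]
      norm_num
    · have := abs_rootTrace_le n (q := 10) (by norm_num) (by omega)
      have h' := (abs_le.1 this).1
      norm_num at h' ⊢
      linarith

end rootsOfUnity

/-! ### Roots of unity among the roots, even `m` -/

section classification

variable {K : Type*} [Field K] [NumberField K]

theorem normTrace_one : normTrace K 1 = 1 := by
  rw [normTrace_eq (by simp), orderOf_one, rootTrace_one]

theorem normTrace_inv {x : K} (hx : IsOfFinOrder x) : normTrace K x⁻¹ = normTrace K x := by
  rw [normTrace_eq hx.orderOf_pos, normTrace_of_isPrimitiveRoot hx.orderOf_pos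
    (IsPrimitiveRoot.orderOf x).inv]

theorem normTrace_pow {x : K} (hx : IsOfFinOrder x) (j : ℕ) :
    normTrace K (x ^ j) = rootTrace (orderOf x / (j % orderOf x).gcd (orderOf x)) := by
  rw [normTrace_eq hx.pow.orderOf_pos, hx.orderOf_pow, Nat.gcd_rec]

theorem normTrace_le_half {x : K} (hx : IsOfFinOrder x) (h1 : x ≠ 1) : normTrace K x ≤ 1 / 2 := by
  rw [normTrace_eq hx.orderOf_pos]
  by_cases h6 : orderOf x = 6
  · rw [h6, rootTrace_six]
  · have := rootTrace_le_quarter hx.orderOf_pos (mt orderOf_eq_one_iff.1 h1) h6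
    linarith

theorem normTrace_le_quarter {x : K} (hx : IsOfFinOrder x) (h1 : x ≠ 1) (h6 : orderOf x ≠ 6) :
    normTrace K x ≤ 1 / 4 := by
  rw [normTrace_eq hx.orderOf_pos]
  exact rootTrace_le_quarter hx.orderOf_pos (mt orderOf_eq_one_iff.1 h1) h6

omit [NumberField K] in
theorem eq_neg_one_of_orderOf_eq_two {x : K} (hx : orderOf x = 2) : x = -1 := by
  have h := pow_orderOf_eq_one x
  rw [hx, sq_eq_one_iff] at h
  rcases h with rfl | h
  · simp at hx
  · exact h

theorem neg_half_le_normTrace {x : K} (hx : IsOfFinOrder x) (h1 : x ≠ -1) :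
    -(1 / 2) ≤ normTrace K x := by
  rw [normTrace_eq hx.orderOf_pos]
  have hpos := hx.orderOf_pos
  rcases Nat.lt_or_ge (orderOf x) 3 with h | h
  · interval_cases h' : orderOf x
    · rw [rootTrace_one]; norm_num
    · exact absurd (eq_neg_one_of_orderOf_eq_two h') h1
  · exact (abs_le.1 (abs_rootTrace_le_half h)).1

/-- The roots of unity that are roots of the denominator, for `m = 2w` and `ℓ = k + 1`. -/
theorem rootOfUnity_even {k w : ℕ} (hk : 2 ≤ k) (hw : 1 ≤ w) {z : K} (hz : IsOfFinOrder z)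
    (h1 : z ≠ 1) (h : z * (z ^ w + k) = k * z ^ w + 1) :
    (z = -1 ∧ w % 2 = 1) ∨ (k = 2 ∧ orderOf z = 6 ∧ w % 6 = 2) := by
  obtain ⟨v, rfl⟩ : ∃ v, w = v + 1 := ⟨w - 1, by omega⟩
  have hk1 : (k : K) - 1 ≠ 0 := by
    rw [sub_ne_zero]
    exact_mod_cast (by omega : k ≠ 1)
  have hz0 : z ≠ 0 := hz.isUnit.ne_zero
  have hneg : z = -1 → (v + 1) % 2 = 1 := by
    rintro rfl
    rcases Nat.even_or_odd (v + 1) with hv | hv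
    · rw [hv.neg_one_pow] at h
      have hk0 : (k : K) + 1 ≠ 0 := by exact_mod_cast (by omega : k + 1 ≠ 0)
      exact absurd (by linear_combination (-1 / 2 : K) * h) hk0
    · exact Nat.odd_iff.1 hv
  -- The trace bounds need `z ^ v ≠ 1` and `z ^ (v + 1) ≠ -1`; both exceptions lead to `z = -1`.
  by_cases hy : z ^ v = 1
  · rw [pow_succ, hy] at h
    have : (z - 1) * (z + 1) = 0 := by linear_combination h
    rcases mul_eq_zero.1 this with h' | h'
    · exact absurd (sub_eq_zero.1 h') h1
    · exact Or.inl ⟨eq_neg_of_add_eq_zero_left h', hneg (eq_neg_of_add_eq_zero_left h')⟩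
  by_cases hx : z ^ (v + 1) = -1
  · rw [hx] at h
    have : ((k : K) - 1) * (z + 1) = 0 := by linear_combination h
    have h' := (mul_eq_zero.1 this).resolve_left hk1
    exact Or.inl ⟨eq_neg_of_add_eq_zero_left h', hneg (eq_neg_of_add_eq_zero_left h')⟩
  right
  -- The equation divided by `z ^ (v + 1)`. Inverses have the same trace, and the bounds `1/2`,
  -- `1/2`, `-1/2` leave only `k = 2` with equality everywhere; the upper bound is attained only at
  -- order `6`.
  have htr : z + (k : ℚ) • (z ^ v)⁻¹ = (k : ℚ) • 1 + (z ^ (v + 1))⁻¹ := by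
    rw [Algebra.smul_def, Algebra.smul_def, map_natCast]
    rw [pow_succ] at h ⊢
    field_simp
    linear_combination h
  have htr' := congrArg (normTrace K) htr
  rw [map_add, map_add, map_smul, map_smul, normTrace_inv hz.pow, normTrace_inv hz.pow,
    normTrace_one, smul_eq_mul, smul_eq_mul, mul_one] at htr'
  have a1 := normTrace_le_half hz h1
  have a2 := normTrace_le_half hz.pow hy
  have a3 := neg_half_le_normTrace hz.pow hx
  have hk' : (2 : ℚ) ≤ k := by exact_mod_cast hk
  have o1 : orderOf z = 6 := by
    by_contra h6
    have := normTrace_le_quarter hz h1 h6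
    nlinarith
  have k2 : k = 2 := by
    by_contra hk2
    have : (3 : ℚ) ≤ k := by exact_mod_cast (by omega : 3 ≤ k)
    nlinarith
  have o2 : orderOf (z ^ v) = 6 := by
    by_contra h6
    have := normTrace_le_quarter hz.pow hy h6
    nlinarith
  refine ⟨k2, o1, ?_⟩
  have hv : v % 6 < 6 := Nat.mod_lt _ (by norm_num)
  rw [hz.orderOf_pow, Nat.gcd_rec, o1] at o2
  have hx0 : (v + 1) % 6 ≠ 0 := by
    intro h0
    have hx1 : z ^ (v + 1) = 1 := orderOf_dvd_iff_pow_eq_one.1 (o1 ▸ Nat.dvd_of_mod_eq_zero h0)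
    rw [hx1, normTrace_one] at htr'
    nlinarith
  interval_cases hv' : v % 6 <;> simp at o2 <;> omega

open IntermediateField in
theorem totient_le_of_mem_adjoin {x z : K} (hx : IsOfFinOrder x) (hz : IsOfFinOrder z)
    (h : z ∈ ℚ⟮x⟯) : (orderOf z).totient ≤ (orderOf x).totient := by
  rw [← finrank_adjoin_of_isPrimitiveRoot hx.orderOf_pos (IsPrimitiveRoot.orderOf x),
    ← finrank_adjoin_of_isPrimitiveRoot hz.orderOf_pos (IsPrimitiveRoot.orderOf z)]
  have hle : ℚ⟮z⟯ ≤ ℚ⟮x⟯ := adjoin_simple_le_iff.2 h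
  exact Submodule.finrank_mono (s := ℚ⟮z⟯.toSubmodule) (t := ℚ⟮x⟯.toSubmodule) hle

/-- Since `φ(a) φ(c) ≤ φ(a c)`, the cofactor `c` has totient `1`. -/
theorem eq_or_eq_two_mul_of_totient_le {a n : ℕ} (hn : 0 < n) (han : a ∣ n)
    (h : n.totient ≤ a.totient) : n = a ∨ (Odd a ∧ n = 2 * a) := by
  obtain ⟨c, rfl⟩ := han
  have ha : 0 < a := Nat.pos_of_mul_pos_right hn
  have hc : 0 < c := Nat.pos_of_mul_pos_left hn
  have h1 := Nat.totient_super_multiplicative a c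
  have h2 := Nat.totient_pos.2 ha
  have h3 := Nat.totient_pos.2 hc
  have h4 : c.totient = 1 := by nlinarith
  rcases Nat.totient_eq_one_iff.1 h4 with rfl | rfl
  · simp
  · right
    refine ⟨?_, mul_comm _ _⟩
    by_contra hodd
    rw [Nat.not_odd_iff_even] at hodd
    rw [mul_comm, Nat.totient_two_mul_of_even hodd] at h
    omega

theorem rootTrace_three : rootTrace 3 = -1 / 2 := by
  rw [rootTrace_prime Nat.prime_three]
  norm_num

theorem rootTrace_five : rootTrace 5 = -1 / 4 := by
  rw [rootTrace_prime Nat.prime_five]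
  norm_num

theorem rootTrace_seven : rootTrace 7 = -1 / 6 := by
  rw [rootTrace_prime (by norm_num : Nat.Prime 7)]
  norm_num

theorem rootTrace_ten : rootTrace 10 = 1 / 4 := by
  rw [show 10 = 2 * 5 from rfl, rootTrace_two_mul (by decide), rootTrace_five]
  norm_num

/-- This is the case `z ^ w = z` for odd `m`. After division by `z - 1` the trace shows that `k - 3`
is twice the normalized trace of `z`, hence at most `1`. -/
theorem orderOf_of_quadratic {k : ℕ} (hk : 2 ≤ k) {z : K} (hz : IsOfFinOrder z)
    (h1 : z ≠ 1) (h : z * (z ^ 2 + 2 * z + k) = k * z ^ 2 + 2 * z + 1) :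
    (k = 2 ∧ orderOf z = 3) ∨ (k = 3 ∧ orderOf z = 4) ∨ (k = 4 ∧ orderOf z = 6) := by
  have hz0 : z ≠ 0 := hz.isUnit.ne_zero
  have h2 : z ^ 2 + (3 - k) * z + 1 = 0 := by
    have : (z - 1) * (z ^ 2 + (3 - k) * z + 1) = 0 := by linear_combination h
    exact (mul_eq_zero.1 this).resolve_left (sub_ne_zero.2 h1)
  have htr : z + z⁻¹ = ((k : ℚ) - 3) • 1 := by
    rw [Algebra.smul_def, map_sub, map_natCast, map_ofNat]
    field_simp
    linear_combination h2
  have htr' := congrArg (normTrace K) htr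
  rw [map_add, map_smul, normTrace_inv hz, normTrace_one, smul_eq_mul, mul_one] at htr'
  have a1 := normTrace_le_half hz h1
  have hk4 : k ≤ 4 := by
    have : (k : ℚ) ≤ 4 := by linarith
    exact_mod_cast this
  interval_cases k
  · refine Or.inl ⟨rfl, ?_⟩
    have : z ^ 3 = 1 := by push_cast at h2; linear_combination (z - 1) * h2
    exact orderOf_eq_prime this h1
  · refine Or.inr (Or.inl ⟨rfl, ?_⟩)
    have h2' : z ^ 2 = -1 := by push_cast at h2; linear_combination h2
    refine orderOf_eq_prime_pow (p := 2) (n := 1) ?_ ?_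
    · rw [pow_one, h2']
      norm_num
    · norm_num
      linear_combination (z ^ 2 - 1) * h2'
  · refine Or.inr (Or.inr ⟨rfl, ?_⟩)
    by_contra h6
    have := normTrace_le_quarter hz h1 h6
    norm_num at htr'
    linarith

end classification

/-! ### Roots of unity among the roots, odd `m` -/

section classificationOdd

variable {K : Type*} [Field K] [NumberField K]

open IntermediateField in
/-- The roots of unity that are roots of the denominator, for `m = 2w + 1` and `ℓ = k + 1`. -/
theorem rootOfUnity_odd {k w : ℕ} (hk : 2 ≤ k) (hw : 1 ≤ w) {z : K} (hz : IsOfFinOrder z)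
    (h1 : z ≠ 1)
    (h : z * ((z ^ w) ^ 2 + 2 * z ^ w + k) = k * (z ^ w) ^ 2 + 2 * z ^ w + 1) :
    (k = 2 ∧ orderOf z = 3 ∧ w % 3 = 1) ∨ (k = 3 ∧ orderOf z = 4 ∧ w % 4 = 1) ∨
      (k = 4 ∧ orderOf z = 6 ∧ w % 6 = 1) ∨ (k = 2 ∧ orderOf z = 10 ∧ w % 10 = 2) := by
  obtain ⟨v, rfl⟩ : ∃ v, w = v + 1 := ⟨w - 1, by omega⟩
  have hk1 : (k : K) - 1 ≠ 0 := by
    rw [sub_ne_zero]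
    exact_mod_cast (by omega : k ≠ 1)
  have hk3 : (k : K) + 3 ≠ 0 := by exact_mod_cast (by omega : k + 3 ≠ 0)
  have hz0 : z ≠ 0 := hz.isUnit.ne_zero
  have hk' : (2 : ℚ) ≤ k := by exact_mod_cast hk
  have a1 := normTrace_le_half hz h1
  by_cases hy : z ^ v = 1
  · rw [pow_succ z v, hy, one_mul] at h
    have hd := orderOf_dvd_of_pow_eq_one hy
    rcases orderOf_of_quadratic hk hz h1 h with ⟨h', o⟩ | ⟨h', o⟩ | ⟨h', o⟩ <;>
      rw [o] at hd
    · exact Or.inl ⟨h', o, by omega⟩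
    · exact Or.inr (Or.inl ⟨h', o, by omega⟩)
    · exact Or.inr (Or.inr (Or.inl ⟨h', o, by omega⟩))
  by_cases hy' : z ^ v = -1
  · exfalso
    rw [pow_succ z v, hy', neg_one_mul] at h
    have h2 : z ^ 2 - (k + 1) * z + 1 = 0 := by
      have : (z - 1) * (z ^ 2 - (k + 1) * z + 1) = 0 := by linear_combination h
      exact (mul_eq_zero.1 this).resolve_left (sub_ne_zero.2 h1)
    have htr : z + z⁻¹ = ((k : ℚ) + 1) • 1 := by
      rw [Algebra.smul_def, map_add, map_natCast, map_one]
      field_simp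
      linear_combination h2
    have htr' := congrArg (normTrace K) htr
    rw [map_add, map_smul, normTrace_inv hz, normTrace_one, smul_eq_mul, mul_one] at htr'
    linarith
  set x := z ^ (v + 1) with hx
  have hxv : x = z ^ v * z := pow_succ z v
  have hxf : IsOfFinOrder x := hz.pow
  have hx0 : x ≠ 0 := hxf.isUnit.ne_zero
  by_cases hη : z ^ (2 * v + 1) = 1
  · exfalso
    have hxz : z = x ^ 2 := by
      rw [hx, ← pow_mul, show (v + 1) * 2 = (2 * v + 1) + 1 by ring, pow_succ, hη, one_mul]
    rw [hxz] at h h1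
    have h2 : (x ^ 2 - 1) * (x + 1) ^ 2 = 0 := by linear_combination h
    rcases mul_eq_zero.1 h2 with h3 | h3
    · exact h1 (sub_eq_zero.1 h3)
    · exact h1 (by rw [eq_neg_of_add_eq_zero_left (pow_eq_zero_iff two_ne_zero |>.1 h3)]; norm_num)
  have hq : x ^ 2 + 2 * x + k ≠ 0 := by
    intro h0
    have hs : ((k : K) - 1) * (x ^ 2 - 1) = 0 := by linear_combination -h - (1 - z) * h0
    have hs' := (mul_eq_zero.1 hs).resolve_left hk1
    have hxx : (x - 1) * (x + 1) = 0 := by linear_combination hs'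
    rcases mul_eq_zero.1 hxx with h3 | h3
    · exact hk3 (by linear_combination h0 - (x + 3) * h3)
    · exact hk1 (by linear_combination h0 - (x + 1) * h3)
  -- the degree of `z` is at most that of `x`
  have hmem : z ∈ ℚ⟮x⟯ := by
    have hxm : x ∈ ℚ⟮x⟯ := mem_adjoin_simple_self ℚ x
    have hzq : z = (k * x ^ 2 + 2 * x + 1) / (x ^ 2 + 2 * x + k) := by
      rw [eq_div_iff hq, h]
    rw [hzq]
    have hkm : (k : K) ∈ ℚ⟮x⟯ := _root_.natCast_mem _ k
    have h2m : (2 : K) ∈ ℚ⟮x⟯ := ofNat_mem _ 2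
    exact div_mem (add_mem (add_mem (mul_mem hkm (pow_mem hxm 2)) (mul_mem h2m hxm)) (one_mem _))
      (add_mem (add_mem (pow_mem hxm 2) (mul_mem h2m hxm)) hkm)
  have hord := eq_or_eq_two_mul_of_totient_le hz.orderOf_pos (orderOf_pow_dvd (v + 1))
    (totient_le_of_mem_adjoin hxf hz hmem)
  rw [← hx] at hord
  -- the traced equation
  have htr : z + (2 : ℚ) • (z ^ v)⁻¹ + (k : ℚ) • (z ^ (2 * v + 1))⁻¹ =
      (k : ℚ) • 1 + (2 : ℚ) • x⁻¹ + (x ^ 2)⁻¹ := by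
    simp only [Algebra.smul_def, map_natCast, map_ofNat]
    have e : z ^ (2 * v + 1) = (z ^ v) ^ 2 * z := by ring
    rw [hxv] at h ⊢
    rw [e]
    have : z ^ v ≠ 0 := pow_ne_zero _ hz0
    field_simp
    linear_combination h
  have htr' := congrArg (normTrace K) htr
  simp only [map_add, map_smul, normTrace_inv hz.pow, normTrace_inv hxf, normTrace_inv hxf.pow,
    normTrace_one, smul_eq_mul, mul_one] at htr'
  have a2 := normTrace_le_half hz.pow hy
  have a3 := normTrace_le_half hz.pow hη
  have horder : orderOf x = orderOf z / ((v + 1) % orderOf z).gcd (orderOf z) := by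
    rw [hx, hz.orderOf_pow, Nat.gcd_rec]
  have hpos := hz.orderOf_pos
  -- With `τ` the normalized trace, `htr'` equates this quantity with `k (1 - τ(z^(2v+1))) - 2
  -- τ(z^v)`. It is below `1/2` only if both powers have order `6`; then `z` has order `6` and `x =
  -- 1`, which `htr'` excludes.
  have hE : 1 / 2 ≤ normTrace K z - normTrace K (x ^ 2) - 2 * normTrace K x := by
    by_contra! hlt
    have o2 : orderOf (z ^ v) = 6 := by
      by_contra h6
      have := normTrace_le_quarter hz.pow hy h6
      nlinarith
    have o3 : orderOf (z ^ (2 * v + 1)) = 6 := by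
      by_contra h6
      have := normTrace_le_quarter hz.pow hη h6
      nlinarith
    have h6a : orderOf x ∣ 6 := by
      refine orderOf_dvd_of_pow_eq_one ?_
      have e1 := pow_orderOf_eq_one (z ^ v)
      have e2 := pow_orderOf_eq_one (z ^ (2 * v + 1))
      rw [o2] at e1
      rw [o3, show z ^ (2 * v + 1) = x * z ^ v by rw [hxv]; ring, mul_pow, e1, mul_one] at e2
      exact e2
    have h6n : 6 ∣ orderOf z := o2 ▸ orderOf_pow_dvd v
    have hn : orderOf z = 6 := by
      have := Nat.le_of_dvd (by norm_num) h6a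
      rcases hord with hn | ⟨⟨b, hb⟩, hn⟩
      · omega
      · interval_cases hx : orderOf x <;> omega
    rw [hz.orderOf_pow, Nat.gcd_rec, hn] at o2 o3
    have hv : v % 6 < 6 := Nat.mod_lt _ (by norm_num)
    have hv5 : v % 6 = 5 := by
      rw [show (2 * v + 1) % 6 = (2 * (v % 6) + 1) % 6 by omega] at o3
      interval_cases hv' : v % 6 <;> simp at o2 o3 ⊢
    have hx1 : x = 1 := orderOf_dvd_iff_pow_eq_one.1 (hn ▸ by omega)
    rw [hx1, one_pow, normTrace_one] at htr'
    nlinarith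
  have htz := normTrace_eq hpos
  have htx := normTrace_eq hxf.orderOf_pos
  have htxx := normTrace_eq hxf.pow.orderOf_pos (x := x ^ 2)
  have hty := normTrace_pow hz v
  have htη := normTrace_pow hz (2 * v + 1)
  rw [hxf.orderOf_pow] at htxx
  -- For equal orders `n` the quantity in `hE` depends on `n` alone: it is `0` if `n` is twice an
  -- odd number, at most `1/4` if `4 ∣ n` and `n ≠ 4`, and `-2 * rootTrace n` if `n` is odd.
  rcases hord with hn | ⟨ha, hn⟩
  · exfalso
    rw [← hn] at htx htxx horder
    rcases Nat.even_or_odd' (orderOf z) with ⟨b, hb | hb⟩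
    · rw [hb, Nat.gcd_mul_right_left, Nat.mul_div_cancel_left _ two_pos] at htxx
      rcases Nat.even_or_odd' b with ⟨c, hc | hc⟩
      · have h4 : orderOf z = 4 * c := by omega
        rw [h4, rootTrace_four_mul] at htz htx
        rcases Nat.even_or_odd' c with ⟨d, hd | hd⟩
        · rw [show b = 4 * d by omega, rootTrace_four_mul] at htxx
          linarith
        · rw [hc, rootTrace_two_mul ⟨d, hd⟩] at htxx
          by_cases hc1 : c = 1
          · subst hc1
            rw [h4] at hty htη horder
            have hv : v % 4 < 4 := Nat.mod_lt _ (by norm_num)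
            rw [show (v + 1) % 4 = (v % 4 + 1) % 4 by omega] at horder
            interval_cases hv' : v % 4 <;> simp [rootTrace_one, rootTrace_two] at horder hty
            · linarith
            · rw [rootTrace_one] at htxx
              nlinarith
          · have := rootTrace_le_quarter (by omega : 0 < c) hc1 (by omega)
            linarith
      · rw [hb, rootTrace_two_mul ⟨c, hc⟩] at htz htx
        linarith
    · have hodd : Odd (orderOf z) := ⟨b, hb⟩
      have hodd6 : ∀ j, orderOf (z ^ j) ≠ 6 := fun j h6 => by
        have : 6 ∣ orderOf z := h6 ▸ orderOf_pow_dvd j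
        omega
      rw [Nat.Coprime.gcd_eq_one (Nat.coprime_two_right.2 hodd), Nat.div_one] at htxx
      have b2 := normTrace_le_quarter hz.pow hy (hodd6 _)
      have b3 := normTrace_le_quarter hz.pow hη (hodd6 _)
      have hle : rootTrace (orderOf z) ≤ -1 / 2 := by nlinarith
      by_cases o3 : orderOf z = 3
      · rw [o3] at hty htη htz htx htxx
        rw [rootTrace_three] at htz htx htxx
        have hv : v % 3 < 3 := Nat.mod_lt _ (by norm_num)
        interval_cases hv' : v % 3 <;> simp [rootTrace_one, rootTrace_three] at hty <;> nlinarith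
      by_cases o5 : orderOf z = 5
      · rw [o5, rootTrace_five] at hle
        norm_num at hle
      by_cases o7 : orderOf z = 7
      · rw [o7, rootTrace_seven] at hle
        norm_num at hle
      have := neg_eighth_lt_rootTrace hodd o3 o5 o7
      linarith
  -- When the order of `z` is twice the odd order `a` of `x`, the quantity in `hE` is `-4 *
  -- rootTrace a`, so `a` is `3`, `5` or `7`.
  · rw [Nat.Coprime.gcd_eq_one (Nat.coprime_two_right.2 ha), Nat.div_one] at htxx
    rw [hn, rootTrace_two_mul ha] at htz
    by_cases o3 : orderOf x = 3
    · exfalso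
      rw [o3] at hn
      rw [hn, o3] at horder
      rw [hn] at hty htη
      rw [o3, rootTrace_three] at htz htx htxx
      have hv : v % 6 < 6 := Nat.mod_lt _ (by norm_num)
      rw [show (v + 1) % 6 = (v % 6 + 1) % 6 by omega] at horder
      rw [show (2 * v + 1) % 6 = (2 * (v % 6) + 1) % 6 by omega] at htη
      interval_cases hv' : v % 6 <;>
        simp [rootTrace_two, rootTrace_six] at horder hty htη
      · have h32 : (2 * k : ℚ) = 3 := by
          rw [htz, htx, htxx, hty, htη] at htr'
          linarith
        have : 2 * k = 3 := by exact_mod_cast h32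
        omega
      · rw [hty, htη] at htr'
        linarith
    by_cases o5 : orderOf x = 5
    -- The equation `htr'` also admits `k = 2` with `v % 10 = 3`; tracing the undivided equation
    -- removes this case.
    · have htr2 : z ^ (2 * v + 3) + (2 : ℚ) • z ^ (v + 2) + (k : ℚ) • z =
          (k : ℚ) • x ^ 2 + (2 : ℚ) • x + 1 := by
        simp only [Algebra.smul_def, map_natCast, map_ofNat]
        rw [← h, hx]
        ring
      have htr2' := congrArg (normTrace K) htr2
      simp only [map_add, map_smul, normTrace_one, smul_eq_mul] at htr2'
      rw [o5] at hn
      have ht3 := normTrace_pow hz (2 * v + 3)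
      have ht2 := normTrace_pow hz (v + 2)
      rw [hn, o5] at horder
      rw [hn] at hty htη ht2 ht3
      rw [o5, rootTrace_five] at htz htx htxx
      have hv : v % 10 < 10 := Nat.mod_lt _ (by norm_num)
      rw [show (v + 1) % 10 = (v % 10 + 1) % 10 by omega] at horder
      rw [show (v + 2) % 10 = (v % 10 + 2) % 10 by omega] at ht2
      rw [show (2 * v + 1) % 10 = (2 * (v % 10) + 1) % 10 by omega] at htη
      rw [show (2 * v + 3) % 10 = (2 * (v % 10) + 3) % 10 by omega] at ht3
      rw [htz, htx, htxx] at htr' htr2'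
      interval_cases hv' : v % 10 <;>
        simp [rootTrace_two, rootTrace_ten] at horder hty htη ht2 ht3
      · refine Or.inr (Or.inr (Or.inr ⟨?_, hn, by omega⟩))
        have : (k : ℚ) = 2 := by
          rw [hty, htη] at htr'
          linarith
        exact_mod_cast this
      · rw [hty, htη] at htr'
        rw [ht2, ht3] at htr2'
        linarith
      · rw [hty, htη] at htr'
        linarith
      · rw [hty, htη] at htr'
        linarith
    exfalso
    by_cases o7 : orderOf x = 7
    · rw [o7] at hn
      rw [o7, rootTrace_seven] at htz htx htxx
      have hodd6 : ∀ j, orderOf (z ^ j) ≠ 6 := fun j h6 => by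
        have : 6 ∣ orderOf z := h6 ▸ orderOf_pow_dvd j
        omega
      have b2 := normTrace_le_quarter hz.pow hy (hodd6 _)
      have b3 := normTrace_le_quarter hz.pow hη (hodd6 _)
      nlinarith
    have := neg_eighth_lt_rootTrace ha o3 o5 o7
    linarith

end classificationOdd

/-! ### The cyclotomic part of the denominator -/

section cyclotomicFactors

theorem cyclotomic_four_int : cyclotomic 4 ℤ = X ^ 2 + 1 := by
  rw [show 4 = 2 ^ (1 + 1) from rfl, cyclotomic_prime_pow_eq_geom_sum Nat.prime_two]
  simp [Finset.sum_range_succ, add_comm]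

theorem cyclotomic_ten_int : cyclotomic 10 ℤ = X ^ 4 - X ^ 3 + X ^ 2 - X + 1 := by
  have h := cyclotomic_expand_eq_cyclotomic_mul Nat.prime_two (n := 5) (by norm_num) ℤ
  have h5 : cyclotomic 5 ℤ = X ^ 4 + X ^ 3 + X ^ 2 + X + 1 := by
    have := Fact.mk Nat.prime_five
    rw [cyclotomic_prime]
    simp only [Finset.sum_range_succ, Finset.sum_range_zero]
    ring
  refine mul_right_cancel₀ (cyclotomic_ne_zero 5 ℤ) ?_
  rw [show 10 = 5 * 2 from rfl, ← h, h5]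
  simp only [map_add, map_pow, expand_X, map_one]
  ring

/-- The orders of the roots of unity among the roots of the denominator. -/
def IsRootOrder (ℓ m n : ℕ) : Prop :=
  (n = 2 ∧ m % 4 = 2) ∨ (n = 6 ∧ (ℓ = 3 ∧ m % 12 = 4 ∨ ℓ = 5 ∧ m % 12 = 3)) ∨
  (n = 3 ∧ ℓ = 3 ∧ m % 6 = 3) ∨ (n = 10 ∧ ℓ = 3 ∧ m % 20 = 5) ∨ (n = 4 ∧ ℓ = 4 ∧ m % 8 = 3)

-- The two conditions for order `6` exclude each other through `ℓ`, so their factors merge into a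
-- single cyclotomic one.
open Classical in
theorem prod_cyclotomic_rootOrder (ℓ m : ℕ) :
    (if m % 4 = 2 then X + 1 else 1) * exceptionalFactor ℓ m
      = ∏ n ∈ ({2, 3, 4, 6, 10} : Finset ℕ) with IsRootOrder ℓ m n, cyclotomic n ℤ := by
  rw [Finset.prod_filter, Finset.prod_insert (by decide), Finset.prod_insert (by decide),
    Finset.prod_insert (by decide), Finset.prod_insert (by decide), Finset.prod_singleton,
    cyclotomic_two, cyclotomic_three, cyclotomic_four_int, cyclotomic_six, cyclotomic_ten_int,
    if_congr (show IsRootOrder ℓ m 2 ↔ m % 4 = 2 by simp [IsRootOrder]) rfl rfl,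
    if_congr (show IsRootOrder ℓ m 3 ↔ ℓ = 3 ∧ m % 6 = 3 by simp [IsRootOrder]) rfl rfl,
    if_congr (show IsRootOrder ℓ m 4 ↔ ℓ = 4 ∧ m % 8 = 3 by simp [IsRootOrder]) rfl rfl,
    if_congr (show IsRootOrder ℓ m 10 ↔ ℓ = 3 ∧ m % 20 = 5 by simp [IsRootOrder]) rfl rfl]
  have h6 : (if IsRootOrder ℓ m 6 then X ^ 2 - X + 1 else 1 : ℤ[X]) =
      (if ℓ = 3 ∧ m % 12 = 4 then X ^ 2 - X + 1 else 1) *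
        (if ℓ = 5 ∧ m % 12 = 3 then X ^ 2 - X + 1 else 1) := by
    have : IsRootOrder ℓ m 6 ↔ ℓ = 3 ∧ m % 12 = 4 ∨ ℓ = 5 ∧ m % 12 = 3 := by simp [IsRootOrder]
    rw [if_congr this rfl rfl]
    split_ifs <;> first | (exfalso; omega) | simp
  rw [h6, exceptionalFactor]
  ring

theorem cyclotomic_dvd_of_aeval_eq_zero {z : ℂ} {n : ℕ} (hn : 0 < n) (hz : IsPrimitiveRoot z n)
    {f : ℤ[X]} (hf : aeval z f = 0) : cyclotomic n ℤ ∣ f := by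
  rw [cyclotomic_eq_minpoly hz hn]
  exact minpoly.isIntegrallyClosed_dvd (hz.isIntegral hn) hf

theorem aeval_one_growthDenom_ne_zero {ℓ m : ℕ} (hℓ : 3 ≤ ℓ) (hm : 3 ≤ m)
    (hyp : 4 < (ℓ - 2) * (m - 2)) : aeval (1 : ℂ) (growthDenom ℓ m) ≠ 0 := by
  have hint : aeval (1 : ℤ) (growthDenom ℓ m) ≠ 0 := by
    obtain ⟨k, w, rfl, hk, ⟨rfl, hw, h⟩ | ⟨rfl, hw, h⟩⟩ := hyperbolic_param hℓ hm hyp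
    · rw [growthDenom_even, aeval_plateau]
      zify [hw, (by omega : 1 ≤ w), (by omega : 1 ≤ k)] at h
      simp [Nat.cast_sub (by omega : 1 ≤ w)]
      intro h0
      nlinarith
    · rw [growthDenom_odd, map_add, aeval_plateau]
      zify [(by omega : 1 ≤ 2 * w), (by omega : 1 ≤ k)] at h
      simp [Nat.cast_sub (by omega : 1 ≤ 2 * w)]
      intro h0
      nlinarith
  intro h
  apply hint
  have h1 := aeval_algebraMap_apply ℂ (1 : ℤ) (growthDenom ℓ m)
  rw [map_one, h] at h1
  simpa using h1.symm

/-- Divisibility by a cyclotomic polynomial does not depend on the field containing the root. This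
carries the trace argument in number fields over to complex roots. -/
theorem isRootOrder_of_cyclotomic_dvd {ℓ m : ℕ} (hℓ : 3 ≤ ℓ) (hm : 3 ≤ m)
    (hyp : 4 < (ℓ - 2) * (m - 2)) {K : Type*} [Field K] [NumberField K] {u : K} {n : ℕ}
    (hn : 1 < n) (hu : IsPrimitiveRoot u n) (h : cyclotomic n ℤ ∣ growthDenom ℓ m) :
    IsRootOrder ℓ m n := by
  have h0 : aeval u (growthDenom ℓ m) = 0 := by
    obtain ⟨g, hg⟩ := h
    have hr := hu.isRoot_cyclotomic (by omega)
    rw [← map_cyclotomic_int, isRoot_map_int_iff] at hr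
    rw [hg, map_mul, hr, zero_mul]
  have huf : IsOfFinOrder u := isOfFinOrder_iff_pow_eq_one.2 ⟨n, by omega, hu.pow_eq_one⟩
  have hu1 : u ≠ 1 := hu.ne_one hn
  have ho := hu.eq_orderOf
  obtain ⟨k, w, rfl, hk, ⟨rfl, hw, -⟩ | ⟨rfl, hw, -⟩⟩ := hyperbolic_param hℓ hm hyp
  · have he := aeval_even k (by omega : 1 ≤ w) u
    rw [h0, zero_mul, eq_comm, sub_eq_zero] at he
    rcases rootOfUnity_even hk (by omega) huf hu1 he with ⟨hneg, hw2⟩ | ⟨hk2, h6, hw6⟩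
    · have h2 : n = 2 := by
        rw [ho, hneg]
        exact orderOf_eq_prime (by norm_num) (by norm_num)
      exact Or.inl ⟨h2, by omega⟩
    · exact Or.inr (Or.inl ⟨by omega, by omega⟩)
  · have he := aeval_odd k (by omega : 1 ≤ w) u
    rw [h0, zero_mul, eq_comm, sub_eq_zero] at he
    rw [IsRootOrder]
    rcases rootOfUnity_odd hk hw huf hu1 he with ⟨hk', o, h'⟩ | ⟨hk', o, h'⟩ | ⟨hk', o, h'⟩ |
      ⟨hk', o, h'⟩ <;> rw [← ho] at o <;> subst hk' o <;> simp <;> omega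

open IntermediateField in
theorem isRootOrder_of_aeval_eq_zero {ℓ m : ℕ} (hℓ : 3 ≤ ℓ) (hm : 3 ≤ m)
    (hyp : 4 < (ℓ - 2) * (m - 2)) {z : ℂ} {n : ℕ} (hn : 0 < n) (hz : IsPrimitiveRoot z n)
    (h : aeval z (growthDenom ℓ m) = 0) : IsRootOrder ℓ m n := by
  have hn1 : n ≠ 1 := by
    rintro rfl
    rw [IsPrimitiveRoot.one_right_iff.1 hz] at h
    exact aeval_one_growthDenom_ne_zero hℓ hm hyp h
  have := IntermediateField.adjoin.finiteDimensional (K := ℚ) (hz.isIntegral hn).tower_top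
  have : NumberField ℚ⟮z⟯ := ⟨⟩
  have hu : IsPrimitiveRoot (IntermediateField.AdjoinSimple.gen ℚ z) n :=
    hz.of_map_of_injective (f := ℚ⟮z⟯.val) ℚ⟮z⟯.val.injective
  exact isRootOrder_of_cyclotomic_dvd hℓ hm hyp (by omega) hu
    (cyclotomic_dvd_of_aeval_eq_zero hn hz h)

theorem aeval_eq_zero_of_isRootOrder {ℓ m : ℕ} (hℓ : 3 ≤ ℓ) (hm : 3 ≤ m)
    (hyp : 4 < (ℓ - 2) * (m - 2)) {z : ℂ} {n : ℕ} (hz : IsPrimitiveRoot z n)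
    (h : IsRootOrder ℓ m n) : aeval z (growthDenom ℓ m) = 0 := by
  have hn1 : 1 < n := by unfold IsRootOrder at h; omega
  have hz1 : z - 1 ≠ 0 := sub_ne_zero.2 (hz.ne_one hn1)
  refine (mul_eq_zero.1 ?_).resolve_right hz1
  have hc := hz.isRoot_cyclotomic (by omega)
  rw [← map_cyclotomic_int, isRoot_map_int_iff] at hc
  have hpow := hz.pow_eq_one
  obtain ⟨k, w, rfl, hk, ⟨rfl, hw, -⟩ | ⟨rfl, hw, -⟩⟩ := hyperbolic_param hℓ hm hyp
  · rw [aeval_even k (by omega : 1 ≤ w) z, pow_eq_pow_mod w hpow]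
    rcases h with ⟨rfl, h⟩ | ⟨rfl, h⟩ | ⟨rfl, h⟩ | ⟨rfl, h⟩ | ⟨rfl, h⟩
    · rw [cyclotomic_two] at hc
      simp at hc
      rw [show w % 2 = 1 by omega]
      linear_combination (z - 1) * hc
    · rw [cyclotomic_six] at hc
      simp at hc
      rw [show w % 6 = 2 by omega, show k = 2 by omega]
      push_cast
      linear_combination (z - 1) * hc
    all_goals omega
  · rw [aeval_odd k hw z, pow_eq_pow_mod w hpow]
    rcases h with ⟨rfl, h⟩ | ⟨rfl, h⟩ | ⟨rfl, h⟩ | ⟨rfl, h⟩ | ⟨rfl, h⟩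
    · omega
    · rw [cyclotomic_six] at hc
      simp at hc
      rw [show w % 6 = 1 by omega, show k = 4 by omega]
      push_cast
      linear_combination (z - 1) * hc
    · rw [cyclotomic_three] at hc
      simp at hc
      rw [show w % 3 = 1 by omega, show k = 2 by omega]
      push_cast
      linear_combination (z - 1) * hc
    · rw [cyclotomic_ten_int] at hc
      simp at hc
      rw [show w % 10 = 2 by omega, show k = 2 by omega]
      push_cast
      linear_combination (z - 1) * hc
    · rw [cyclotomic_four_int] at hc
      simp at hc
      rw [show w % 4 = 1 by omega, show k = 3 by omega]
      push_cast
      linear_combination (z - 1) * hc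

/-- Distinct cyclotomic polynomials are relatively prime, so the product of those with a root in
common with the denominator divides it; `irreducible_cofactor` then applies to the quotient. -/
theorem growthDenom_factor {ℓ m : ℕ} (hℓ : 3 ≤ ℓ) (hm : 3 ≤ m) (hyp : 4 < (ℓ - 2) * (m - 2)) :
    ∃ S : ℤ[X], Irreducible S ∧
      growthDenom ℓ m = (if m % 4 = 2 then X + 1 else 1) * exceptionalFactor ℓ m * S := by
  classical
  rw [prod_cyclotomic_rootOrder]
  set N : Finset ℕ := ({2, 3, 4, 6, 10} : Finset ℕ).filter (IsRootOrder ℓ m) with hN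
  have hpos : ∀ n ∈ N, 0 < n := by
    intro n hn
    have := (Finset.mem_filter.1 hn).2
    unfold IsRootOrder at this
    omega
  have hdvd : ∏ n ∈ N, cyclotomic n ℤ ∣ growthDenom ℓ m := by
    refine Finset.prod_dvd_of_isRelPrime (fun i hi j hj hij => ?_) fun n hn => ?_
    · rw [Function.onFun, (cyclotomic.irreducible (hpos i hi)).isRelPrime_iff_not_dvd]
      intro hdvd
      exact hij (cyclotomic_injective (eq_of_monic_of_associated (cyclotomic.monic i ℤ)
        (cyclotomic.monic j ℤ) ((cyclotomic.irreducible (hpos i hi)).associated_of_dvd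
          (cyclotomic.irreducible (hpos j hj)) hdvd)))
    · have hz := Complex.isPrimitiveRoot_exp n (hpos n hn).ne'
      exact cyclotomic_dvd_of_aeval_eq_zero (hpos n hn) hz
        (aeval_eq_zero_of_isRootOrder hℓ hm hyp hz (Finset.mem_filter.1 hn).2)
  obtain ⟨S, hS⟩ := hdvd
  refine ⟨S, ?_, hS⟩
  have hmonic : (∏ n ∈ N, cyclotomic n ℤ).Monic :=
    monic_prod_of_monic _ _ fun n _ => cyclotomic.monic n ℤ
  obtain ⟨b, -, -, h0, -⟩ := growthDenom_coeff (ℓ := ℓ) hm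
  refine irreducible_cofactor (growthDenom_monic ℓ hm) (by rw [h0]; exact isUnit_one) hS hmonic
    ?_ ?_ ?_ ?_ ?_ ?_
  · intro z hz
    rw [map_prod, Finset.prod_eq_zero_iff] at hz
    obtain ⟨n, hn, hz⟩ := hz
    have := NeZero.mk (hpos n hn).ne'
    have hr : IsPrimitiveRoot z n := by
      rw [← isRoot_cyclotomic_iff, ← map_cyclotomic_int, isRoot_map_int_iff]
      exact hz
    exact (hr.norm'_eq_one (hpos n hn).ne').le
  · obtain ⟨z, hz, h, -⟩ := growthDenom_exists_root hℓ hm hyp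
    exact ⟨z, hz, h⟩
  · exact fun u v => growthDenom_eq_of_one_lt_norm hℓ hm hyp
  · intro u hu hu0
    obtain ⟨z, hz, hz0, hz1⟩ := growthDenom_exists_root hℓ hm hyp
    rwa [growthDenom_eq_of_one_lt_norm hℓ hm hyp hu hz hu0 hz0]
  · exact fun z => growthDenom_simple_of_norm_one hℓ hm hyp
  · intro z n hn hz h
    have h' := isRootOrder_of_aeval_eq_zero hℓ hm hyp hn hz h
    rw [map_prod]
    refine Finset.prod_eq_zero (i := n) ?_ ?_
    · rw [hN, Finset.mem_filter]
      refine ⟨?_, h'⟩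
      unfold IsRootOrder at h'
      simp only [Finset.mem_insert, Finset.mem_singleton]
      omega
    · have hc := hz.isRoot_cyclotomic hn
      rwa [← map_cyclotomic_int, isRoot_map_int_iff] at hc

end cyclotomicFactors

theorem theorem1 (ℓ m : ℕ) (hℓ : 3 ≤ ℓ) (hm : 3 ≤ m) (hyp : 4 < (ℓ - 2) * (m - 2)) :
    (∀ x₀ : TessVertex ℓ m,
      growthSeries (tessGraph ℓ m) x₀ * (growthDenom ℓ m : PowerSeries ℤ)
        = (growthNum m : PowerSeries ℤ)) ∧
    IsReciprocalPoly (growthDenom ℓ m) ∧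
    IsSalemPoly (growthDenom ℓ m) ∧
    ∃ S : ℤ[X], Irreducible S ∧
      growthDenom ℓ m = (if m % 4 = 2 then X + 1 else 1) * exceptionalFactor ℓ m * S := by
  exact ⟨LayerData.growthSeries_mul_growthDenom hℓ hm hyp, growthDenom_reciprocal ℓ hm,
    growthDenom_salem hℓ hm hyp, growthDenom_factor hℓ hm hyp⟩
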